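/- **Setting.** A local system is a finite-dimensional Hilbert space $H=\bigoplus_n H_n$ graded by particle number, with number operator $\hat N$. A pure bipartite state $\varphi\in H^A\otimes H^B$ is a unit vector of definite total particle number $K$. Let $E(\varphi)$ be its entropy of entanglement in bits, $\mu=\langle\varphi|\hat N_A|\varphi\rangle$, and $V(\varphi)=4\big(\langle\varphi|\hat N_A^2|\varphi\rangle-\mu^2\big)$ its superselection induced variance (SiV). Let $S(\varphi)$ be the set of values of Alice's particle number that occur in $\varphi$ with non-zero amplitude, and let $L(\varphi)=d\mathbb Z$ be the subgroup of $\mathbb Z$ generated by the differences of elements of $S(\varphi)$. (So $d=1$ if these values have no common period, and $d=0$ if and only if $V(\varphi)=0$.) An SSR-respecting LOCC protocol is a finite sequence of local measurements by Alice or Bob, each depending on the earlier outcomes, whose Kraus operators satisfy $\sum_iK_i^\dagger K_i=1$ and map, for every $n$, the $n$-particle sector of the input space to the $(n+q_i)$-particle sector of the output space, with $q_i\in\mathbb Z$ independent of $n$ (that is, measurements commuting with the local particle number, together with adding and discarding local ancillas of definite particle number). Sequences of states satisfy $\psi_N\to\tau_N$ if for every $\varepsilon>0$ and all large $N$ some such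 protocol turns $\psi_N$ into a state $\rho$ with $\langle\tau_N|\rho|\tau_N\rangle\ge1-\varepsilon$. Let $\omega=\frac1{\sqrt2}\big(|01\rangle_A|10\rangle_B+|10\rangle_A|01\rangle_B\big)$, and let $$G_N(\varphi)=\sum_{n=0}^{NK}c_n\,|n\rangle_A|NK-n\rangle_B,\qquad |n\rangle=|\underbrace{1\cdots1}_{n}0\cdots0\rangle\ \text{ on } NK \text{ modes},$$ with Gaussian coefficients of SiV $NV(\varphi)$: $c_n\ge0$, $\sum_nc_n^2=1$, and $$c_n^2\propto\exp\!\Big(-\frac{(n-N\mu)^2}{2\sigma_N^2}\Big),\qquad \sigma_N^2=\frac{NV(\varphi)}4,$$ for those $n$ with $n-Nk\in L(\varphi)$ for $k\in S(\varphi)$, and $c_n=0$ for the other $n$. (If $d=1$ there is no restriction on $n$; if $V(\varphi)=0$, only $n=N\mu$ remains, with $c_n=1$.) **Theorem.** (i) For every pure bipartite state $\varphi$ of definite total particle number and every $\delta>0$, there are asymptotic conversions by SSR-respecting LOCC $$\varphi^{\otimes N}\to\omega^{\otimes\lfloor N(E(\varphi)-\delta)\rfloor}\otimes G_N(\varphi),\qquad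 \omega^{\otimes\lceil N(E(\varphi)+\delta)\rceil}\otimes G_N(\varphi)\to\varphi^{\otimes N},$$ where $\lfloor x\rfloor$ is read as $0$ for $x<0$. That is, $\varphi^{\otimes N}\leftrightarrow\omega^{\otimes NE(\varphi)}\otimes G_N(\varphi)$ asymptotically reversibly. (ii) Consequently, entropy of entanglement and SiV characterize pure states asymptotically: if $E(\varphi)=E(\varphi')$, $V(\varphi)=V(\varphi')$ and $L(\varphi)=L(\varphi')$, then $\varphi^{\otimes N}\to\varphi'^{\otimes\lfloor(1-\delta)N\rfloor}$ for every $\delta>0$ (with the same reading of $\lfloor x\rfloor$ for $x<0$), and likewise with $\varphi$ and $\varphi'$ exchanged. -/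

import Mathlib

open Filter Topology
open scoped Matrix

noncomputable section

namespace SSR

/-- A finite-dimensional local Hilbert space `⨁ₙ Hₙ` graded by particle number, given by an
orthonormal basis of eigenvectors of the local particle number operator: the basis vector `x`
contains `num x` particles. -/
structure LocalSystem where
  carrier : Type
  [fintype : Fintype carrier]
  [decEq : DecidableEq carrier]
  num : carrier → ℕ

instance : CoeSort LocalSystem Type := ⟨LocalSystem.carrier⟩
instance (A : LocalSystem) : Fintype A := A.fintype
instance (A : LocalSystem) : DecidableEq A := A.decEq

/-- Tensor product of two systems; particle numbers add. -/
def LocalSystem.tensor (A A' : LocalSystem) : LocalSystem where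
  carrier := A × A'
  num x := A.num x.1 + A'.num x.2

/-- `N`-fold tensor power of a system; particle numbers add. -/
def LocalSystem.pow (A : LocalSystem) (N : ℕ) : LocalSystem where
  carrier := Fin N → A
  num x := ∑ j, A.num (x j)

/-- A single mode, with basis `|0⟩, |1⟩` (empty, occupied by one particle). -/
def mode : LocalSystem where
  carrier := Fin 2
  num i := i.val

/-- A (normalized) pure state `∑ amp a b |a⟩_A |b⟩_B` of a bipartite system, with support in the
superselection sector of `total` particles. -/
structure PureState (A B : LocalSystem) where
  amp : Matrix A B ℂ
  norm_one : ∑ a, ∑ b, ‖amp a b‖ ^ 2 = 1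
  total : ℕ
  sector : ∀ a b, amp a b ≠ 0 → A.num a + B.num b = total

namespace PureState

variable {A B A' B' : LocalSystem}

/-- The reduced density matrix `tr_B |ψ⟩⟨ψ|` of Alice is Hermitian. -/
theorem reduced_isHermitian (ψ : PureState A B) : (ψ.amp * ψ.ampᴴ).IsHermitian :=
  Matrix.isHermitian_mul_conjTranspose_self ψ.amp

/-- Entropy of entanglement: the von Neumann entropy, in bits, of Alice's reduced density
matrix. -/
def entropy (ψ : PureState A B) : ℝ :=
  ∑ i, Real.negMulLog (ψ.reduced_isHermitian.eigenvalues i) / Real.log 2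

/-- `⟨ψ| N_A ⊗ 1 |ψ⟩`. -/
def meanNum (ψ : PureState A B) : ℝ := ∑ a, ∑ b, (A.num a : ℝ) * ‖ψ.amp a b‖ ^ 2

/-- `⟨ψ| N_A² ⊗ 1 |ψ⟩`. -/
def meanNumSq (ψ : PureState A B) : ℝ := ∑ a, ∑ b, (A.num a : ℝ) ^ 2 * ‖ψ.amp a b‖ ^ 2

/-- Superselection induced variance. -/
def siv (ψ : PureState A B) : ℝ := 4 * (ψ.meanNumSq - ψ.meanNum ^ 2)

/-- The values of Alice's local particle number that occur in `ψ`. -/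
def occurring (ψ : PureState A B) : Set ℕ := {n | ∃ a b, ψ.amp a b ≠ 0 ∧ A.num a = n}

/-- The subgroup `dℤ` of `ℤ` generated by the differences of the local particle numbers that occur
in `ψ`. It is `ℤ` if these numbers have no common period, and `0` if only one number occurs. -/
def numLattice (ψ : PureState A B) : AddSubgroup ℤ :=
  AddSubgroup.closure {z | ∃ m ∈ ψ.occurring, ∃ n ∈ ψ.occurring, z = (m : ℤ) - n}

/-- Tensor product of bipartite pure states (Alice's parts together, Bob's parts together). -/
def tensor (ψ : PureState A B) (χ : PureState A' B') :
    PureState (A.tensor A') (B.tensor B') where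
  amp := fun a b => ψ.amp a.1 b.1 * χ.amp a.2 b.2
  norm_one := by
    have h : ∑ a : A × A', ∑ b : B × B', ‖ψ.amp a.1 b.1 * χ.amp a.2 b.2‖ ^ 2 = 1 := by
      simp only [Fintype.sum_prod_type, norm_mul, mul_pow, ← Finset.mul_sum, ← Finset.sum_mul,
        χ.norm_one, ψ.norm_one, mul_one]
    exact h
  total := ψ.total + χ.total
  sector := by
    intro a b h
    have h1 := ψ.sector _ _ (left_ne_zero_of_mul h)
    have h2 := χ.sector _ _ (right_ne_zero_of_mul h)
    change A.num a.1 + A'.num a.2 + (B.num b.1 + B'.num b.2) = _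
    omega

/-- `N` copies of a bipartite pure state. -/
def pow (ψ : PureState A B) (N : ℕ) : PureState (A.pow N) (B.pow N) where
  amp := fun a b => ∏ j, ψ.amp (a j) (b j)
  norm_one := by
    have h : ∑ a : Fin N → A, ∑ b : Fin N → B, ‖∏ j, ψ.amp (a j) (b j)‖ ^ 2 = 1 := by
      simp only [norm_prod, ← Finset.prod_pow]
      have h1 : ∀ a : Fin N → A, ∑ b : Fin N → B, ∏ j, ‖ψ.amp (a j) (b j)‖ ^ 2
          = ∏ j, ∑ b, ‖ψ.amp (a j) b‖ ^ 2 := fun a =>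
        (Fintype.prod_sum fun j b => ‖ψ.amp (a j) b‖ ^ 2).symm
      simp only [h1]
      rw [← Fintype.prod_sum fun (_ : Fin N) a => ∑ b, ‖ψ.amp a b‖ ^ 2]
      simp [ψ.norm_one]
    exact h
  total := N * ψ.total
  sector := by
    intro a b h
    change ∑ j, A.num (a j) + ∑ j, B.num (b j) = _
    rw [← Finset.sum_add_distrib]
    rw [Finset.sum_congr rfl fun j _ =>
      ψ.sector (a j) (b j) (Finset.prod_ne_zero_iff.1 h j (Finset.mem_univ j))]
    simp

end PureState

/-- The normalized state `(|01⟩_A |10⟩_B + |10⟩_A |01⟩_B) / √2` of two modes at each side. -/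
def ebit : PureState (mode.tensor mode) (mode.tensor mode) where
  amp := fun (a b : Fin 2 × Fin 2) =>
    if (a = (0, 1) ∧ b = (1, 0)) ∨ (a = (1, 0) ∧ b = (0, 1)) then ((1 / √2 : ℝ) : ℂ) else 0
  norm_one := by
    have h : ∑ a : Fin 2 × Fin 2, ∑ b : Fin 2 × Fin 2,
        ‖(if (a = (0, 1) ∧ b = (1, 0)) ∨ (a = (1, 0) ∧ b = (0, 1))
          then ((1 / √2 : ℝ) : ℂ) else 0)‖ ^ 2 = 1 := by
      have h2 : ((√2)⁻¹ : ℝ) ^ 2 = 1 / 2 := by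
        rw [inv_pow, Real.sq_sqrt (by norm_num)]; norm_num
      simp [Fintype.sum_prod_type, Fin.sum_univ_two]
      norm_num
    exact h
  total := 2
  sector := by
    intro a b h
    change a.1.val + a.2.val + (b.1.val + b.2.val) = 2
    have h' : (a = ((0 : Fin 2), (1 : Fin 2)) ∧ b = ((1 : Fin 2), (0 : Fin 2))) ∨
        (a = ((1 : Fin 2), (0 : Fin 2)) ∧ b = ((0 : Fin 2), (1 : Fin 2))) := by
      by_contra hc
      exact h (if_neg hc)
    rcases h' with ⟨rfl, rfl⟩ | ⟨rfl, rfl⟩ <;> rfl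

/-- The state `|n⟩ = |1⋯10⋯0⟩` of `M` modes, with `n` ones. -/
def fock (M n : ℕ) : mode.pow M := fun j => if j.val < n then (1 : Fin 2) else (0 : Fin 2)

theorem num_fock {M n : ℕ} (h : n ≤ M) : (mode.pow M).num (fock M n) = n := by
  change ∑ j : Fin M, (if j.val < n then (1 : Fin 2) else (0 : Fin 2)).val = n
  have : ∀ j : Fin M, (if j.val < n then (1 : Fin 2) else (0 : Fin 2)).val
      = if j.val < n then 1 else 0 := by
    intro j; split_ifs <;> rfl
  simp only [this]
  rw [Finset.sum_boole, Nat.cast_id]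
  simp [Fin.card_filter_val_lt, h]

theorem fock_injective {M m n : ℕ} (hm : m ≤ M) (hn : n ≤ M) (h : fock M m = fock M n) :
    m = n := by
  rw [← num_fock hm, ← num_fock hn, h]

/-- The state `∑ₙ c n |n⟩_A |M - n⟩_B`, where `0 ≤ n ≤ M`. -/
def fockSum (M : ℕ) (c : Fin (M + 1) → ℂ) (hc : ∑ n, ‖c n‖ ^ 2 = 1) :
    PureState (mode.pow M) (mode.pow M) where
  amp := fun a b => ∑ n : Fin (M + 1), if a = fock M n ∧ b = fock M (M - n) then c n else 0
  norm_one := by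
    have key : ∀ a b : mode.pow M,
        ‖∑ n : Fin (M + 1), if a = fock M n ∧ b = fock M (M - n) then c n else 0‖ ^ 2
          = ∑ n : Fin (M + 1), if a = fock M n ∧ b = fock M (M - n) then ‖c n‖ ^ 2 else 0 := by
      intro a b
      by_cases h : ∃ n : Fin (M + 1), a = fock M n ∧ b = fock M (M - n)
      · obtain ⟨n, rfl, rfl⟩ := h
        rw [Finset.sum_eq_single n, Finset.sum_eq_single n]
        · simp
        · intro m _ hm
          exact if_neg fun h => hm
            (Fin.ext (fock_injective (by omega) (by omega) h.1)).symm
        · simp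
        · intro m _ hm
          exact if_neg fun h => hm
            (Fin.ext (fock_injective (by omega) (by omega) h.1)).symm
        · simp
      · push Not at h
        rw [Finset.sum_eq_zero, Finset.sum_eq_zero]
        · simp
        · intro n _; exact if_neg fun hn => h n hn.1 hn.2
        · intro n _; exact if_neg fun hn => h n hn.1 hn.2
    simp only [key]
    rw [← hc]
    calc ∑ a : mode.pow M, ∑ b : mode.pow M, ∑ n : Fin (M + 1),
          (if a = fock M n ∧ b = fock M (M - n) then ‖c n‖ ^ 2 else 0)
        = ∑ n : Fin (M + 1), ∑ a : mode.pow M, ∑ b : mode.pow M,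
          (if a = fock M n ∧ b = fock M (M - n) then ‖c n‖ ^ 2 else 0) := by
          rw [Finset.sum_comm]
          refine (Finset.sum_congr rfl fun a _ => Finset.sum_comm).trans ?_
          exact (Finset.sum_congr rfl fun b _ => Finset.sum_congr rfl fun n _ => rfl).trans
            ((Finset.sum_comm).trans (Finset.sum_congr rfl fun n _ => Finset.sum_comm))
      _ = ∑ n, ‖c n‖ ^ 2 := by
          refine Finset.sum_congr rfl fun n _ => ?_
          simp [ite_and]
  total := M
  sector := by
    intro a b h
    obtain ⟨n, _, hn⟩ := Finset.exists_ne_zero_of_sum_ne_zero h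
    have h' : a = fock M n ∧ b = fock M (M - n) := by
      by_contra hc
      exact hn (if_neg hc)
    have hnM : n.val ≤ M := Nat.le_of_lt_succ n.isLt
    rw [h'.1, h'.2, num_fock hnM, num_fock (Nat.sub_le M n)]
    exact Nat.add_sub_cancel' hnM

namespace PureState

variable {A B : LocalSystem}

open Classical in
/-- Unnormalized Gaussian weight of `n`, with mean `N ⟨N_A⟩` and variance `N V(φ) / 4`, on those `n`
that are congruent to the values of Alice's local particle number in `N` copies of `φ`. (If
`V(φ) = 0`, only one such `n` exists, and its weight is `1`.) -/
def gaussianWeight (φ : PureState A B) (N n : ℕ) : ℝ :=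
  if ∀ k ∈ φ.occurring, (n : ℤ) - N * k ∈ φ.numLattice then
    Real.exp (-((n : ℝ) - N * φ.meanNum) ^ 2 / (2 * (N * φ.siv / 4)))
  else 0

/-- The normalized Gaussian amplitudes: `c n ^ 2` is proportional to the Gaussian weight. -/
def gaussianCoeff (φ : PureState A B) (N : ℕ) (n : Fin (N * φ.total + 1)) : ℂ :=
  (√(φ.gaussianWeight N n / ∑ m : Fin (N * φ.total + 1), φ.gaussianWeight N m) : ℝ)

theorem gaussianWeight_nonneg (φ : PureState A B) (N n : ℕ) : 0 ≤ φ.gaussianWeight N n := by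
  unfold gaussianWeight
  split_ifs
  · positivity
  · exact le_rfl

theorem gaussianWeight_sum_pos (φ : PureState A B) (N : ℕ) :
    0 < ∑ m : Fin (N * φ.total + 1), φ.gaussianWeight N m := by
  obtain ⟨a, b, hab⟩ : ∃ a b, φ.amp a b ≠ 0 := by
    by_contra h
    push Not at h
    simpa [h] using φ.norm_one
  have hle : A.num a ≤ φ.total := by have := φ.sector a b hab; omega
  have hlt : N * A.num a < N * φ.total + 1 := Nat.lt_succ_of_le (Nat.mul_le_mul_left N hle)
  refine Finset.sum_pos' (fun m _ => φ.gaussianWeight_nonneg N m)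
    ⟨⟨N * A.num a, hlt⟩, Finset.mem_univ _, ?_⟩
  unfold gaussianWeight
  rw [if_pos]
  · positivity
  · intro k hk
    have : (((N * A.num a : ℕ) : ℤ) - N * k) = (N : ℤ) • ((A.num a : ℤ) - k) := by
      simp [mul_sub]
    change ((N * A.num a : ℕ) : ℤ) - N * k ∈ _
    rw [this]
    have hmem : ((A.num a : ℤ) - k) ∈ φ.numLattice := by
      apply AddSubgroup.subset_closure
      exact ⟨A.num a, ⟨a, b, hab, rfl⟩, k, hk, rfl⟩
    exact AddSubgroup.zsmul_mem _ hmem _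

theorem gaussianCoeff_norm (φ : PureState A B) (N : ℕ) :
    ∑ n, ‖φ.gaussianCoeff N n‖ ^ 2 = 1 := by
  have hS := φ.gaussianWeight_sum_pos N
  have : ∀ n : Fin (N * φ.total + 1), ‖φ.gaussianCoeff N n‖ ^ 2
      = φ.gaussianWeight N n / ∑ m : Fin (N * φ.total + 1), φ.gaussianWeight N m := by
    intro n
    unfold gaussianCoeff
    rw [Complex.norm_real, Real.norm_eq_abs, sq_abs, Real.sq_sqrt]
    exact div_nonneg (φ.gaussianWeight_nonneg N n) hS.le
  simp only [this]
  rw [← Finset.sum_div, div_self hS.ne']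

/-- The state `∑ₙ cₙ |n⟩_A |N K - n⟩_B`, with `K` the particle number of `φ` and Gaussian
coefficients of superselection induced variance `N V(φ)`. -/
def gaussian (φ : PureState A B) (N : ℕ) :
    PureState (mode.pow (N * φ.total)) (mode.pow (N * φ.total)) :=
  fockSum (N * φ.total) (φ.gaussianCoeff N) (φ.gaussianCoeff_norm N)

end PureState

/-- A local measurement that respects the superselection rule, from the system `A` to a system
`out i` that may depend on the outcome `i`. Each Kraus operator sends the sector of `n` particles
to the sector of `n + q` particles, with `q` independent of `n`: these are the compositions of
appending a local ancilla with definite particle number, a measurement whose operators commute with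
the local particle number, and discarding a subsystem whose particle number is measured. -/
structure IsInstrument (A : LocalSystem) {k : ℕ} (out : Fin k → LocalSystem)
    (K : ∀ i, Matrix (out i) A ℂ) : Prop where
  complete : ∑ i, (K i)ᴴ * K i = 1
  charge : ∀ i, ∃ q : ℤ, ∀ x y, K i x y ≠ 0 → ((out i).num x : ℤ) = A.num y + q

/-- Protocols of local operations and classical communication that respect the superselection rule,
from the system `A, B` (the last two arguments) to the system `A', B'` (the first two). In each
step Alice or Bob performs a local measurement, and the rest of the protocol depends on the
outcome, which is communicated to the other party. -/
inductive LOCC (A' B' : LocalSystem) : LocalSystem → LocalSystem → Type 1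
  | done : LOCC A' B' A' B'
  | alice {A B : LocalSystem} {k : ℕ} (out : Fin k → LocalSystem)
      (K : ∀ i, Matrix (out i) A ℂ) (hK : IsInstrument A out K)
      (next : ∀ i, LOCC A' B' (out i) B) : LOCC A' B' A B
  | bob {A B : LocalSystem} {k : ℕ} (out : Fin k → LocalSystem)
      (K : ∀ i, Matrix (out i) B ℂ) (hK : IsInstrument B out K)
      (next : ∀ i, LOCC A' B' A (out i)) : LOCC A' B' A B

/-- The fidelity `⟨τ| ρ |τ⟩` of the output `ρ` of the protocol, run on the vector `ψ`, with the
vector `τ`: the sum over all branches of `|⟨τ|v⟩|²`, where `v` is the unnormalized vector that the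
branch ends with. -/
def LOCC.fidelity {A' B' : LocalSystem} (τ : Matrix A' B' ℂ) :
    {A B : LocalSystem} → LOCC A' B' A B → Matrix A B ℂ → ℝ
  | _, _, .done, ψ => ‖∑ a, ∑ b, star (τ a b) * ψ a b‖ ^ 2
  | _, _, .alice _ K _ next, ψ => ∑ i, (next i).fidelity τ (K i * ψ)
  | _, _, .bob _ K _ next, ψ => ∑ i, (next i).fidelity τ (ψ * (K i)ᵀ)

/-- The states `ψ N` can be converted into the states `τ N` by protocols of local operations and
classical communication that respect the superselection rule, with a fidelity that tends to `1` as
`N → ∞`. -/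
def AsymptoticallyConvertible {A B A' B' : ℕ → LocalSystem}
    (ψ : ∀ N, PureState (A N) (B N)) (τ : ∀ N, PureState (A' N) (B' N)) : Prop :=
  ∀ ε : ℝ, 0 < ε → ∀ᶠ N in atTop, ∃ P : LOCC (A' N) (B' N) (A N) (B N),
    1 - ε ≤ P.fidelity (τ N).amp (ψ N).amp

end SSR

end

/-! Since the total particle number is fixed, Alice's reduced state commutes with her particle
number, so a state is, up to local graded isometries, a family of Schmidt weights `p x` labelled by
particle numbers `n x`. Conversion becomes a majorization problem in the manner of Nielsen. If the
target weights `q`, spread by doubly substochastic matrices each of which shifts the number by a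
constant, and mixed at random, give `p'`, then Birkhoff's theorem turns the mixture into one
measurement by Alice and a conditional relabelling by Bob, with fidelity at least `(∑ √(p x * p' x))
^ 2` (`HasSchmidt.exists_locc_of_substochastic`).

Entropy and number statistics decouple in `HasSchmidt.exists_locc_of_flat`. Each target weight is
spread over a whole sector, following the conditional distribution of the source there. This is
substochastic as soon as source weights are at most `1 / L` of their sector and the target has at
most `L` weights per sector. The spread weights are then proportional to those of the source inside
each sector, so only the two particle number distributions remain to be compared.

For the entropy, asymptotic equipartition gives about `2 ^ (N E)` typical weights of size about `2 ^
(-N E)`; the number of sectors is polynomial in `N`, so conditioning on a sector does not change the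
exponent. An ebit doubles the number of weights and leaves the number distribution fixed up to a
translation.

For the number, the local limit theorem on the lattice `dℤ` (Fourier inversion and dominated
convergence) shows that the number distribution of `N` copies is close in total variation to a
discrete Gaussian, which is the exact distribution in the Gaussian state. Two states with equal
variance and lattice share this Gaussian up to a translation. In part (ii) the particles in the
surplus copies act as a further random shift, and the entropy of the surplus copies pays for the
fluctuations in the typical counts. -/

open Filter Topology
open scoped Matrix

noncomputable section

namespace SSR

/-! ### Schmidt forms and two-step protocols -/

/-- The columns of `U` are orthonormal, and column `x` lies in the sector of `n x` particles. -/
structure IsGradedIsometry (A : LocalSystem) {X : Type} [Fintype X] [DecidableEq X] (n : X → ℤ)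
    (U : Matrix A X ℂ) : Prop where
  isometry : Uᴴ * U = 1
  grade : ∀ a x, U a x ≠ 0 → (A.num a : ℤ) = n x

/-- The matrix `T` is the amplitude matrix of `∑ₓ √(p x) |uₓ⟩|wₓ⟩` with orthonormal `uₓ` and `wₓ`
of definite particle number, where `uₓ` contains `n x` particles. -/
def HasSchmidt {A B : LocalSystem} {X : Type} [Fintype X] [DecidableEq X] (T : Matrix A B ℂ)
    (p : X → ℝ) (n : X → ℤ) : Prop :=
  (∀ x, 0 ≤ p x) ∧ ∃ (K : ℤ) (U : Matrix A X ℂ) (W : Matrix B X ℂ),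
    IsGradedIsometry A n U ∧ IsGradedIsometry B (fun x => K - n x) W ∧
      T = U * Matrix.diagonal (fun x => ((√(p x) : ℝ) : ℂ)) * Wᵀ

/-- The operator `|a₀⟩⟨v|` (with `v` given by its conjugate coordinates). -/
def rowOp {A A' : Type} [DecidableEq A'] (a₀ : A') (v : A → ℂ) : Matrix A' A ℂ :=
  fun b y => if b = a₀ then v y else 0

/-- An operator whose rows lie in different sectors has no definite charge. Measured row by row,
with a single output vector `a₀`, it has one in each outcome. All unwanted branches of a measurement
are completed in this way. -/
theorem sum_rowOp {A A' R : Type} [Fintype A'] [DecidableEq A'] [Fintype R] (a₀ : A')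
    (M : Matrix R A ℂ) : ∑ r, (rowOp a₀ (M r))ᴴ * rowOp a₀ (M r) = Mᴴ * M := by
  ext y y'
  simp [Matrix.sum_apply, Matrix.mul_apply, rowOp]

theorem LOCC.fidelity_nonneg {A' B' : LocalSystem} (τ : Matrix A' B' ℂ) {A B : LocalSystem}
    (P : LOCC A' B' A B) (ψ : Matrix A B ℂ) : 0 ≤ P.fidelity τ ψ := by
  induction P with
  | done => exact sq_nonneg _
  | alice out K hK next ih => exact Finset.sum_nonneg fun i _ => ih i _
  | bob out K hK next ih => exact Finset.sum_nonneg fun i _ => ih i _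

theorem exists_alice_step {A B A' B' : LocalSystem} {κ : Type} [Fintype κ]
    (K : κ → Matrix A' A ℂ) (hK : ∑ i, (K i)ᴴ * K i = 1)
    (hc : ∀ i, ∃ q : ℤ, ∀ x y, K i x y ≠ 0 → (A'.num x : ℤ) = A.num y + q)
    (next : κ → LOCC A' B' A' B) :
    ∃ P : LOCC A' B' A B, ∀ τ ψ, P.fidelity τ ψ = ∑ i, (next i).fidelity τ (K i * ψ) := by
  let e := Fintype.equivFin κ
  refine ⟨.alice (fun _ => A') (fun i => K (e.symm i)) ⟨?_, fun i => hc _⟩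
    (fun i => next (e.symm i)), fun τ ψ => ?_⟩
  · rw [← hK]; exact Equiv.sum_comp e.symm fun i => (K i)ᴴ * K i
  · exact Equiv.sum_comp e.symm fun i => (next i).fidelity τ (K i * ψ)

theorem exists_bob_step {A B A' B' : LocalSystem} {κ : Type} [Fintype κ]
    (K : κ → Matrix B' B ℂ) (hK : ∑ i, (K i)ᴴ * K i = 1)
    (hc : ∀ i, ∃ q : ℤ, ∀ x y, K i x y ≠ 0 → (B'.num x : ℤ) = B.num y + q)
    (next : κ → LOCC A' B' A B') :
    ∃ P : LOCC A' B' A B, ∀ τ ψ, P.fidelity τ ψ = ∑ i, (next i).fidelity τ (ψ * (K i)ᵀ) := by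
  let e := Fintype.equivFin κ
  refine ⟨.bob (fun _ => B') (fun i => K (e.symm i)) ⟨?_, fun i => hc _⟩
    (fun i => next (e.symm i)), fun τ ψ => ?_⟩
  · rw [← hK]; exact Equiv.sum_comp e.symm fun i => (K i)ᴴ * K i
  · exact Equiv.sum_comp e.symm fun i => (next i).fidelity τ (ψ * (K i)ᵀ)

section instrument

variable {A A' : LocalSystem} {X Y : Type} [Fintype X] [DecidableEq X] [Fintype Y] [DecidableEq Y]
  {n : X → ℤ} {m : Y → ℤ} {U : Matrix A X ℂ} {U' : Matrix A' Y ℂ}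

/-- Kraus operators given in graded orthonormal frames, with `∑ᵢ kᵢ† kᵢ ≤ 1` diagonal, are part of a
measurement that respects the superselection rule. -/
theorem IsGradedIsometry.exists_instrument (hU : IsGradedIsometry A n U)
    (hU' : IsGradedIsometry A' m U') [Nonempty A'] {ι : Type} [Fintype ι]
    (k : ι → Matrix Y X ℂ) (c : ι → ℤ) (hk : ∀ i y x, k i y x ≠ 0 → n x = m y + c i)
    (d : X → ℝ) (hd : ∀ x, d x ≤ 1)
    (hkd : ∑ i, (k i)ᴴ * k i = Matrix.diagonal fun x => ((d x : ℝ) : ℂ)) :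
    ∃ K : ι ⊕ (A ⊕ X) → Matrix A' A ℂ, (∀ i, K (.inl i) = U' * k i * Uᴴ) ∧
      ∑ i, (K i)ᴴ * K i = 1 ∧
      ∀ i, ∃ q : ℤ, ∀ x y, K i x y ≠ 0 → (A'.num x : ℤ) = A.num y + q := by
  obtain ⟨a₀⟩ := ‹Nonempty A'›
  -- The defect `1 - ∑ K† K` equals `Q† Q + R† R`: `Q` projects onto the complement of the range of
  -- `U`, and `R` supplies the missing weight `1 - d x` inside it.
  let Q : Matrix A A ℂ := 1 - U * Uᴴ
  let R : Matrix X A ℂ := Matrix.diagonal (fun x => ((√(1 - d x) : ℝ) : ℂ)) * Uᴴ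
  have hQ : Qᴴ * Q = 1 - U * Uᴴ := by
    have h1 : U * Uᴴ * (U * Uᴴ) = U * Uᴴ := by
      rw [Matrix.mul_assoc, ← Matrix.mul_assoc Uᴴ, hU.isometry, Matrix.one_mul]
    simp [Q, Matrix.conjTranspose_sub, Matrix.conjTranspose_mul, Matrix.sub_mul, Matrix.mul_sub, h1]
  have hR : Rᴴ * R = U * Matrix.diagonal (fun x => ((1 - d x : ℝ) : ℂ)) * Uᴴ := by
    have h2 : (Matrix.diagonal (fun x => ((√(1 - d x) : ℝ) : ℂ)))ᴴ *
        Matrix.diagonal (fun x => ((√(1 - d x) : ℝ) : ℂ))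
          = Matrix.diagonal (fun x => ((1 - d x : ℝ) : ℂ)) := by
      rw [Matrix.diagonal_conjTranspose, Matrix.diagonal_mul_diagonal]
      congr 1
      funext x
      simp only [Pi.star_apply, RCLike.star_def, Complex.conj_ofReal]
      rw [← Complex.ofReal_mul, Real.mul_self_sqrt (sub_nonneg.2 (hd x))]
    simp only [R, Matrix.conjTranspose_mul, Matrix.conjTranspose_conjTranspose]
    rw [← h2]
    simp only [Matrix.mul_assoc]
  have hkk : ∑ i, (U' * k i * Uᴴ)ᴴ * (U' * k i * Uᴴ)
      = U * Matrix.diagonal (fun x => ((d x : ℝ) : ℂ)) * Uᴴ := by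
    rw [← hkd, Matrix.mul_sum, Matrix.sum_mul]
    refine Finset.sum_congr rfl fun i _ => ?_
    simp only [Matrix.conjTranspose_mul, Matrix.conjTranspose_conjTranspose, Matrix.mul_assoc]
    rw [← Matrix.mul_assoc U'ᴴ, hU'.isometry, Matrix.one_mul]
  refine ⟨Sum.elim (fun i => U' * k i * Uᴴ)
    (Sum.elim (fun a => rowOp a₀ (Q a)) (fun x => rowOp a₀ (R x))), fun i => rfl, ?_, ?_⟩
  · rw [Fintype.sum_sum_type, Fintype.sum_sum_type]
    simp only [Sum.elim_inl, Sum.elim_inr]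
    rw [sum_rowOp, sum_rowOp, hQ, hR, hkk]
    have h3 : Matrix.diagonal (fun x => ((1 - d x : ℝ) : ℂ))
        = 1 - Matrix.diagonal (fun x => ((d x : ℝ) : ℂ)) := by
      rw [← Matrix.diagonal_one, Matrix.diagonal_sub]
      simp
    rw [h3, Matrix.mul_sub, Matrix.sub_mul, Matrix.mul_one]
    abel
  · rintro (i | a | x)
    · refine ⟨-c i, fun a' a h => ?_⟩
      simp only [Sum.elim_inl, Matrix.mul_apply] at h
      obtain ⟨x, -, hx⟩ := Finset.exists_ne_zero_of_sum_ne_zero h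
      obtain ⟨y, -, hy⟩ := Finset.exists_ne_zero_of_sum_ne_zero (left_ne_zero_of_mul hx)
      have h1 := hU'.grade _ _ (left_ne_zero_of_mul hy)
      have h2 := hk _ _ _ (right_ne_zero_of_mul hy)
      have h3 := hU.grade a x (by
        have := right_ne_zero_of_mul hx
        simpa using this)
      omega
    · refine ⟨A'.num a₀ - A.num a, fun a' y h => ?_⟩
      simp only [Sum.elim_inl, Sum.elim_inr, rowOp, ne_eq, ite_eq_right_iff, not_forall] at h
      obtain ⟨rfl, h⟩ := h
      -- An off-diagonal entry of `U * Uᴴ` needs a column of `U` that meets both basis vectors, and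
      -- a column lies in one sector.
      have : A.num a = A.num y := by
        by_cases hay : a = y
        · rw [hay]
        · simp only [Q, Matrix.sub_apply, Matrix.one_apply_ne hay, zero_sub, Matrix.mul_apply,
            neg_eq_zero] at h
          obtain ⟨x, -, hx⟩ := Finset.exists_ne_zero_of_sum_ne_zero h
          have h1 := hU.grade a x (left_ne_zero_of_mul hx)
          have h2 := hU.grade y x (by simpa using right_ne_zero_of_mul hx)
          omega
      omega
    · refine ⟨A'.num a₀ - n x, fun a' y h => ?_⟩
      simp only [Sum.elim_inr, rowOp, ne_eq, ite_eq_right_iff, not_forall] at h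
      obtain ⟨rfl, h⟩ := h
      simp only [R, Matrix.diagonal_mul] at h
      have h2 := hU.grade y x (by simpa using right_ne_zero_of_mul h)
      omega

end instrument

/-- Failed branches of Alice's measurement must still end in the right output system; which protocol
does this is irrelevant, because fidelities are nonnegative. -/
theorem exists_bob_only {A' B B' : LocalSystem} [Nonempty B'] : Nonempty (LOCC A' B' A' B) := by
  obtain ⟨b₀⟩ := ‹Nonempty B'›
  obtain ⟨P, -⟩ := exists_bob_step (A' := A') (B := B) (A := A')
    (fun b : B => rowOp b₀ ((1 : Matrix B B ℂ) b)) (by rw [sum_rowOp]; simp)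
    (fun b => ⟨B'.num b₀ - B.num b, fun x y h => by
      simp only [rowOp, ne_eq, ite_eq_right_iff, not_forall] at h
      obtain ⟨rfl, h⟩ := h
      have : b = y := by
        by_contra hc
        exact h (Matrix.one_apply_ne hc)
      subst this; omega⟩)
    (fun _ => LOCC.done)
  exact ⟨P⟩

/-- Overlap with `τ` of the vector into which a pair of local operators, given in Schmidt bases,
sends `ψ`. -/
theorem overlap_schmidt {A B A' B' X Y : Type} [Fintype A] [Fintype B] [Fintype A'] [Fintype B']
    [Fintype X] [Fintype Y] [DecidableEq X] [DecidableEq Y]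
    {U : Matrix A X ℂ} {W : Matrix B X ℂ} {U' : Matrix A' Y ℂ} {W' : Matrix B' Y ℂ}
    (hU : Uᴴ * U = 1) (hW : Wᴴ * W = 1) (hU' : U'ᴴ * U' = 1) (hW' : W'ᴴ * W' = 1)
    (s : X → ℝ) (t : Y → ℝ) (k j : Y → X → ℝ) :
    ∑ a, ∑ b, star ((U' * Matrix.diagonal (fun y => (t y : ℂ)) * W'ᵀ) a b) *
      (U' * (Matrix.of fun y x => (k y x : ℂ)) * Uᴴ *
        (U * Matrix.diagonal (fun x => (s x : ℂ)) * Wᵀ) *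
          (W' * (Matrix.of fun y x => (j y x : ℂ)) * Wᴴ)ᵀ) a b
      = ((∑ y, ∑ x, t y * k y x * s x * j y x : ℝ) : ℂ) := by
  set k' : Matrix Y X ℂ := Matrix.of fun y x => (k y x : ℂ)
  set j' : Matrix Y X ℂ := Matrix.of fun y x => (j y x : ℂ)
  set D : Matrix Y Y ℂ := Matrix.diagonal (fun y => (t y : ℂ))
  set S : Matrix X X ℂ := Matrix.diagonal (fun x => (s x : ℂ))
  have e1 : ∀ T R : Matrix A' B' ℂ, ∑ a, ∑ b, star (T a b) * R a b = (Tᴴ * R).trace := by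
    intro T R
    rw [Finset.sum_comm]
    simp [Matrix.trace, Matrix.mul_apply]
  have hWt : Wᵀ * Wᴴᵀ = 1 := by rw [← Matrix.transpose_mul, hW, Matrix.transpose_one]
  have hWt' : W'ᵀ * W'ᵀᴴ = 1 := by
    have h := congrArg Matrix.transpose hW'
    rw [Matrix.transpose_mul, Matrix.transpose_one] at h
    exact h
  rw [e1]
  -- The isometries cancel, so that the overlap is a trace over Schmidt indices only.
  have e2 : U' * k' * Uᴴ * (U * S * Wᵀ) * (W' * j' * Wᴴ)ᵀ = U' * (k' * S * j'ᵀ) * W'ᵀ := by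
    simp only [Matrix.transpose_mul, Matrix.mul_assoc]
    rw [← Matrix.mul_assoc Uᴴ, hU, Matrix.one_mul, ← Matrix.mul_assoc Wᵀ, hWt, Matrix.one_mul]
  have e3 : (U' * D * W'ᵀ)ᴴ * (U' * (k' * S * j'ᵀ) * W'ᵀ) = W'ᵀᴴ * (Dᴴ * (k' * S * j'ᵀ) * W'ᵀ) := by
    simp only [Matrix.conjTranspose_mul, Matrix.mul_assoc]
    rw [← Matrix.mul_assoc U'ᴴ, hU', Matrix.one_mul]
  rw [e2, e3, Matrix.trace_mul_comm, Matrix.mul_assoc, hWt', Matrix.mul_one]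
  have hD : Dᴴ = D := by
    simp only [D, Matrix.diagonal_conjTranspose]
    congr 1
    funext y
    simp
  rw [hD, Complex.ofReal_sum]
  simp only [Matrix.trace, Matrix.diag_apply, D, Matrix.diagonal_mul]
  refine Finset.sum_congr rfl fun y _ => ?_
  rw [Matrix.mul_apply, Finset.mul_sum, Complex.ofReal_sum]
  refine Finset.sum_congr rfl fun x _ => ?_
  simp only [S, Matrix.mul_diagonal, Matrix.transpose_apply, k', j', Matrix.of_apply,
    Complex.ofReal_mul]
  ring

/-- A protocol that consists of one measurement by Alice followed by one measurement by Bob. -/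
theorem HasSchmidt.exists_locc {A B A' B' : LocalSystem} {X Y : Type} [Fintype X] [DecidableEq X]
    [Fintype Y] [DecidableEq Y] {T : Matrix A B ℂ} {T' : Matrix A' B' ℂ} {p : X → ℝ} {n : X → ℤ}
    {q : Y → ℝ} {m : Y → ℤ} (hT : HasSchmidt T p n) (hT' : HasSchmidt T' q m)
    [Nonempty A'] [Nonempty B'] {ι : Type} [Fintype ι] (k j : ι → Y → X → ℝ) (c : ι → ℤ)
    (hk : ∀ i y x, k i y x ≠ 0 → n x = m y + c i) (hj : ∀ i y x, j i y x ≠ 0 → n x = m y + c i)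
    (d : X → ℝ) (hd : ∀ x, d x ≤ 1)
    (hkd : ∀ x x', ∑ i, ∑ y, k i y x * k i y x' = if x = x' then d x else 0)
    (e : ι → X → ℝ) (he : ∀ i x, e i x ≤ 1)
    (hje : ∀ i x x', ∑ y, j i y x * j i y x' = if x = x' then e i x else 0) :
    ∃ P : LOCC A' B' A B,
      ∑ i, (∑ y, ∑ x, √(q y) * k i y x * √(p x) * j i y x) ^ 2 ≤ P.fidelity T' T := by
  obtain ⟨-, N, U, W, hU, hW, rfl⟩ := hT
  obtain ⟨-, N', U', W', hU', hW', rfl⟩ := hT'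
  obtain ⟨K, hK1, hK2, hK3⟩ := hU.exists_instrument hU' (fun i => Matrix.of fun y x => (k i y x : ℂ))
    c (fun i y x h => hk i y x (by simpa using h)) d hd (by
      ext x x'
      have := congrArg (fun r : ℝ => (r : ℂ)) (hkd x x')
      simp only [Matrix.sum_apply, Matrix.mul_apply, Matrix.conjTranspose_apply, Matrix.of_apply,
        RCLike.star_def, Complex.conj_ofReal, Matrix.diagonal_apply]
      push_cast at this
      rw [this]
      split_ifs <;> simp)
  have hB : ∀ i, ∃ Q : LOCC A' B' A' B, ∀ τ ψ,
      ‖∑ a, ∑ b, star (τ a b) * (ψ * (W' * (Matrix.of fun y x => (j i y x : ℂ)) * Wᴴ)ᵀ) a b‖ ^ 2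
        ≤ Q.fidelity τ ψ := by
    intro i
    -- Bob holds `N - n x` and `N' - m y` particles, so Alice's charge relation `n x = m y + c i`
    -- becomes one with `N - N' - c i` on his side.
    obtain ⟨K, hK1, hK2, hK3⟩ := hW.exists_instrument hW'
      (fun _ : Unit => Matrix.of fun y x => (j i y x : ℂ)) (fun _ => N - N' - c i)
      (fun _ y x h => by have := hj i y x (by simpa using h); omega) (e i) (he i) (by
        ext x x'
        have := congrArg (fun r : ℝ => (r : ℂ)) (hje i x x')
        simp only [Matrix.mul_apply, Matrix.conjTranspose_apply, Matrix.of_apply,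
          RCLike.star_def, Complex.conj_ofReal, Matrix.diagonal_apply, Finset.univ_unique,
          Finset.sum_singleton]
        push_cast at this
        rw [this]
        split_ifs <;> simp)
    obtain ⟨Q, hQ⟩ := exists_bob_step (A' := A') (A := A') K hK2 hK3 (fun _ => LOCC.done)
    refine ⟨Q, fun τ ψ => ?_⟩
    rw [hQ, Fintype.sum_sum_type]
    refine le_add_of_le_of_nonneg ?_ (Finset.sum_nonneg fun _ _ => LOCC.fidelity_nonneg _ _ _)
    simp only [Finset.univ_unique, Finset.sum_singleton, hK1]
    exact le_rfl
  choose Q hQ using hB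
  obtain ⟨P₀⟩ := exists_bob_only (A' := A') (B := B) (B' := B')
  obtain ⟨P, hP⟩ := exists_alice_step (B := B) (B' := B') K hK2 hK3 (Sum.elim Q fun _ => P₀)
  refine ⟨P, ?_⟩
  rw [hP, Fintype.sum_sum_type]
  refine le_add_of_le_of_nonneg (Finset.sum_le_sum fun i _ => ?_)
    (Finset.sum_nonneg fun _ _ => LOCC.fidelity_nonneg _ _ _)
  refine le_trans (le_of_eq ?_) (hQ i _ _)
  rw [hK1, overlap_schmidt hU.isometry hW.isometry hU'.isometry hW'.isometry, Complex.norm_real,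
    Real.norm_eq_abs, sq_abs]

/-! ### Majorization with particle number shifts -/

/-- A doubly substochastic matrix is a mixture of partial injections (a form of Birkhoff's
theorem). -/
theorem exists_perm_mixture_of_substochastic {X Y : Type} [Fintype X] [DecidableEq X] [Fintype Y]
    [DecidableEq Y] (D : Y → X → ℝ) (h0 : ∀ y x, 0 ≤ D y x) (hrow : ∀ y, ∑ x, D y x ≤ 1)
    (hcol : ∀ x, ∑ y, D y x ≤ 1) :
    ∃ w : Equiv.Perm (Y ⊕ X) → ℝ, (∀ σ, 0 ≤ w σ) ∧ ∑ σ, w σ = 1 ∧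
      ∀ y x, D y x = ∑ σ, w σ * if σ (.inl y) = .inr x then 1 else 0 := by
  -- Padding to a doubly stochastic matrix: the row and column defects go on the diagonal blocks,
  -- and the transpose fills the remaining block.
  let M : Matrix (Y ⊕ X) (Y ⊕ X) ℝ := Matrix.fromBlocks
    (Matrix.diagonal fun y => 1 - ∑ x, D y x) (Matrix.of D) (Matrix.of D)ᵀ
    (Matrix.diagonal fun x => 1 - ∑ y, D y x)
  have hM : M ∈ doublyStochastic ℝ (Y ⊕ X) := by
    rw [mem_doublyStochastic_iff_sum]
    refine ⟨?_, ?_, ?_⟩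
    · rintro (y | x) (y' | x')
      · simp only [M, Matrix.fromBlocks_apply₁₁, Matrix.diagonal_apply]
        split_ifs
        · exact sub_nonneg.2 (hrow y)
        · exact le_rfl
      · exact h0 _ _
      · exact h0 _ _
      · simp only [M, Matrix.fromBlocks_apply₂₂, Matrix.diagonal_apply]
        split_ifs
        · exact sub_nonneg.2 (hcol x)
        · exact le_rfl
    · rintro (y | x) <;> simp [M, Matrix.diagonal_apply]
    · rintro (y | x) <;> simp [M, Matrix.diagonal_apply]
  obtain ⟨w, hw0, hw1, hwM⟩ := exists_eq_sum_perm_of_mem_doublyStochastic hM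
  refine ⟨w, hw0, hw1, fun y x => ?_⟩
  have h := congrFun (congrFun hwM (.inl y)) (.inr x)
  have h' : M (.inl y) (.inr x) = D y x := rfl
  rw [← h', ← h, Matrix.sum_apply]
  refine Finset.sum_congr rfl fun σ _ => ?_
  simp [Equiv.Perm.permMatrix, PEquiv.toMatrix_apply, eq_comm]

/-- Cauchy–Schwarz for subprobability weights. It bounds a fidelity summed over branches below by
the square of the mean branch amplitude. -/
theorem sq_sum_mul_le {ι : Type} [Fintype ι] (w z : ι → ℝ) (hw : ∀ i, 0 ≤ w i)
    (hw1 : ∑ i, w i ≤ 1) : (∑ i, w i * z i) ^ 2 ≤ ∑ i, w i * z i ^ 2 := by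
  have h := Finset.sum_mul_sq_le_sq_mul_sq Finset.univ (fun i => √(w i)) (fun i => √(w i) * z i)
  have e1 : ∀ i, √(w i) * (√(w i) * z i) = w i * z i := fun i => by
    rw [← mul_assoc, Real.mul_self_sqrt (hw i)]
  have e2 : ∀ i, (√(w i) * z i) ^ 2 = w i * z i ^ 2 := fun i => by
    rw [mul_pow, Real.sq_sqrt (hw i)]
  simp only [e1, e2, Real.sq_sqrt (hw _)] at h
  refine h.trans (mul_le_of_le_one_left (Finset.sum_nonneg fun i _ => ?_) hw1)
  exact mul_nonneg (hw i) (sq_nonneg _)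

/-- If a mixture of number-shifting doubly substochastic matrices sends the Schmidt weights `q` of
the target to `p'`, then the source with Schmidt weights `p` can be converted into the target with
fidelity at least `(∑ₓ √(pₓ p'ₓ))²`. -/
theorem HasSchmidt.exists_locc_of_substochastic {A B A' B' : LocalSystem} {X Y : Type} [Fintype X]
    [DecidableEq X] [Fintype Y] [DecidableEq Y] {T : Matrix A B ℂ} {T' : Matrix A' B' ℂ}
    {p : X → ℝ} {n : X → ℤ} {q : Y → ℝ} {m : Y → ℤ} (hT : HasSchmidt T p n)
    (hT' : HasSchmidt T' q m) [Nonempty A'] [Nonempty B'] {C : Type} [Fintype C] (r : C → ℝ)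
    (hr : ∀ c, 0 ≤ r c) (hr1 : ∑ c, r c ≤ 1) (s : C → ℤ) (D : C → Y → X → ℝ)
    (h0 : ∀ c y x, 0 ≤ D c y x) (hrow : ∀ c y, ∑ x, D c y x ≤ 1)
    (hcol : ∀ c x, ∑ y, D c y x ≤ 1) (hD : ∀ c y x, D c y x ≠ 0 → n x = m y + s c)
    (p' : X → ℝ) (hp' : ∀ x, p' x = ∑ c, r c * ∑ y, q y * D c y x) :
    ∃ P : LOCC A' B' A B, (∑ x, √(p x * p' x)) ^ 2 ≤ P.fidelity T' T := by
  classical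
  have hp := hT.1
  have hq := hT'.1
  choose w hw0 hw1 hwD using fun c => exists_perm_mixture_of_substochastic (D c) (h0 c) (hrow c)
    (hcol c)
  let v : C × Equiv.Perm (Y ⊕ X) → ℝ := fun i => r i.1 * w i.1 i.2
  have hv : ∀ i, 0 ≤ v i := fun i => mul_nonneg (hr _) (hw0 _ _)
  have hp'0 : ∀ x, 0 ≤ p' x := fun x => by
    rw [hp']
    exact Finset.sum_nonneg fun c _ => mul_nonneg (hr c) (Finset.sum_nonneg fun y _ =>
      mul_nonneg (hq y) (h0 _ _ _))
  -- A permutation may also match indices that violate the shift. Such matches are removed, which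
  -- loses nothing because `D` vanishes there.
  let b : C × Equiv.Perm (Y ⊕ X) → Y → X → ℝ := fun i y x =>
    if i.2 (.inl y) = .inr x ∧ n x = m y + s i.1 then 1 else 0
  have hvb : ∀ y x c, D c y x = ∑ σ, w c σ * b (c, σ) y x := by
    intro y x c
    rw [hwD]
    by_cases hn : n x = m y + s c
    · simp [b, hn]
    · have : D c y x = 0 := by
        by_contra h
        exact hn (hD c y x h)
      rw [← hwD, this]
      simp [b, hn]
  have hp'' : ∀ x, ∑ i, ∑ y, b i y x * (v i * q y) = p' x := by
    intro x
    rw [hp', Fintype.sum_prod_type]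
    refine Finset.sum_congr rfl fun c _ => ?_
    rw [Finset.sum_comm, Finset.mul_sum]
    refine Finset.sum_congr rfl fun y _ => ?_
    rw [hvb, Finset.mul_sum, Finset.mul_sum]
    refine Finset.sum_congr rfl fun σ _ => ?_
    simp only [v]
    ring
  have hbb : ∀ i y x, b i y x * b i y x = b i y x := by
    intro i y x
    simp only [b]
    split_ifs <;> simp
  have hbx : ∀ i y x x', x ≠ x' → b i y x * b i y x' = 0 := by
    intro i y x x' hx
    simp only [b]
    split_ifs with h1 h2
    · exact absurd (Sum.inr_injective (h1.1.symm.trans h2.1)) hx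
    all_goals simp
  have hb1 : ∀ i x, ∑ y, b i y x ≤ 1 := by
    intro i x
    calc ∑ y, b i y x ≤ ∑ y, if i.2.symm (.inr x) = .inl y then 1 else 0 := by
          refine Finset.sum_le_sum fun y _ => ?_
          simp only [b]
          split_ifs with h1 h2 h2 <;> norm_num
          exact h2 (by rw [← h1.1, Equiv.symm_apply_apply])
      _ ≤ 1 := by
          rcases i.2.symm (.inr x) with y | x' <;> simp
  -- In branch `i` Alice rescales the weights from `p'` to `v i * q` along the partial injection `b
  -- i`, and Bob applies `b i` itself to keep the Schmidt bases aligned.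
  obtain ⟨P, hP⟩ := hT.exists_locc hT' (fun i y x => b i y x * √(v i * q y / p' x)) b
    (fun i => s i.1)
    (fun i y x h => by
      have := left_ne_zero_of_mul h
      simp only [b, ne_eq, ite_eq_right_iff, not_forall] at this
      exact this.1.2)
    (fun i y x h => by
      simp only [b, ne_eq, ite_eq_right_iff, not_forall] at h
      exact h.1.2)
    -- As division by zero gives zero, this is the indicator of `p' x ≠ 0`: where `p'` vanishes,
    -- Alice's operators vanish too.
    (fun x => p' x / p' x) (fun x => div_self_le_one _)
    (fun x x' => by
      split_ifs with h
      · subst h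
        conv_rhs => rw [← hp'' x]
        rw [Finset.sum_div]
        refine Finset.sum_congr rfl fun i _ => ?_
        rw [Finset.sum_div]
        refine Finset.sum_congr rfl fun y _ => ?_
        rw [mul_mul_mul_comm, hbb,
          Real.mul_self_sqrt (div_nonneg (mul_nonneg (hv i) (hq y)) (hp'0 x)), hp'']
        ring
      · refine Finset.sum_eq_zero fun i _ => Finset.sum_eq_zero fun y _ => ?_
        rw [mul_mul_mul_comm, hbx i y x x' h, zero_mul])
    (fun i x => ∑ y, b i y x) hb1
    (fun i x x' => by
      split_ifs with h
      · subst h; exact Finset.sum_congr rfl fun y _ => hbb i y x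
      · exact Finset.sum_eq_zero fun y _ => hbx i y x x' h)
  refine ⟨P, le_trans ?_ hP⟩
  -- Branch `i` contributes `v i * z i ^ 2` to the fidelity, while `∑ v i * z i` is the overlap `∑
  -- √(p x * p' x)`.
  let z : C × Equiv.Perm (Y ⊕ X) → ℝ := fun i => ∑ y, ∑ x, q y * √(p x / p' x) * b i y x
  have hz : ∀ i, (∑ y, ∑ x, √(q y) * (b i y x * √(v i * q y / p' x)) * √(p x) * b i y x) ^ 2
      = v i * z i ^ 2 := by
    intro i
    have : ∑ y, ∑ x, √(q y) * (b i y x * √(v i * q y / p' x)) * √(p x) * b i y x = √(v i) * z i := by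
      rw [Finset.mul_sum]
      refine Finset.sum_congr rfl fun y _ => ?_
      rw [Finset.mul_sum]
      refine Finset.sum_congr rfl fun x _ => ?_
      rw [Real.sqrt_div (mul_nonneg (hv i) (hq y)), Real.sqrt_mul (hv i), Real.sqrt_div (hp x)]
      calc _ = √(v i) * (√(q y) * √(q y)) * (√(p x) / √(p' x)) * (b i y x * b i y x) := by ring
        _ = _ := by rw [hbb, Real.mul_self_sqrt (hq y)]; ring
    rw [this, mul_pow, Real.sq_sqrt (hv i)]
  simp only [hz]
  have hv1 : ∑ i, v i ≤ 1 := by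
    simp only [v, Fintype.sum_prod_type, ← Finset.mul_sum, hw1, mul_one]
    exact hr1
  refine le_trans (le_of_eq ?_) (sq_sum_mul_le v z hv hv1)
  congr 1
  have : ∀ x, √(p x * p' x) = ∑ i, ∑ y, v i * (q y * √(p x / p' x) * b i y x) := by
    intro x
    have e1 : √(p x * p' x) = p' x * √(p x / p' x) := by
      rw [Real.sqrt_mul (hp x), Real.sqrt_div (hp x)]
      by_cases h : p' x = 0
      · simp [h]
      · have h1 : √(p' x) ≠ 0 := (Real.sqrt_pos.2 (lt_of_le_of_ne (hp'0 x) (Ne.symm h))).ne'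
        have h2 : p' x = √(p' x) * √(p' x) := (Real.mul_self_sqrt (hp'0 x)).symm
        conv_rhs => rw [h2]
        simp only [Real.sqrt_mul_self (Real.sqrt_nonneg _)]
        field_simp
    rw [e1]
    nth_rewrite 1 [← hp'' x]
    rw [Finset.sum_mul]
    refine Finset.sum_congr rfl fun i _ => ?_
    rw [Finset.sum_mul]
    refine Finset.sum_congr rfl fun y _ => by ring
  simp only [this, z, Finset.mul_sum]
  rw [Finset.sum_comm]
  exact Finset.sum_congr rfl fun i _ => Finset.sum_comm

/-- Distribution of `n x`, when `x` has weight `p x`. -/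
def marginal {X : Type} [Fintype X] (p : X → ℝ) (n : X → ℤ) (k : ℤ) : ℝ :=
  ∑ x, if n x = k then p x else 0

theorem marginal_nonneg {X : Type} [Fintype X] {p : X → ℝ} (hp : ∀ x, 0 ≤ p x) (n : X → ℤ)
    (k : ℤ) : 0 ≤ marginal p n k :=
  Finset.sum_nonneg fun x _ => by split_ifs <;> simp [hp]

/-- Conversion of states with almost flat spectrum in each sector: the Schmidt weights of the source
in `G` are at most `1 / L` in their sector, at most `L` Schmidt weights of the target in `S` belong
to each sector, and the particle number distribution of the source is close to that of the
target, shifted randomly. -/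
theorem HasSchmidt.exists_locc_of_flat {A B A' B' : LocalSystem} {X Y : Type} [Fintype X]
    [DecidableEq X] [Fintype Y] [DecidableEq Y] {T : Matrix A B ℂ} {T' : Matrix A' B' ℂ}
    {p : X → ℝ} {n : X → ℤ} {q : Y → ℝ} {m : Y → ℤ} (hT : HasSchmidt T p n)
    (hT' : HasSchmidt T' q m) [Nonempty A'] [Nonempty B'] (hp1 : ∑ x, p x = 1)
    (hq1 : ∑ y, q y = 1) {C : Type} [Fintype C] (r : C → ℝ)
    (hr : ∀ c, 0 ≤ r c) (hr1 : ∑ c, r c ≤ 1) (s : C → ℤ) {L : ℝ} (G : Finset X)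
    (S : Finset Y) {ε : ℝ} (hG : ∀ x ∈ G, p x * L ≤ marginal p n (n x))
    (hS : ∀ k, ((S.filter fun y => m y = k).card : ℝ) ≤ L)
    (hGε : 1 - ε ≤ ∑ x ∈ G, p x) (hSε : 1 - ε ≤ ∑ y ∈ S, q y) (Z : Finset ℤ)
    (hZ : 1 - ε ≤ ∑ k ∈ Z, min (marginal p n k) (∑ c, r c * marginal q m (k - s c))) :
    ∃ P : LOCC A' B' A B, 1 - 6 * ε ≤ P.fidelity T' T := by
  classical
  have hp := hT.1
  have hq := hT'.1
  set μ := marginal p n with hμ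
  have hμ0 : ∀ k, 0 ≤ μ k := marginal_nonneg hp n
  -- A target weight is spread over the shifted sector with the conditional distribution `p x / μ (n
  -- x)`. Rows are then substochastic automatically; columns need the flatness `hG` and the count
  -- `hS`.
  let D : C → Y → X → ℝ := fun c y x =>
    if n x = m y + s c ∧ y ∈ S ∧ x ∈ G then p x / μ (n x) else 0
  let R : ℤ → ℝ := fun k => ∑ c, r c * ∑ y ∈ S, if m y = k - s c then q y else 0
  have hD0 : ∀ c y x, 0 ≤ D c y x := fun c y x => by
    simp only [D]
    split_ifs
    · exact div_nonneg (hp x) (hμ0 _)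
    · exact le_rfl
  obtain ⟨P, hP⟩ := hT.exists_locc_of_substochastic hT' r hr hr1 s D hD0
    (fun c y => by
      calc ∑ x, D c y x ≤ ∑ x, (if n x = m y + s c then p x else 0) / μ (m y + s c) := by
            refine Finset.sum_le_sum fun x _ => ?_
            simp only [D]
            split_ifs with h1 h2 h2
            · rw [h1.1]
            · exact absurd h1.1 h2
            · exact div_nonneg (hp x) (hμ0 _)
            · simp
        _ = μ (m y + s c) / μ (m y + s c) := by rw [← Finset.sum_div]; rfl
        _ ≤ 1 := div_self_le_one _)
    (fun c x => by
      by_cases hx : x ∈ G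
      · by_cases hμx : μ (n x) = 0
        · simp [D, hμx]
        have hμx' : 0 < μ (n x) := lt_of_le_of_ne (hμ0 _) (Ne.symm hμx)
        calc ∑ y, D c y x = ∑ y ∈ S.filter (fun y => m y = n x - s c), p x / μ (n x) := by
              rw [Finset.sum_filter, ← Finset.sum_filter_add_sum_filter_not Finset.univ (· ∈ S)]
              rw [Finset.sum_eq_zero (s := Finset.univ.filter fun y => y ∉ S), add_zero]
              · simp only [Finset.filter_mem_eq_inter, Finset.univ_inter]
                refine Finset.sum_congr rfl fun y hy => ?_
                have : (n x = m y + s c ∧ y ∈ S ∧ x ∈ G) ↔ m y = n x - s c := by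
                  constructor
                  · rintro ⟨h, -, -⟩; omega
                  · intro h; exact ⟨by omega, hy, hx⟩
                simp only [D, this]
              · intro y hy
                simp only [Finset.mem_filter] at hy
                simp [D, hy.2]
          _ = (S.filter (fun y => m y = n x - s c)).card * (p x / μ (n x)) := by
              rw [Finset.sum_const, nsmul_eq_mul]
          _ ≤ L * (p x / μ (n x)) :=
              mul_le_mul_of_nonneg_right (hS _) (div_nonneg (hp x) (hμ0 _))
          _ = p x * L / μ (n x) := by ring
          _ ≤ 1 := (div_le_one hμx').2 (hG x hx)
      · simp [D, hx])
    (fun c y x h => by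
      simp only [D, ne_eq, ite_eq_right_iff, not_forall] at h
      exact h.1.1)
    -- On `G` the transported weights are proportional to `p` in each sector. Only the factor `R /
    -- μ`, a ratio of number distributions, distinguishes them.
    (fun x => if x ∈ G then p x / μ (n x) * R (n x) else 0)
    (fun x => by
      split_ifs with hx
      · simp only [R, Finset.mul_sum]
        refine Finset.sum_congr rfl fun c _ => ?_
        rw [← Finset.sum_subset (Finset.subset_univ S)]
        · refine Finset.sum_congr rfl fun y hy => ?_
          have : (n x = m y + s c ∧ y ∈ S ∧ x ∈ G) ↔ m y = n x - s c := by
            constructor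
            · rintro ⟨h, -, -⟩; omega
            · intro h; exact ⟨by omega, hy, hx⟩
          simp only [D, this]
          split_ifs <;> ring
        · intro y _ hy
          simp [D, hy]
      · simp [D, hx])
  refine ⟨P, le_trans ?_ hP⟩
  have hR0 : ∀ k, 0 ≤ R k := fun k => Finset.sum_nonneg fun c _ => mul_nonneg (hr c)
    (Finset.sum_nonneg fun y _ => by split_ifs <;> simp [hq])
  -- One `ε` each is lost by restricting to `G`, by restricting to `S`, and in the overlap of the
  -- number distributions.
  have key : 1 - 3 * ε ≤ ∑ x, √(p x * if x ∈ G then p x / μ (n x) * R (n x) else 0) := by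
    -- Truncating the ratio at `1` makes the square root harmless: `t ^ 2 ≤ t ≤ R / μ`, hence `t ≤
    -- √(R / μ)`, and `μ * t` is exactly `min μ R`.
    let t : ℤ → ℝ := fun k => min 1 (R k / μ k)
    have ht0 : ∀ k, 0 ≤ t k := fun k => le_min zero_le_one (div_nonneg (hR0 k) (hμ0 k))
    have e1 : ∑ x ∈ G, p x * t (n x) ≤
        ∑ x, √(p x * if x ∈ G then p x / μ (n x) * R (n x) else 0) := by
      rw [← Finset.sum_subset (Finset.subset_univ G) (fun x _ hx => by simp [hx])]
      refine Finset.sum_le_sum fun x hx => ?_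
      rw [if_pos hx]
      have : p x * (p x / μ (n x) * R (n x)) = p x ^ 2 * (R (n x) / μ (n x)) := by ring
      rw [this, Real.sqrt_mul (sq_nonneg _), Real.sqrt_sq (hp x)]
      refine mul_le_mul_of_nonneg_left ?_ (hp x)
      refine Real.le_sqrt_of_sq_le ?_
      calc t (n x) ^ 2 ≤ t (n x) := by
            have : t (n x) ≤ 1 := min_le_left _ _
            nlinarith [ht0 (n x)]
        _ ≤ _ := min_le_right _ _
    have e2 : ∑ x, p x * t (n x) - ε ≤ ∑ x ∈ G, p x * t (n x) := by
      have h1 : ∑ x, p x * t (n x) = ∑ x ∈ G, p x * t (n x) + ∑ x ∈ Gᶜ, p x * t (n x) :=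
        (Finset.sum_add_sum_compl G _).symm
      have h2 : ∑ x ∈ Gᶜ, p x * t (n x) ≤ ∑ x ∈ Gᶜ, p x := Finset.sum_le_sum fun x _ =>
        mul_le_of_le_one_right (hp x) (min_le_left _ _)
      have h3 := Finset.sum_add_sum_compl G p
      linarith
    have e3 : ∑ k ∈ Z, min (μ k) (R k) ≤ ∑ x, p x * t (n x) := by
      have h1 : ∀ k, min (μ k) (R k) = μ k * t k := by
        intro k
        rcases (hμ0 k).eq_or_lt with h | h
        · rw [← h]; simp [hR0 k]
        · simp only [t]
          rw [mul_min_of_nonneg _ _ h.le, mul_one, mul_div_cancel₀ _ h.ne']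
      simp only [h1]
      simp only [hμ, marginal, Finset.sum_mul]
      rw [Finset.sum_comm]
      refine Finset.sum_le_sum fun x _ => ?_
      simp only [ite_mul, zero_mul]
      rw [Finset.sum_ite_eq]
      split_ifs
      · exact le_rfl
      · exact mul_nonneg (hp x) (ht0 _)
    have e4 : ∑ k ∈ Z, min (μ k) (∑ c, r c * marginal q m (k - s c)) - ε
        ≤ ∑ k ∈ Z, min (μ k) (R k) := by
      have h1 : ∀ k, marginal q m k = (∑ y ∈ S, if m y = k then q y else 0)
          + ∑ y ∈ Sᶜ, if m y = k then q y else 0 := fun k =>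
        (Finset.sum_add_sum_compl S _).symm
      have h2 : ∀ k, min (μ k) (∑ c, r c * marginal q m (k - s c)) ≤ min (μ k) (R k)
          + ∑ c, r c * ∑ y ∈ Sᶜ, if m y = k - s c then q y else 0 := by
        intro k
        have h3 : ∑ c, r c * marginal q m (k - s c)
            = R k + ∑ c, r c * ∑ y ∈ Sᶜ, if m y = k - s c then q y else 0 := by
          simp only [h1, mul_add, Finset.sum_add_distrib, R]
        have h4 : 0 ≤ ∑ c, r c * ∑ y ∈ Sᶜ, if m y = k - s c then q y else 0 :=
          Finset.sum_nonneg fun c _ => mul_nonneg (hr c)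
            (Finset.sum_nonneg fun y _ => by split_ifs <;> simp [hq])
        rw [h3]
        rcases min_cases (μ k) (R k) with ⟨h, _⟩ | ⟨h, _⟩ <;> rw [h]
        · exact (min_le_left _ _).trans (by linarith)
        · exact min_le_right _ _
      have h5 : ∑ k ∈ Z, ∑ c, r c * ∑ y ∈ Sᶜ, (if m y = k - s c then q y else 0) ≤ ε := by
        rw [Finset.sum_comm]
        have h6 : ∑ y ∈ Sᶜ, q y ≤ ε := by
          have := Finset.sum_add_sum_compl S q
          linarith
        have h7 : 0 ≤ ∑ y ∈ Sᶜ, q y := Finset.sum_nonneg fun y _ => hq y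
        calc ∑ c, ∑ k ∈ Z, r c * ∑ y ∈ Sᶜ, (if m y = k - s c then q y else 0)
            ≤ ∑ c, r c * ∑ y ∈ Sᶜ, q y := by
              refine Finset.sum_le_sum fun c _ => ?_
              rw [← Finset.mul_sum]
              refine mul_le_mul_of_nonneg_left ?_ (hr c)
              rw [Finset.sum_comm]
              refine Finset.sum_le_sum fun y _ => ?_
              have : ∀ k, (m y = k - s c) ↔ (m y + s c = k) := fun k => by omega
              simp only [this]
              rw [Finset.sum_ite_eq]
              split_ifs
              · exact le_rfl
              · exact hq y
          _ = (∑ c, r c) * ∑ y ∈ Sᶜ, q y := by rw [Finset.sum_mul]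
          _ ≤ 1 * ∑ y ∈ Sᶜ, q y := mul_le_mul_of_nonneg_right hr1 h7
          _ ≤ ε := by rw [one_mul]; exact h6
      have h8 := Finset.sum_le_sum fun k (_ : k ∈ Z) => h2 k
      rw [Finset.sum_add_distrib] at h8
      linarith
    linarith
  set F := ∑ x, √(p x * if x ∈ G then p x / μ (n x) * R (n x) else 0)
  have hF : 0 ≤ F := Finset.sum_nonneg fun _ _ => Real.sqrt_nonneg _
  -- Squaring gives `(1 - 3 * ε) ^ 2 ≥ 1 - 6 * ε`; if `1 - 3 * ε` is negative, so is `1 - 6 * ε`.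
  by_cases h : 0 ≤ 1 - 3 * ε
  · nlinarith [sq_nonneg ε]
  · nlinarith [sq_nonneg F]

/-! ### Schmidt forms of products, ebits and Fock sums -/

section products

variable {A B A' B' : LocalSystem} {X Y : Type} [Fintype X] [DecidableEq X] [Fintype Y]
  [DecidableEq Y]

theorem schmidt_apply {A B : Type} (U : Matrix A X ℂ) (W : Matrix B X ℂ) (s : X → ℂ) (a : A)
    (b : B) : (U * Matrix.diagonal s * Wᵀ) a b = ∑ x, U a x * s x * W b x := by
  simp [Matrix.mul_apply, Matrix.diagonal_apply]

theorem hasSchmidt_of_apply {T : Matrix A B ℂ} {p : X → ℝ} {n : X → ℤ} (hp : ∀ x, 0 ≤ p x) (K : ℤ)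
    (U : Matrix A X ℂ) (W : Matrix B X ℂ) (hU : IsGradedIsometry A n U)
    (hW : IsGradedIsometry B (fun x => K - n x) W)
    (h : ∀ a b, T a b = ∑ x, U a x * ((√(p x) : ℝ) : ℂ) * W b x) : HasSchmidt T p n :=
  ⟨hp, K, U, W, hU, hW, Matrix.ext fun a b => by rw [schmidt_apply]; exact h a b⟩

theorem IsGradedIsometry.pow {n : X → ℤ} {U : Matrix A X ℂ} (h : IsGradedIsometry A n U) (N : ℕ) :
    IsGradedIsometry (A.pow N) (fun x : Fin N → X => ∑ j, n (x j))
      (fun a x => ∏ j, U (a j) (x j)) where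
  isometry := by
    refine Matrix.ext fun x x' => ?_
    change ∑ a : Fin N → A, star (∏ j, U (a j) (x j)) * ∏ j, U (a j) (x' j) = _
    simp only [star_prod, ← Finset.prod_mul_distrib]
    rw [← Fintype.prod_sum fun j a => star (U a (x j)) * U a (x' j)]
    have h1 : ∀ y y', ∑ a, star (U a y) * U a y' = (1 : Matrix X X ℂ) y y' := fun y y' => by
      rw [← h.isometry, Matrix.mul_apply]; rfl
    simp only [h1, Matrix.one_apply, Finset.prod_ite_zero, Finset.mem_univ, true_imp_iff,
      funext_iff, Finset.prod_const_one]
  grade := by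
    intro a x hx
    change ((∑ j, A.num (a j) : ℕ) : ℤ) = _
    rw [Nat.cast_sum]
    exact Finset.sum_congr rfl fun j _ =>
      h.grade _ _ (Finset.prod_ne_zero_iff.1 hx j (Finset.mem_univ j))

theorem IsGradedIsometry.tensor {n : X → ℤ} {U : Matrix A X ℂ} (h : IsGradedIsometry A n U)
    {m : Y → ℤ} {V : Matrix A' Y ℂ} (h' : IsGradedIsometry A' m V) :
    IsGradedIsometry (A.tensor A') (fun x : X × Y => n x.1 + m x.2)
      (fun a x => U a.1 x.1 * V a.2 x.2) where
  isometry := by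
    refine Matrix.ext fun x x' => ?_
    change ∑ a : A × A', star (U a.1 x.1 * V a.2 x.2) * (U a.1 x'.1 * V a.2 x'.2) = _
    have h1 : ∀ y y', ∑ a, star (U a y) * U a y' = (1 : Matrix X X ℂ) y y' := fun y y' => by
      rw [← h.isometry, Matrix.mul_apply]; rfl
    have h2 : ∀ y y', ∑ a, star (V a y) * V a y' = (1 : Matrix Y Y ℂ) y y' := fun y y' => by
      rw [← h'.isometry, Matrix.mul_apply]; rfl
    calc _ = (∑ a, star (U a x.1) * U a x'.1) * ∑ a, star (V a x.2) * V a x'.2 := by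
          rw [Finset.sum_mul_sum, Fintype.sum_prod_type]
          refine Finset.sum_congr rfl fun a _ => Finset.sum_congr rfl fun b _ => ?_
          rw [star_mul']
          ring
      _ = _ := by
          rw [h1, h2]
          simp only [Matrix.one_apply, Prod.ext_iff, ite_and]
          split_ifs <;> simp
  grade := by
    intro a x hx
    change ((A.num a.1 + A'.num a.2 : ℕ) : ℤ) = _
    rw [Nat.cast_add, h.grade _ _ (left_ne_zero_of_mul hx), h'.grade _ _ (right_ne_zero_of_mul hx)]

theorem HasSchmidt.pow {T : Matrix A B ℂ} {p : X → ℝ} {n : X → ℤ} (h : HasSchmidt T p n) (N : ℕ) :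
    HasSchmidt (A := A.pow N) (B := B.pow N) (fun a b => ∏ j, T (a j) (b j))
      (fun x : Fin N → X => ∏ j, p (x j)) (fun x => ∑ j, n (x j)) := by
  obtain ⟨hp, K, U, W, hU, hW, rfl⟩ := h
  refine hasSchmidt_of_apply (fun x => Finset.prod_nonneg fun j _ => hp _) (N * K) _
    (fun b x => ∏ j, W (b j) (x j)) (hU.pow N) ?_ fun a b => ?_
  · have := hW.pow N
    simpa only [Finset.sum_sub_distrib, Finset.sum_const, Finset.card_univ, Fintype.card_fin,
      nsmul_eq_mul] using this
  · simp only [schmidt_apply]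
    rw [Fintype.prod_sum fun j x => U (a j) x * ((√(p x) : ℝ) : ℂ) * W (b j) x]
    refine Finset.sum_congr rfl fun x _ => ?_
    rw [Finset.prod_mul_distrib, Finset.prod_mul_distrib, Real.sqrt_prod _ fun j _ => hp _,
      Complex.ofReal_prod]

theorem HasSchmidt.tensor {T : Matrix A B ℂ} {p : X → ℝ} {n : X → ℤ} (h : HasSchmidt T p n)
    {T' : Matrix A' B' ℂ} {q : Y → ℝ} {m : Y → ℤ} (h' : HasSchmidt T' q m) :
    HasSchmidt (A := A.tensor A') (B := B.tensor B') (fun a b => T a.1 b.1 * T' a.2 b.2)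
      (fun x : X × Y => p x.1 * q x.2) (fun x => n x.1 + m x.2) := by
  obtain ⟨hp, K, U, W, hU, hW, rfl⟩ := h
  obtain ⟨hq, K', U', W', hU', hW', rfl⟩ := h'
  refine hasSchmidt_of_apply (fun x => mul_nonneg (hp _) (hq _)) (K + K') _
    (fun b x => W b.1 x.1 * W' b.2 x.2) (hU.tensor hU') ?_ fun a b => ?_
  · have := hW.tensor hW'
    simpa only [sub_add_sub_comm] using this
  · simp only [schmidt_apply]
    rw [Finset.sum_mul_sum, Fintype.sum_prod_type]
    refine Finset.sum_congr rfl fun x _ => Finset.sum_congr rfl fun y _ => ?_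
    rw [Real.sqrt_mul (hp _), Complex.ofReal_mul]
    ring

end products

theorem isGradedIsometry_of_injective (A : LocalSystem) {X : Type} [Fintype X] [DecidableEq X]
    (n : X → ℤ) (f : X → A) (hf : Function.Injective f) (hn : ∀ x, (A.num (f x) : ℤ) = n x) :
    IsGradedIsometry A n (fun a x => if a = f x then (1 : ℂ) else 0) where
  isometry := by
    refine Matrix.ext fun x x' => ?_
    change ∑ a, star (if a = f x then (1 : ℂ) else 0) * (if a = f x' then (1 : ℂ) else 0) = _
    simp [Matrix.one_apply, hf.eq_iff, eq_comm]
  grade := by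
    intro a x h
    simp only [ne_eq, ite_eq_right_iff, not_forall] at h
    obtain ⟨rfl, -⟩ := h
    exact hn x

/-- Both Schmidt vectors contain one particle of Alice: an ebit carries entanglement but no number
fluctuation. -/
theorem hasSchmidt_ebit : HasSchmidt ebit.amp (fun _ : Fin 2 => 1 / 2) (fun _ => 1) := by
  refine hasSchmidt_of_apply (fun _ => by norm_num) 2 _ _
    (isGradedIsometry_of_injective _ _ (fun x : Fin 2 => ((x, 1 - x) : Fin 2 × Fin 2)) ?_ ?_)
    (isGradedIsometry_of_injective _ _ (fun x : Fin 2 => ((1 - x, x) : Fin 2 × Fin 2)) ?_ ?_)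
    fun (a b : Fin 2 × Fin 2) => ?_
  · exact fun x y h => congrArg Prod.fst h
  · intro x
    fin_cases x <;> rfl
  · exact fun x y h => congrArg Prod.snd h
  · intro x
    fin_cases x <;> rfl
  · change (if (a = ((0, 1) : Fin 2 × Fin 2) ∧ b = ((1, 0) : Fin 2 × Fin 2)) ∨
      (a = ((1, 0) : Fin 2 × Fin 2) ∧ b = ((0, 1) : Fin 2 × Fin 2))
        then ((1 / √2 : ℝ) : ℂ) else 0) = ∑ x : Fin 2,
        (if a = ((x, 1 - x) : Fin 2 × Fin 2) then (1 : ℂ) else 0) * ((√(1 / 2) : ℝ) : ℂ) *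
          (if b = ((1 - x, x) : Fin 2 × Fin 2) then (1 : ℂ) else 0)
    rw [Fin.sum_univ_two]
    have h0 : (((0 : Fin 2), (1 : Fin 2) - 0)) = (0, 1) := rfl
    have h1 : (((1 : Fin 2), (1 : Fin 2) - 1)) = (1, 0) := rfl
    have h2 : (((1 : Fin 2) - 0, (0 : Fin 2))) = (1, 0) := rfl
    have h3 : (((1 : Fin 2) - 1, (1 : Fin 2))) = (0, 1) := rfl
    have h4 : √(1 / 2 : ℝ) = 1 / √2 := by rw [Real.sqrt_div zero_le_one, Real.sqrt_one]
    rw [h0, h1, h2, h3, h4]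
    have h5 : ((0, 1) : Fin 2 × Fin 2) ≠ (1, 0) := by decide
    have h6 : ((1, 0) : Fin 2 × Fin 2) ≠ (0, 1) := by decide
    by_cases ha : a = ((0, 1) : Fin 2 × Fin 2)
    · subst ha
      by_cases hb : b = ((1, 0) : Fin 2 × Fin 2)
      · subst hb; simp
      · simp [hb]
    · by_cases ha' : a = ((1, 0) : Fin 2 × Fin 2)
      · subst ha'
        by_cases hb : b = ((0, 1) : Fin 2 × Fin 2)
        · subst hb; simp
        · simp [hb]
      · simp [ha, ha']

theorem hasSchmidt_fockSum (M : ℕ) (c : Fin (M + 1) → ℝ) (h0 : ∀ n, 0 ≤ c n)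
    (hc : ∑ n, ‖((√(c n) : ℝ) : ℂ)‖ ^ 2 = 1) :
    HasSchmidt (fockSum M (fun n => ((√(c n) : ℝ) : ℂ)) hc).amp c
      (fun n => ((n : ℕ) : ℤ)) := by
  refine hasSchmidt_of_apply h0 M _ _
    (isGradedIsometry_of_injective _ _ (fun n : Fin (M + 1) => fock M n) ?_ ?_)
    (isGradedIsometry_of_injective _ _ (fun n : Fin (M + 1) => fock M (M - n)) ?_ ?_) fun a b => ?_
  · exact fun x y h => Fin.ext (fock_injective (by omega) (by omega) h)
  · exact fun x => congrArg _ (num_fock (by omega))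
  · intro x y h
    have := fock_injective (by omega) (by omega) h
    exact Fin.ext (by omega)
  · intro x
    rw [num_fock (by omega)]
    have : (x : ℕ) ≤ M := by omega
    simp [Nat.cast_sub this]
  · change (∑ n : Fin (M + 1), if a = fock M n ∧ b = fock M (M - n) then _ else _) = _
    refine Finset.sum_congr rfl fun n _ => ?_
    simp only [ite_and]
    split_ifs <;> simp

/-! ### Graded Schmidt decomposition of a pure state -/

theorem sum_eq_sum_fiber {A : Type} [Fintype A] (f : A → ℕ) (n : ℕ)
    {M : Type} [AddCommMonoid M] (F : A → M) (hF : ∀ a, F a ≠ 0 → f a = n) :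
    ∑ a, F a = ∑ a : {a // f a = n}, F a := by
  rw [← Finset.sum_subtype (Finset.univ.filter fun a => f a = n) (by simp) F]
  refine (Finset.sum_subset (Finset.filter_subset _ _) fun a _ ha => ?_).symm
  by_contra h
  exact ha (Finset.mem_filter.2 ⟨Finset.mem_univ _, hF a h⟩)

/-- A Hermitian operator that commutes with the particle number has an eigenbasis of states of
definite particle number. -/
theorem exists_graded_eigenbasis (A : LocalSystem) (ρ : Matrix A A ℂ) (hρ : ρ.IsHermitian)
    (hn : ∀ a a', ρ a a' ≠ 0 → A.num a = A.num a') :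
    ∃ (U : Matrix A A ℂ) (l : A → ℝ), IsGradedIsometry A (fun a => (A.num a : ℤ)) U ∧
      ρ * U = U * Matrix.diagonal fun a => (l a : ℂ) := by
  -- Each diagonal block of `ρ` is diagonalized separately, and the eigenbases are glued to a block
  -- diagonal unitary.
  have hb : ∀ k, (ρ.submatrix (Subtype.val : {a // A.num a = k} → A) Subtype.val).IsHermitian :=
    fun k => hρ.submatrix _
  let V : ∀ k, Matrix {a // A.num a = k} {a // A.num a = k} ℂ := fun k => (hb k).eigenvectorUnitary
  have hV : ∀ k, (V k)ᴴ * V k = 1 := fun k => Unitary.coe_star_mul_self (hb k).eigenvectorUnitary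
  have hVe : ∀ k a x, ∑ a', ρ a.1 a'.1 * V k a' x = (hb k).eigenvalues x * V k a x := by
    intro k a x
    have := congrFun ((hb k).mulVec_eigenvectorBasis x) a
    simp only [Matrix.mulVec, dotProduct, Matrix.submatrix_apply, Pi.smul_apply,
      Complex.real_smul] at this
    exact this
  let U : Matrix A A ℂ := fun a x => if h : A.num a = A.num x then V (A.num x) ⟨a, h⟩ ⟨x, rfl⟩ else 0
  have hU : ∀ k (a x : {a // A.num a = k}), U a x = V k a x := by
    rintro k ⟨a, ha⟩ ⟨x, rfl⟩
    simp [U, ha]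
  have hU0 : ∀ a x, U a x ≠ 0 → A.num a = A.num x := by
    intro a x h
    by_contra hc
    exact h (dif_neg hc)
  refine ⟨U, fun x => (hb (A.num x)).eigenvalues ⟨x, rfl⟩, ⟨?_, fun a x h => ?_⟩, ?_⟩
  · ext x x'
    rw [Matrix.mul_apply, sum_eq_sum_fiber A.num (A.num x') _ fun a h =>
      hU0 _ _ (right_ne_zero_of_mul h)]
    simp only [Matrix.conjTranspose_apply]
    by_cases hx : A.num x = A.num x'
    · have h1 := congrFun (congrFun (hV (A.num x')) ⟨x, hx⟩) ⟨x', rfl⟩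
      rw [Matrix.mul_apply] at h1
      simp only [Matrix.conjTranspose_apply] at h1
      have h2 : ∀ a : {a // A.num a = A.num x'}, star (U a x) * U a x'
          = star (V _ a ⟨x, hx⟩) * V _ a ⟨x', rfl⟩ := fun a => by
        rw [← hU _ a ⟨x, hx⟩, ← hU _ a ⟨x', rfl⟩]
      rw [Finset.sum_congr rfl fun a _ => h2 a, h1]
      simp [Matrix.one_apply]
    · rw [Matrix.one_apply_ne (fun h => hx (by rw [h]))]
      refine Finset.sum_eq_zero fun a _ => ?_
      have : U a x = 0 := by
        by_contra h
        exact hx ((hU0 _ _ h).symm.trans a.2)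
      rw [this, star_zero, zero_mul]
  · exact congrArg _ (hU0 a x h)
  · ext a x
    rw [Matrix.mul_diagonal, Matrix.mul_apply, sum_eq_sum_fiber A.num (A.num x) _ fun a h =>
      hU0 _ _ (right_ne_zero_of_mul h)]
    by_cases ha : A.num a = A.num x
    · have h1 := hVe _ ⟨a, ha⟩ ⟨x, rfl⟩
      rw [← hU _ ⟨a, ha⟩ ⟨x, rfl⟩] at h1
      rw [mul_comm, ← h1]
      exact Finset.sum_congr rfl fun a' _ => by rw [← hU _ a' ⟨x, rfl⟩]
    · have h1 : U a x = 0 := by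
        by_contra h
        exact ha (hU0 _ _ h)
      rw [h1, zero_mul]
      refine Finset.sum_eq_zero fun a' _ => ?_
      have : ρ a a' = 0 := by
        by_contra h
        exact ha ((hn _ _ h).trans a'.2)
      rw [this, zero_mul]

/-- Both families are the roots of the characteristic polynomial with multiplicity. The entropy,
defined by the eigenvalues of the spectral theorem, can thus be computed in the graded basis. -/
theorem sum_eigenvalues_eq {A : Type} [Fintype A] [DecidableEq A] {ρ U : Matrix A A ℂ}
    (hρ : ρ.IsHermitian) (hU : Uᴴ * U = 1) (l : A → ℝ)
    (h : ρ * U = U * Matrix.diagonal fun a => (l a : ℂ)) (f : ℝ → ℝ) :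
    ∑ i, f (hρ.eigenvalues i) = ∑ i, f (l i) := by
  have hU' : U * Uᴴ = 1 := mul_eq_one_comm.1 hU
  have h1 : ρ = U * Matrix.diagonal (fun a => (l a : ℂ)) * Uᴴ := by
    rw [← h, Matrix.mul_assoc, hU', Matrix.mul_one]
  have h2 : ρ.charpoly = (Matrix.diagonal (fun a => (l a : ℂ))).charpoly := by
    rw [h1, Matrix.charpoly_mul_comm, ← Matrix.mul_assoc, hU, Matrix.one_mul]
  have h3 : ρ.charpoly.roots = Multiset.map (fun a => (l a : ℂ)) Finset.univ.val := by
    rw [h2, Matrix.charpoly_diagonal, Polynomial.roots_prod]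
    · simp
    · exact Finset.prod_ne_zero_iff.2 fun i _ => Polynomial.X_sub_C_ne_zero _
  rw [hρ.roots_charpoly_eq_eigenvalues] at h3
  have h4 := congrArg (fun s => (s.map fun z : ℂ => f z.re).sum) h3
  simpa using h4

/-- Alice's vectors are a graded eigenbasis of her reduced state, and Bob's are the normalized
partial overlaps of the state with them. Null eigenvalues are discarded to make all weights
positive. The identity for arbitrary `g` yields mean, variance and occurring numbers at once. -/
theorem PureState.exists_schmidt {A B : LocalSystem} (φ : PureState A B) :
    ∃ (X : Type) (_ : Fintype X) (_ : DecidableEq X) (p : X → ℝ) (n : X → ℕ),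
      HasSchmidt φ.amp p (fun x => (n x : ℤ)) ∧ (∀ x, 0 < p x) ∧ (∀ x, n x ≤ φ.total) ∧
      (∀ g : ℕ → ℝ, ∑ a, ∑ b, g (A.num a) * ‖φ.amp a b‖ ^ 2 = ∑ x, p x * g (n x)) ∧
      φ.entropy = (∑ x, Real.negMulLog (p x)) / Real.log 2 := by
  obtain ⟨U, l, hU, hl⟩ := exists_graded_eigenbasis A (φ.amp * φ.ampᴴ) φ.reduced_isHermitian (by
    intro a a' h
    obtain ⟨b, -, hb⟩ := Finset.exists_ne_zero_of_sum_ne_zero (by rwa [Matrix.mul_apply] at h)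
    have h1 := φ.sector _ _ (left_ne_zero_of_mul hb)
    have h2 := φ.sector a' b (by simpa using right_ne_zero_of_mul hb)
    omega)
  have hU' : U * Uᴴ = 1 := mul_eq_one_comm.1 hU.isometry
  -- The rows of `R` are Bob's unnormalized Schmidt vectors: orthogonal, with squared norms `l x`,
  -- and with `φ.total - A.num x` particles.
  let R : Matrix A B ℂ := Uᴴ * φ.amp
  have hR : R * Rᴴ = Matrix.diagonal fun a => (l a : ℂ) := by
    simp only [R, Matrix.conjTranspose_mul, Matrix.conjTranspose_conjTranspose]
    rw [Matrix.mul_assoc, ← Matrix.mul_assoc φ.amp, hl, ← Matrix.mul_assoc, hU.isometry,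
      Matrix.one_mul]
  have hRn : ∀ x b, R x b ≠ 0 → A.num x + B.num b = φ.total := by
    intro x b h
    obtain ⟨a, -, ha⟩ := Finset.exists_ne_zero_of_sum_ne_zero
      (show ∑ a, Uᴴ x a * φ.amp a b ≠ 0 from h)
    have h1 := hU.grade a x (by simpa using left_ne_zero_of_mul ha)
    have h2 := φ.sector a b (right_ne_zero_of_mul ha)
    omega
  have hRs : ∀ x, ∑ b, ‖R x b‖ ^ 2 = l x := by
    intro x
    have := congrFun (congrFun hR x) x
    rw [Matrix.mul_apply, Matrix.diagonal_apply_eq] at this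
    have h2 : ∀ b, R x b * Rᴴ b x = ((‖R x b‖ ^ 2 : ℝ) : ℂ) := fun b => by
      rw [Matrix.conjTranspose_apply, RCLike.star_def, Complex.mul_conj, Complex.normSq_eq_norm_sq]
    simp only [h2] at this
    rw [← Complex.ofReal_sum] at this
    exact_mod_cast this
  have hl0 : ∀ x, 0 ≤ l x := fun x => by
    rw [← hRs]
    positivity
  have hR0 : ∀ x b, l x = 0 → R x b = 0 := by
    intro x b h
    have h1 := (Finset.sum_eq_zero_iff_of_nonneg (fun b _ => sq_nonneg ‖R x b‖)).1
      ((hRs x).trans h) b (Finset.mem_univ _)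
    simpa using h1
  have hpos : ∀ x : {x : A // l x ≠ 0}, 0 < l x := fun x => lt_of_le_of_ne (hl0 _) (Ne.symm x.2)
  have hsub : ∀ F : A → ℝ, (∀ a, l a = 0 → F a = 0) →
      ∑ a, F a = ∑ x : {x : A // l x ≠ 0}, F x := by
    intro F hF
    rw [← Finset.sum_subtype (Finset.univ.filter fun a => l a ≠ 0) (by simp) F]
    refine (Finset.sum_subset (Finset.filter_subset _ _) fun a _ ha => hF a ?_).symm
    simpa using ha
  refine ⟨{x : A // l x ≠ 0}, inferInstance, inferInstance, fun x => l x, fun x => A.num x,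
    hasSchmidt_of_apply (fun x => hl0 _) φ.total (fun a x => U a x)
      (fun b x => R x b / ((√(l x) : ℝ) : ℂ)) ⟨?_, fun a x h => hU.grade _ _ h⟩ ⟨?_, ?_⟩ ?_, hpos,
    ?_, ?_, ?_⟩
  · refine Matrix.ext fun x x' => ?_
    have := congrFun (congrFun hU.isometry x) x'
    rw [Matrix.mul_apply] at this
    refine this.trans ?_
    simp [Matrix.one_apply, Subtype.ext_iff]
  · refine Matrix.ext fun x x' => ?_
    change ∑ b, star (R x b / ((√(l x) : ℝ) : ℂ)) * (R x' b / ((√(l x') : ℝ) : ℂ)) = _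
    have h1 := congrFun (congrFun hR x') x
    rw [Matrix.mul_apply] at h1
    have h2 : ∀ b, star (R x b / ((√(l x) : ℝ) : ℂ)) * (R x' b / ((√(l x') : ℝ) : ℂ))
        = (R x' b * Rᴴ b x) / (((√(l x) : ℝ) : ℂ) * ((√(l x') : ℝ) : ℂ)) := fun b => by
      simp only [RCLike.star_def, map_div₀, Complex.conj_ofReal, Matrix.conjTranspose_apply]
      ring
    simp only [h2]
    rw [← Finset.sum_div, h1, Matrix.diagonal_apply]
    by_cases hx : x = x'
    · subst hx
      rw [if_pos rfl, Matrix.one_apply_eq, ← Complex.ofReal_mul, Real.mul_self_sqrt (hl0 _),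
        div_self]
      exact_mod_cast x.2
    · rw [if_neg (fun h => hx (Subtype.ext h.symm)), zero_div, Matrix.one_apply_ne hx]
  · intro b x h
    have h1 := hRn x b (div_ne_zero_iff.1 h).1
    change (B.num b : ℤ) = φ.total - A.num x
    omega
  · intro a b
    have h1 : φ.amp a b = ∑ x, U a x * R x b := by
      have : φ.amp = U * R := by rw [← Matrix.mul_assoc, hU', Matrix.one_mul]
      conv_lhs => rw [this]
      rw [Matrix.mul_apply]
    rw [h1]
    rw [← Finset.sum_filter_of_ne (p := fun x => l x ≠ 0),
      Finset.sum_subtype (Finset.univ.filter fun a => l a ≠ 0) (p := fun x => l x ≠ 0) (by simp)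
        (fun x => U a x * R x b)]
    · refine Finset.sum_congr rfl fun x _ => ?_
      have : ((√(l x) : ℝ) : ℂ) ≠ 0 := by exact_mod_cast (Real.sqrt_pos.2 (hpos x)).ne'
      field_simp
    · intro x _ hx h
      exact hx (by rw [hR0 x b h, mul_zero])
  · intro x
    obtain ⟨b, hb⟩ : ∃ b, R x b ≠ 0 := by
      by_contra h
      push Not at h
      exact x.2 (by rw [← hRs]; simp [h])
    have := hRn x b hb
    change A.num x ≤ φ.total
    omega
  · intro g
    rw [← hsub (fun x => l x * g (A.num x)) (fun a ha => by simp [ha])]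
    have h1 : ∀ a, ∑ b, ‖φ.amp a b‖ ^ 2 = ∑ x, l x * ‖U a x‖ ^ 2 := by
      intro a
      have h2 : φ.amp * φ.ampᴴ = U * Matrix.diagonal (fun a => (l a : ℂ)) * Uᴴ := by
        rw [← hl, Matrix.mul_assoc, hU', Matrix.mul_one]
      have h3 := congrFun (congrFun h2 a) a
      rw [Matrix.mul_apply, Matrix.mul_apply] at h3
      simp only [Matrix.mul_diagonal, Matrix.conjTranspose_apply, RCLike.star_def] at h3
      have h4 : ∀ x, U a x * (l x : ℂ) * (starRingEnd ℂ) (U a x) = ((l x * ‖U a x‖ ^ 2 : ℝ) : ℂ) :=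
        fun x => by
          rw [mul_right_comm, Complex.mul_conj, Complex.normSq_eq_norm_sq]
          push_cast
          ring
      simp only [h4, Complex.mul_conj, Complex.normSq_eq_norm_sq, ← Complex.ofReal_sum] at h3
      exact_mod_cast h3
    have h5 : ∀ x, ∑ a, ‖U a x‖ ^ 2 = 1 := by
      intro x
      have h3 := congrFun (congrFun hU.isometry x) x
      rw [Matrix.mul_apply, Matrix.one_apply_eq] at h3
      have h4 : ∀ a, Uᴴ x a * U a x = ((‖U a x‖ ^ 2 : ℝ) : ℂ) := fun a => by
        rw [Matrix.conjTranspose_apply, RCLike.star_def, mul_comm, Complex.mul_conj,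
          Complex.normSq_eq_norm_sq]
      simp only [h4, ← Complex.ofReal_sum] at h3
      exact_mod_cast h3
    simp only [← Finset.mul_sum, h1]
    simp only [Finset.mul_sum]
    rw [Finset.sum_comm]
    refine Finset.sum_congr rfl fun x _ => ?_
    have h6 : ∀ a, g (A.num a) * (l x * ‖U a x‖ ^ 2) = l x * g (A.num x) * ‖U a x‖ ^ 2 := by
      intro a
      by_cases h : U a x = 0
      · simp [h]
      · have : A.num a = A.num x := by exact_mod_cast hU.grade a x h
        rw [this]
        ring
    simp only [h6]
    rw [← Finset.mul_sum, h5, mul_one]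
  · rw [PureState.entropy, ← Finset.sum_div,
      sum_eigenvalues_eq φ.reduced_isHermitian hU.isometry l hl,
      ← hsub (fun x => Real.negMulLog (l x)) (fun a ha => by simp [ha])]

/-! ### Characteristic functions and the local limit theorem -/

open MeasureTheory Complex in
theorem integral_exp_lattice {d : ℕ} (hd : 0 < d) (k : ℤ) :
    ∫ t in (-(Real.pi / d))..(Real.pi / d), exp (((d * k : ℤ) : ℂ) * I * t)
      = if k = 0 then ((2 * Real.pi / d : ℝ) : ℂ) else 0 := by
  have hd' : (d : ℂ) ≠ 0 := by exact_mod_cast hd.ne'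
  split_ifs with hk
  · subst hk
    simp only [mul_zero, Int.cast_zero, zero_mul, Complex.exp_zero, intervalIntegral.integral_const]
    rw [Complex.real_smul, mul_one]
    congr 1
    ring
  · have hk' : (k : ℂ) ≠ 0 := by exact_mod_cast hk
    have hc : ((d * k : ℤ) : ℂ) * I ≠ 0 := by
      push_cast
      exact mul_ne_zero (mul_ne_zero hd' hk') I_ne_zero
    rw [integral_exp_mul_complex hc, div_eq_zero_iff]
    left
    rw [sub_eq_zero, Complex.exp_eq_exp_iff_exists_int]
    refine ⟨k, ?_⟩
    push_cast
    field_simp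
    ring

section

variable {X : Type} [Fintype X] (p : X → ℝ) (f : X → ℤ)

/-- Mean of `f` under the weights `p`. -/
def mean : ℝ := ∑ x, p x * f x

/-- Variance of `f` under the weights `p`. -/
def variance : ℝ := ∑ x, p x * (f x - mean p f) ^ 2

/-- Characteristic function of the centred variable `f`. -/
def charFn (t : ℝ) : ℂ := ∑ x, (p x : ℂ) * Complex.exp (((f x - mean p f : ℝ) : ℂ) * Complex.I * t)

/-- Distribution of the sum of `N` independent copies of `f`. -/
def sumDist (N : ℕ) : ℤ → ℝ :=
  marginal (fun x : Fin N → X => ∏ j, p (x j)) (fun x => ∑ j, f (x j))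

theorem continuous_charFn : Continuous (charFn p f) := by
  unfold charFn
  fun_prop

open Complex in
theorem charFn_pow (N : ℕ) (t : ℝ) : charFn p f t ^ N = ∑ x : Fin N → X, ((∏ j, p (x j) : ℝ) : ℂ) *
    exp (((∑ j, f (x j) : ℤ) - N * mean p f : ℝ) * I * t) := by
  have : charFn p f t ^ N = ∏ _j : Fin N, charFn p f t := by simp
  rw [this]
  unfold charFn
  rw [Fintype.prod_sum fun (_ : Fin N) x => (p x : ℂ) * exp (((f x - mean p f : ℝ) : ℂ) * I * t)]
  refine Finset.sum_congr rfl fun x _ => ?_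
  rw [Finset.prod_mul_distrib, ← Complex.exp_sum, ← Complex.ofReal_prod]
  congr 2
  rw [← Finset.sum_mul, ← Finset.sum_mul, ← Complex.ofReal_sum, Finset.sum_sub_distrib]
  simp

open Complex in
/-- Fourier inversion for the distribution of a sum of independent lattice variables. -/
theorem integral_charFn_pow {d : ℕ} (hd : 0 < d) (hf : ∀ x y, (d : ℤ) ∣ f x - f y) {N : ℕ}
    (hN : 0 < N) (n : ℤ)     (hn : ∀ x, (d : ℤ) ∣ n - N * f x) :
    ∫ t in (-(Real.pi / d))..(Real.pi / d),
      charFn p f t ^ N * exp (-((n - N * mean p f : ℝ) * I * t))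
      = ((2 * Real.pi / d * sumDist p f N n : ℝ) : ℂ) := by
  -- All values of the sum lie in the coset `n + dℤ`, so that integration over one period `2π / d`
  -- isolates the value `n`.
  have hdvd : ∀ x : Fin N → X, ∃ k : ℤ, ∑ j, f (x j) - n = d * k := by
    intro x
    have h1 := hn (x ⟨0, hN⟩)
    have h2 : (d : ℤ) ∣ ∑ j, (f (x j) - f (x ⟨0, hN⟩)) := Finset.dvd_sum fun j _ => hf _ _
    obtain ⟨k, hk⟩ := dvd_sub h2 h1
    refine ⟨k, ?_⟩
    rw [← hk, Finset.sum_sub_distrib]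
    simp
  choose k hk using hdvd
  have h1 : ∀ t : ℝ, charFn p f t ^ N * exp (-((n - N * mean p f : ℝ) * I * t))
      = ∑ x : Fin N → X, ((∏ j, p (x j) : ℝ) : ℂ) * exp (((d * k x : ℤ) : ℂ) * I * t) := by
    intro t
    rw [charFn_pow, Finset.sum_mul]
    refine Finset.sum_congr rfl fun x _ => ?_
    rw [mul_assoc, ← Complex.exp_add, ← hk]
    congr 2
    push_cast
    ring
  simp only [h1]
  rw [intervalIntegral.integral_finsetSum]
  · simp only [intervalIntegral.integral_const_mul, integral_exp_lattice hd]
    unfold sumDist marginal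
    rw [Finset.mul_sum, Complex.ofReal_sum]
    refine Finset.sum_congr rfl fun x _ => ?_
    have : (∑ j, f (x j) = n) ↔ k x = 0 := by
      have hd' : (d : ℤ) ≠ 0 := by exact_mod_cast hd.ne'
      rw [← sub_eq_zero, hk, mul_eq_zero, or_iff_right hd']
    simp only [this]
    split_ifs <;> push_cast <;> ring
  · intro x _
    exact Continuous.intervalIntegrable (by fun_prop) _ _

variable {p f}

/-- `½ (1 - |χ(t)|²)`, with `χ` the characteristic function. -/
def oscillation (p : X → ℝ) (f : X → ℤ) (t : ℝ) : ℝ :=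
  ∑ x, ∑ y, p x * p y * Real.sin (t * (f x - f y) / 2) ^ 2

/-- Symmetrization: `|χ|²` is the mean of `cos (t * (f x - f y))` over independent `x` and `y`. -/
theorem norm_charFn_sq (hp1 : ∑ x, p x = 1) (t : ℝ) :
    ‖charFn p f t‖ ^ 2 = 1 - 2 * oscillation p f t := by
  have h1 : ((‖charFn p f t‖ ^ 2 : ℝ) : ℂ) = charFn p f t * star (charFn p f t) := by
    rw [RCLike.star_def, Complex.mul_conj, Complex.normSq_eq_norm_sq]
  have h2 : ‖charFn p f t‖ ^ 2 = ∑ x, ∑ y, p x * p y * Real.cos (t * (f x - f y)) := by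
    have h3 : (charFn p f t * star (charFn p f t)).re
        = ∑ x, ∑ y, p x * p y * Real.cos (t * (f x - f y)) := by
      unfold charFn
      rw [star_sum, Finset.sum_mul_sum, Complex.re_sum]
      refine Finset.sum_congr rfl fun x _ => ?_
      rw [Complex.re_sum]
      refine Finset.sum_congr rfl fun y _ => ?_
      have : (p x : ℂ) * Complex.exp (((f x - mean p f : ℝ) : ℂ) * Complex.I * t) *
          star ((p y : ℂ) * Complex.exp (((f y - mean p f : ℝ) : ℂ) * Complex.I * t))
          = ((p x * p y : ℝ) : ℂ) * Complex.exp ((t * (f x - f y) : ℝ) * Complex.I) := by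
        rw [star_mul', RCLike.star_def, Complex.conj_ofReal, ← Complex.exp_conj,
          mul_mul_mul_comm, ← Complex.exp_add]
        simp only [map_mul, Complex.conj_ofReal, Complex.conj_I]
        push_cast
        congr 2
        ring
      rw [this, Complex.re_ofReal_mul, Complex.exp_ofReal_mul_I_re]
    rw [← h3, ← h1, Complex.ofReal_re]
  have h4 : (1 : ℝ) = ∑ x, ∑ y, p x * p y := by
    rw [← Finset.sum_mul_sum, hp1, one_mul]
  rw [h2, oscillation]
  conv_rhs => rw [h4]
  rw [Finset.mul_sum, ← Finset.sum_sub_distrib]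
  refine Finset.sum_congr rfl fun x _ => ?_
  rw [Finset.mul_sum, ← Finset.sum_sub_distrib]
  refine Finset.sum_congr rfl fun y _ => ?_
  have : Real.cos (t * (f x - f y)) = 1 - 2 * Real.sin (t * (f x - f y) / 2) ^ 2 := by
    have := Real.cos_sq' (t * (f x - f y) / 2)
    have h5 := Real.cos_two_mul (t * (f x - f y) / 2)
    rw [mul_div_cancel₀ _ (two_ne_zero)] at h5
    linarith
  rw [this]
  ring

theorem oscillation_nonneg (hp : ∀ x, 0 < p x) (t : ℝ) : 0 ≤ oscillation p f t :=
  Finset.sum_nonneg fun x _ => Finset.sum_nonneg fun y _ =>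
    mul_nonneg (mul_nonneg (hp x).le (hp y).le) (sq_nonneg _)

/-- The integers `z` with such a bound form a subgroup, by the addition formula for the sine. It
contains every difference `f x - f y`, for which one term of the oscillation suffices. -/
theorem abs_sin_le_oscillation (hp : ∀ x, 0 < p x) {z : ℤ}
    (hz : z ∈ AddSubgroup.closure {z | ∃ x y, z = f x - f y}) :
    ∃ C : ℝ, ∀ t : ℝ, |Real.sin (t * z / 2)| ≤ C * √(oscillation p f t) := by
  induction hz using AddSubgroup.closure_induction with
  | mem z hz =>
    obtain ⟨x, y, rfl⟩ := hz
    refine ⟨1 / √(p x * p y), fun t => ?_⟩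
    have hxy : 0 < p x * p y := mul_pos (hp x) (hp y)
    have h1 : p x * p y * Real.sin (t * (f x - f y) / 2) ^ 2 ≤ oscillation p f t := by
      refine le_trans ?_ (Finset.single_le_sum (f := fun x => ∑ y, p x * p y *
        Real.sin (t * (f x - f y) / 2) ^ 2) (fun x _ => Finset.sum_nonneg fun y _ =>
          mul_nonneg (mul_nonneg (hp x).le (hp y).le) (sq_nonneg _)) (Finset.mem_univ x))
      exact Finset.single_le_sum (f := fun y => p x * p y *
        Real.sin (t * (f x - f y) / 2) ^ 2) (fun y _ =>
          mul_nonneg (mul_nonneg (hp x).le (hp y).le) (sq_nonneg _)) (Finset.mem_univ y)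
    have h2 := Real.sqrt_le_sqrt h1
    rw [Real.sqrt_mul hxy.le, Real.sqrt_sq_eq_abs] at h2
    push_cast
    rw [div_mul_eq_mul_div, one_mul, le_div_iff₀ (Real.sqrt_pos.2 hxy), mul_comm]
    exact h2
  | zero => exact ⟨0, fun t => by simp⟩
  | add z w _ _ hz hw =>
    obtain ⟨C, hC⟩ := hz
    obtain ⟨C', hC'⟩ := hw
    refine ⟨C + C', fun t => ?_⟩
    have : t * ((z + w : ℤ) : ℝ) / 2 = t * z / 2 + t * w / 2 := by push_cast; ring
    rw [this, Real.sin_add, add_mul]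
    refine (abs_add_le _ _).trans (add_le_add ?_ ?_)
    · rw [abs_mul]
      exact (mul_le_of_le_one_right (abs_nonneg _) (Real.abs_cos_le_one _)).trans (hC t)
    · rw [abs_mul]
      exact (mul_le_of_le_one_left (abs_nonneg _) (Real.abs_cos_le_one _)).trans (hC' t)
  | neg z _ hz =>
    obtain ⟨C, hC⟩ := hz
    refine ⟨C, fun t => ?_⟩
    have : t * ((-z : ℤ) : ℝ) / 2 = -(t * z / 2) := by push_cast; ring
    rw [this, Real.sin_neg, abs_neg]
    exact hC t

/-- The oscillation controls `|sin (t * d / 2)|`, which is at least `d * |t| / π` on the whole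
period by Jordan's inequality. Hence `|χ|² ≤ 1 - 2 * c * t ^ 2`. This one bound dominates both small
and large frequencies. -/
theorem exists_norm_charFn_le (hp : ∀ x, 0 < p x) (hp1 : ∑ x, p x = 1) {d : ℕ} (hd : 0 < d)
    (hz : (d : ℤ) ∈ AddSubgroup.closure {z | ∃ x y, z = f x - f y}) :
    ∃ c : ℝ, 0 < c ∧ ∀ t : ℝ, |t| ≤ Real.pi / d → ‖charFn p f t‖ ≤ Real.exp (-c * t ^ 2) := by
  obtain ⟨C, hC⟩ := abs_sin_le_oscillation hp hz
  have hd' : (0 : ℝ) < d := by exact_mod_cast hd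
  have hpi := Real.pi_pos
  have hmain : ∀ t : ℝ, |t| ≤ Real.pi / d → d * |t| / Real.pi ≤ C * √(oscillation p f t) := by
    intro t ht
    refine le_trans ?_ (hC t)
    have h1 : |Real.sin (t * (d : ℤ) / 2)| = Real.sin (|t| * d / 2) := by
      rw [le_div_iff₀ hd'] at ht
      have h2 : 0 ≤ Real.sin (|t| * d / 2) :=
        Real.sin_nonneg_of_nonneg_of_le_pi (by positivity) (by linarith)
      rcases abs_cases t with ⟨h, _⟩ | ⟨h, _⟩
      · rw [h] at h2 ⊢
        rw [Int.cast_natCast, abs_of_nonneg h2]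
      · rw [h] at h2 ⊢
        rw [← abs_of_nonneg h2, Int.cast_natCast]
        have : -t * d / 2 = -(t * d / 2) := by ring
        rw [this, Real.sin_neg, abs_neg]
    rw [h1]
    rw [le_div_iff₀ hd'] at ht
    have := Real.mul_le_sin (x := |t| * d / 2) (by positivity) (by linarith)
    refine le_trans (le_of_eq ?_) this
    field_simp
  -- At the end point `t = π / d` the left side of `hmain` is `1`, which forces `C` to be positive.
  have hCpos : 0 < C := by
    by_contra h
    have h1 := hmain (Real.pi / d) (by rw [abs_of_pos (by positivity)])
    have h2 : C * √(oscillation p f (Real.pi / d)) ≤ 0 :=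
      mul_nonpos_of_nonpos_of_nonneg (not_lt.1 h) (Real.sqrt_nonneg _)
    have h3 : 0 < d * |Real.pi / d| / Real.pi := by
      rw [abs_of_pos (by positivity)]
      positivity
    linarith
  refine ⟨d ^ 2 / (Real.pi ^ 2 * C ^ 2), by positivity, fun t ht => ?_⟩
  have h1 := hmain t ht
  have h2 : (d * |t| / Real.pi) ^ 2 ≤ (C * √(oscillation p f t)) ^ 2 :=
    pow_le_pow_left₀ (by positivity) h1 2
  rw [mul_pow, Real.sq_sqrt (oscillation_nonneg hp t), div_pow, mul_pow, sq_abs] at h2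
  have h3 : d ^ 2 / (Real.pi ^ 2 * C ^ 2) * t ^ 2 ≤ oscillation p f t := by
    rw [← div_le_iff₀' (by positivity)] at h2
    refine le_trans (le_of_eq ?_) h2
    field_simp
  refine abs_le_of_sq_le_sq' ?_ (Real.exp_pos _).le |>.2
  rw [norm_charFn_sq hp1, ← Real.exp_nat_mul]
  have h4 := Real.add_one_le_exp (((2 : ℕ) : ℝ) * (-(d ^ 2 / (Real.pi ^ 2 * C ^ 2)) * t ^ 2))
  push_cast at h4 ⊢
  linarith

end

open Complex in
-- Second order Taylor expansion: the remainder is of order `N * |w| ^ 3`, that is `|b| ^ 3 / √N`.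
-- The linear term is subtracted because it averages to zero for a centred variable.
theorem tendsto_mul_exp_sub (b : ℝ) :
    Tendsto (fun N : ℕ => (N : ℂ) * (exp ((b / √N : ℝ) * I) - 1 - (b / √N : ℝ) * I)) atTop
      (𝓝 (-(b : ℂ) ^ 2 / 2)) := by
  have hs : Tendsto (fun N : ℕ => √(N : ℝ)) atTop atTop :=
    Real.tendsto_sqrt_atTop.comp tendsto_natCast_atTop_atTop
  rw [tendsto_iff_norm_sub_tendsto_zero]
  refine squeeze_zero' (g := fun N : ℕ => |b| ^ 3 * Real.exp |b| / √N)
    (Eventually.of_forall fun _ => norm_nonneg _) ?_ (hs.const_div_atTop _)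
  filter_upwards [eventually_ge_atTop 1] with N hN
  have hN' : (1 : ℝ) ≤ N := by exact_mod_cast hN
  have hN0 : (0 : ℝ) < N := by linarith
  have hsq : 1 ≤ √(N : ℝ) := Real.one_le_sqrt.2 hN'
  have hsq0 : 0 < √(N : ℝ) := by linarith
  set w : ℂ := (b / √N : ℝ) * I with hw
  have hwn : ‖w‖ = |b| / √N := by
    rw [hw, norm_mul, norm_I, mul_one, Complex.norm_real, Real.norm_eq_abs, abs_div,
      abs_of_pos hsq0]
  have hwle : ‖w‖ ≤ |b| := by
    rw [hwn]
    exact div_le_self (abs_nonneg _) hsq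
  have hw2 : (N : ℂ) * w ^ 2 = -(b : ℂ) ^ 2 := by
    have : ((√(N : ℝ) : ℝ) : ℂ) ^ 2 = N := by
      rw [← Complex.ofReal_pow, Real.sq_sqrt hN0.le]; simp
    have hN0' : (N : ℂ) ≠ 0 := by exact_mod_cast hN0.ne'
    rw [hw, mul_pow, I_sq, Complex.ofReal_div, div_pow, this]
    field_simp
  have h1 : (N : ℂ) * (exp w - 1 - w) - -(b : ℂ) ^ 2 / 2
      = N * (exp w - ∑ m ∈ Finset.range 3, w ^ m / m.factorial) := by
    rw [← hw2]
    simp [Finset.sum_range_succ, Nat.factorial]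
    ring
  rw [h1, norm_mul, Complex.norm_natCast]
  calc (N : ℝ) * ‖exp w - ∑ m ∈ Finset.range 3, w ^ m / m.factorial‖
      ≤ N * (‖w‖ ^ 3 * Real.exp ‖w‖) :=
        mul_le_mul_of_nonneg_left (norm_exp_sub_sum_le_norm_mul_exp w 3) hN0.le
    _ ≤ N * (‖w‖ ^ 3 * Real.exp |b|) := by gcongr
    _ = |b| ^ 3 * Real.exp |b| / √N := by
      rw [hwn, div_pow]
      have : √(N : ℝ) ^ 3 = N * √N := by rw [pow_succ, Real.sq_sqrt hN0.le]
      rw [this]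
      field_simp

section

variable {X : Type} [Fintype X] {p : X → ℝ} {f : X → ℤ}

theorem sum_mul_sub_mean (hp1 : ∑ x, p x = 1) : ∑ x, p x * (f x - mean p f) = 0 := by
  simp only [mul_sub, Finset.sum_sub_distrib, ← Finset.sum_mul, hp1, one_mul]
  exact sub_self _

open Complex in
theorem tendsto_charFn_pow (hp1 : ∑ x, p x = 1) (u : ℝ) :
    Tendsto (fun N : ℕ => charFn p f (u / √N) ^ N) atTop
      (𝓝 (exp (-(variance p f / 2 : ℝ) * u ^ 2))) := by
  have h1 : ∀ N : ℕ, charFn p f (u / √N) = 1 + ∑ x, (p x : ℂ) *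
      (exp (((u * (f x - mean p f)) / √N : ℝ) * I) - 1 - ((u * (f x - mean p f)) / √N : ℝ) * I) := by
    intro N
    have h2 : ∑ x, (p x : ℂ) = 1 := by rw [← Complex.ofReal_sum, hp1, Complex.ofReal_one]
    have h3 : ∑ x, (p x : ℂ) * ((u * (f x - mean p f)) / √N : ℝ) = 0 := by
      have : ∑ x, p x * ((u * (f x - mean p f)) / √N) = 0 := by
        have h4 : ∀ x, p x * ((u * (f x - mean p f)) / √N)
            = u / √N * (p x * (f x - mean p f)) := fun x => by ring
        simp only [h4, ← Finset.mul_sum, sum_mul_sub_mean hp1, mul_zero]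
      exact_mod_cast this
    have h4 : ∀ x, (p x : ℂ) * (exp (((u * (f x - mean p f)) / √N : ℝ) * I) - 1
        - ((u * (f x - mean p f)) / √N : ℝ) * I)
        = (p x : ℂ) * exp (((u * (f x - mean p f)) / √N : ℝ) * I) - p x
          - (p x : ℂ) * ((u * (f x - mean p f)) / √N : ℝ) * I := fun x => by ring
    simp only [h4, Finset.sum_sub_distrib]
    rw [← Finset.sum_mul, h3, h2, zero_mul, sub_zero, add_sub_cancel]
    unfold charFn
    refine Finset.sum_congr rfl fun x _ => ?_
    congr 2
    push_cast
    ring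
  simp only [h1]
  refine Complex.tendsto_one_add_pow_exp_of_tendsto ?_
  have h5 : -((variance p f / 2 : ℝ) : ℂ) * u ^ 2
      = ∑ x, (p x : ℂ) * (-((u * (f x - mean p f) : ℝ) : ℂ) ^ 2 / 2) := by
    unfold variance
    push_cast
    rw [Finset.sum_div, ← Finset.sum_neg_distrib, Finset.sum_mul]
    refine Finset.sum_congr rfl fun x _ => ?_
    ring
  rw [h5]
  simp only [Finset.mul_sum]
  refine tendsto_finsetSum _ fun x _ => ?_
  refine ((tendsto_mul_exp_sub (u * (f x - mean p f))).const_mul (p x : ℂ)).congr fun N => ?_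
  ring

/-- Difference of the rescaled characteristic function of a sum and its Gaussian limit. -/
def charFnDiff (p : X → ℝ) (f : X → ℤ) (d N : ℕ) (u : ℝ) : ℂ :=
  (Set.Ioc (-(Real.pi / d * √N)) (Real.pi / d * √N)).indicator
    (fun u => charFn p f (u / √N) ^ N) u - Complex.exp (-(variance p f / 2 : ℝ) * u ^ 2)

theorem norm_exp_neg_mul_sq (c u : ℝ) : ‖Complex.exp (-(c : ℝ) * u ^ 2)‖ = Real.exp (-c * u ^ 2) := by
  rw [Complex.norm_exp]
  congr 1
  rw [← Complex.ofReal_neg, ← Complex.ofReal_pow, ← Complex.ofReal_mul, Complex.ofReal_re]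

open MeasureTheory in
-- At `t = u / √N` the `N`-th power of the bound `exp (-c * t ^ 2)` is `exp (-c * u ^ 2)` for every
-- `N`, which permits dominated convergence.
theorem charFnDiff_tendsto (hp : ∀ x, 0 < p x) (hp1 : ∑ x, p x = 1) {d : ℕ} (hd : 0 < d)
    (hz : (d : ℤ) ∈ AddSubgroup.closure {z | ∃ x y, z = f x - f y}) (hv : 0 < variance p f) :
    (∀ N, Integrable (charFnDiff p f d N)) ∧
      Tendsto (fun N : ℕ => ∫ u, ‖charFnDiff p f d N u‖) atTop (𝓝 0) := by
  obtain ⟨c, hc, hχ⟩ := exists_norm_charFn_le hp hp1 hd hz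
  have hd' : (0 : ℝ) < d := by exact_mod_cast hd
  have hpi := Real.pi_pos
  have hint : Integrable fun u : ℝ => Real.exp (-c * u ^ 2) + Real.exp (-(variance p f / 2) * u ^ 2) :=
    (integrable_exp_neg_mul_sq hc).add (integrable_exp_neg_mul_sq (by linarith))
  have hmeas : ∀ N, AEStronglyMeasurable (charFnDiff p f d N) := by
    intro N
    refine AEStronglyMeasurable.sub ?_ ?_
    · refine AEStronglyMeasurable.indicator ?_ measurableSet_Ioc
      have := continuous_charFn p f
      exact Continuous.aestronglyMeasurable (by fun_prop)
    · exact Continuous.aestronglyMeasurable (by fun_prop)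
  have hbound : ∀ N u, ‖charFnDiff p f d N u‖ ≤
      Real.exp (-c * u ^ 2) + Real.exp (-(variance p f / 2) * u ^ 2) := by
    intro N u
    refine (norm_sub_le _ _).trans (add_le_add ?_ (norm_exp_neg_mul_sq _ _).le)
    rw [Set.indicator_apply]
    split_ifs with hu
    · have hN : 0 < N := by
        rcases Nat.eq_zero_or_pos N with rfl | h
        · simp at hu
        · exact h
      have hN' : (0 : ℝ) < N := by exact_mod_cast hN
      have hs : 0 < √(N : ℝ) := Real.sqrt_pos.2 hN'
      have h1 : |u / √N| ≤ Real.pi / d := by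
        rw [abs_div, abs_of_pos hs, div_le_iff₀ hs]
        exact abs_le.2 ⟨hu.1.le, hu.2⟩
      rw [norm_pow]
      refine (pow_le_pow_left₀ (norm_nonneg _) (hχ _ h1) N).trans (le_of_eq ?_)
      rw [← Real.exp_nat_mul, div_pow, Real.sq_sqrt hN'.le]
      congr 1
      field_simp
    · rw [norm_zero]
      exact (Real.exp_pos _).le
  refine ⟨fun N => hint.mono' (hmeas N) (Eventually.of_forall (hbound N)), ?_⟩
  have h0 : (0 : ℝ) = ∫ _u : ℝ, (0 : ℝ) := by simp
  rw [h0]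
  refine tendsto_integral_of_dominated_convergence _ (fun N => (hmeas N).norm) hint
    (fun N => Eventually.of_forall fun u => by rw [norm_norm]; exact hbound N u)
    (Eventually.of_forall fun u => ?_)
  rw [← norm_zero (E := ℂ)]
  refine Tendsto.norm ?_
  have h1 := (tendsto_charFn_pow (f := f) hp1 u).sub_const
    (Complex.exp (-(variance p f / 2 : ℝ) * u ^ 2))
  rw [sub_self] at h1
  refine h1.congr' ?_
  have hs : Tendsto (fun N : ℕ => Real.pi / d * √(N : ℝ)) atTop atTop :=
    (Real.tendsto_sqrt_atTop.comp tendsto_natCast_atTop_atTop).const_mul_atTop (by positivity)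
  filter_upwards [hs.eventually_gt_atTop |u|] with N hN
  unfold charFnDiff
  rw [Set.indicator_of_mem]
  exact ⟨by linarith [neg_abs_le u], by linarith [le_abs_self u]⟩

open MeasureTheory in
/-- Local limit theorem for sums of independent lattice variables. -/
theorem local_limit (hp : ∀ x, 0 < p x) (hp1 : ∑ x, p x = 1) {d : ℕ} (hd : 0 < d)
    (hf : ∀ x y, (d : ℤ) ∣ f x - f y)
    (hz : (d : ℤ) ∈ AddSubgroup.closure {z | ∃ x y, z = f x - f y}) (hv : 0 < variance p f)
    {ε : ℝ} (hε : 0 < ε) :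
    ∀ᶠ N : ℕ in atTop, ∀ n : ℤ, (∀ x, (d : ℤ) ∣ n - N * f x) →
      |√N * sumDist p f N n - d / √(2 * Real.pi * variance p f) *
        Real.exp (-(n - N * mean p f) ^ 2 / (2 * (N * variance p f)))| ≤ ε := by
  obtain ⟨hI, hT⟩ := charFnDiff_tendsto hp hp1 hd hz hv
  have hd' : (0 : ℝ) < d := by exact_mod_cast hd
  have hpi := Real.pi_pos
  have hT' := hT.eventually (eventually_lt_nhds (show 0 < ε * (2 * Real.pi / d) by positivity))
  filter_upwards [hT', eventually_gt_atTop 0] with N hN hN0 n hn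
  have hN' : (0 : ℝ) < N := by exact_mod_cast hN0
  have hs : 0 < √(N : ℝ) := Real.sqrt_pos.2 hN'
  set v := variance p f with hvdef
  set y : ℝ := (n - N * mean p f) / √N with hy
  -- The error of the local limit theorem at `n` is, up to the factor `2π / d`, a Fourier
  -- coefficient of `charFnDiff`. Its `L¹` norm therefore bounds the error uniformly in `n`.
  have e1 : ∫ u, charFnDiff p f d N u * Complex.exp (Complex.I * ((-y : ℝ) : ℂ) * u)
      = ((2 * Real.pi / d * (√N * sumDist p f N n - d / √(2 * Real.pi * v) *
        Real.exp (-(n - N * mean p f) ^ 2 / (2 * (N * v)))) : ℝ) : ℂ) := by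
    have hg : Integrable fun u : ℝ => Complex.exp (-(v / 2 : ℝ) * u ^ 2) := by
      refine (integrable_exp_neg_mul_sq (show 0 < v / 2 by linarith)).mono'
        (Continuous.aestronglyMeasurable (by fun_prop)) (Eventually.of_forall fun u => ?_)
      exact (norm_exp_neg_mul_sq _ _).le
    have hosc : ∀ g : ℝ → ℂ, Integrable g →
        Integrable fun u => g u * Complex.exp (Complex.I * ((-y : ℝ) : ℂ) * u) := by
      intro g hg
      refine hg.mul_bdd (c := 1) (Continuous.aestronglyMeasurable (by fun_prop))
        (Eventually.of_forall fun u => ?_)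
      have : Complex.I * ((-y : ℝ) : ℂ) * u = ((-y * u : ℝ) : ℂ) * Complex.I := by push_cast; ring
      rw [this, Complex.norm_exp_ofReal_mul_I]
    have hind : Integrable ((Set.Ioc (-(Real.pi / d * √N)) (Real.pi / d * √N)).indicator
        (fun u : ℝ => charFn p f (u / √N) ^ N)) := by
      have := (hI N).add hg
      refine this.congr (Eventually.of_forall fun u => ?_)
      simp [charFnDiff, v]
    have e2 : ∫ u, charFnDiff p f d N u * Complex.exp (Complex.I * ((-y : ℝ) : ℂ) * u)
        = (∫ u, (Set.Ioc (-(Real.pi / d * √N)) (Real.pi / d * √N)).indicator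
            (fun u : ℝ => charFn p f (u / √N) ^ N) u *
              Complex.exp (Complex.I * ((-y : ℝ) : ℂ) * u))
          - ∫ u : ℝ, Complex.exp (-(v / 2 : ℝ) * u ^ 2) *
              Complex.exp (Complex.I * ((-y : ℝ) : ℂ) * u) := by
      rw [← integral_sub (hosc _ hind) (hosc _ hg)]
      refine integral_congr_ae (Eventually.of_forall fun u => ?_)
      simp only [charFnDiff]
      ring
    have e3 : ∫ u, (Set.Ioc (-(Real.pi / d * √N)) (Real.pi / d * √N)).indicator
        (fun u : ℝ => charFn p f (u / √N) ^ N) u * Complex.exp (Complex.I * ((-y : ℝ) : ℂ) * u)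
        = ((2 * Real.pi / d * (√N * sumDist p f N n) : ℝ) : ℂ) := by
      have h1 : ∀ u : ℝ, (Set.Ioc (-(Real.pi / d * √N)) (Real.pi / d * √N)).indicator
          (fun u : ℝ => charFn p f (u / √N) ^ N) u * Complex.exp (Complex.I * ((-y : ℝ) : ℂ) * u)
          = (Set.Ioc (-(Real.pi / d * √N)) (Real.pi / d * √N)).indicator
          (fun u : ℝ => charFn p f (u / √N) ^ N *
            Complex.exp (-((n - N * mean p f : ℝ) * Complex.I * ((u / √N : ℝ) : ℂ)))) u := by
        intro u
        simp only [Set.indicator_apply]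
        split_ifs
        · congr 2
          rw [hy]
          push_cast
          ring
        · simp
      simp only [h1]
      rw [integral_indicator measurableSet_Ioc, ← intervalIntegral.integral_of_le (by
        have : 0 ≤ Real.pi / d * √N := by positivity
        linarith)]
      have h2 := intervalIntegral.integral_comp_div (a := -(Real.pi / d * √N))
        (b := Real.pi / d * √N) (fun t : ℝ => charFn p f t ^ N *
          Complex.exp (-((n - N * mean p f : ℝ) * Complex.I * (t : ℂ)))) hs.ne'
      rw [h2, neg_div, mul_div_cancel_right₀ _ hs.ne',
        integral_charFn_pow p f hd hf hN0 n hn, Complex.real_smul]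
      push_cast
      ring
    have e4 : ∫ u : ℝ, Complex.exp (-(v / 2 : ℝ) * u ^ 2) *
        Complex.exp (Complex.I * ((-y : ℝ) : ℂ) * u)
        = ((2 * Real.pi / d * (d / √(2 * Real.pi * v) *
          Real.exp (-(n - N * mean p f) ^ 2 / (2 * (N * v)))) : ℝ) : ℂ) := by
      have h1 := fourierIntegral_gaussian (b := ((v / 2 : ℝ) : ℂ)) (by
        rw [Complex.ofReal_re]; linarith) ((-y : ℝ) : ℂ)
      simp only [mul_comm (Complex.exp (-((v / 2 : ℝ) : ℂ) * _))]
      rw [h1]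
      have h2 : ((Real.pi : ℂ) / ((v / 2 : ℝ) : ℂ)) ^ (1 / 2 : ℂ) = ((√(Real.pi / (v / 2)) : ℝ) : ℂ) := by
        rw [Real.sqrt_eq_rpow, Complex.ofReal_cpow (by positivity)]
        push_cast
        rfl
      have h3 : -((-y : ℝ) : ℂ) ^ 2 / (4 * ((v / 2 : ℝ) : ℂ))
          = ((-(n - N * mean p f) ^ 2 / (2 * (N * v)) : ℝ) : ℂ) := by
        rw [hy, ← Complex.ofReal_pow, ← Complex.ofReal_neg, neg_sq, div_pow, Real.sq_sqrt hN'.le]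
        have : (4 : ℂ) = ((4 : ℝ) : ℂ) := by norm_num
        rw [this, ← Complex.ofReal_mul, ← Complex.ofReal_div]
        congr 1
        field_simp
        ring
      rw [h2, h3, ← Complex.ofReal_exp, ← Complex.ofReal_mul]
      congr 1
      have h4 : Real.pi / (v / 2) = (2 * Real.pi) ^ 2 / (2 * Real.pi * v) := by
        field_simp
      have h5 : √(Real.pi / (v / 2)) = 2 * Real.pi / d * (d / √(2 * Real.pi * v)) := by
        rw [h4, Real.sqrt_div (by positivity), Real.sqrt_sq (by positivity)]
        field_simp
      rw [h5, mul_assoc]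
    rw [e2, e3, e4, ← Complex.ofReal_sub]
    congr 1
    ring
  have e5 : ‖∫ u, charFnDiff p f d N u * Complex.exp (Complex.I * ((-y : ℝ) : ℂ) * u)‖
      ≤ ε * (2 * Real.pi / d) := by
    refine (norm_integral_le_integral_norm _).trans (le_trans (le_of_eq ?_) hN.le)
    refine integral_congr_ae (Eventually.of_forall fun u => ?_)
    have : Complex.I * ((-y : ℝ) : ℂ) * u = ((-y * u : ℝ) : ℂ) * Complex.I := by push_cast; ring
    simp only [norm_mul, this, Complex.norm_exp_ofReal_mul_I, mul_one]
  rw [e1, Complex.norm_real, Real.norm_eq_abs, abs_mul, abs_of_pos (by positivity), mul_comm] at e5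
  exact le_of_mul_le_mul_right e5 (by positivity)

end

/-! ### Typical sets, flatness in sectors, and total variation -/

section

variable {X : Type} [Fintype X] {p : X → ℝ}

theorem sum_prod_eq_one (hp1 : ∑ x, p x = 1) (N : ℕ) : ∑ x : Fin N → X, ∏ j, p (x j) = 1 := by
  rw [← Fintype.prod_sum fun (_ : Fin N) x => p x]
  simp [hp1]

theorem sum_fin_succ {N : ℕ} (F : (Fin (N + 1) → X) → ℝ) :
    ∑ x, F x = ∑ a, ∑ x : Fin N → X, F (Fin.cons a x) := by
  rw [← Fintype.sum_prod_type', ← Equiv.sum_comp (Fin.consEquiv fun _ => X)]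
  rfl

theorem sum_prod_mul_sum (hp1 : ∑ x, p x = 1) {g : X → ℝ} (hg : ∑ x, p x * g x = 0) (N : ℕ) :
    ∑ x : Fin N → X, (∏ j, p (x j)) * ∑ j, g (x j) = 0 := by
  induction N with
  | zero => simp
  | succ N ih =>
    rw [sum_fin_succ]
    simp only [Fin.prod_univ_succ, Fin.sum_univ_succ, Fin.cons_zero, Fin.cons_succ]
    have : ∀ a, ∑ x : Fin N → X, p a * (∏ j, p (x j)) * (g a + ∑ j, g (x j)) = p a * g a := by
      intro a
      have h1 : ∀ x : Fin N → X, p a * (∏ j, p (x j)) * (g a + ∑ j, g (x j))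
          = p a * g a * (∏ j, p (x j)) + p a * ((∏ j, p (x j)) * ∑ j, g (x j)) := fun x => by ring
      simp only [h1, Finset.sum_add_distrib, ← Finset.mul_sum, ih, sum_prod_eq_one hp1]
      ring
    simp only [this, hg]

theorem sum_prod_mul_sum_sq (hp1 : ∑ x, p x = 1) {g : X → ℝ} (hg : ∑ x, p x * g x = 0) (N : ℕ) :
    ∑ x : Fin N → X, (∏ j, p (x j)) * (∑ j, g (x j)) ^ 2 = N * ∑ x, p x * g x ^ 2 := by
  induction N with
  | zero => simp
  | succ N ih =>
    rw [sum_fin_succ]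
    simp only [Fin.prod_univ_succ, Fin.sum_univ_succ, Fin.cons_zero, Fin.cons_succ]
    have : ∀ a, ∑ x : Fin N → X, p a * (∏ j, p (x j)) * (g a + ∑ j, g (x j)) ^ 2
        = p a * g a ^ 2 + p a * (N * ∑ x, p x * g x ^ 2) := by
      intro a
      have h1 : ∀ x : Fin N → X, p a * (∏ j, p (x j)) * (g a + ∑ j, g (x j)) ^ 2
          = p a * g a ^ 2 * (∏ j, p (x j)) + 2 * p a * g a * ((∏ j, p (x j)) * ∑ j, g (x j))
            + p a * ((∏ j, p (x j)) * (∑ j, g (x j)) ^ 2) := fun x => by ring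
      simp only [h1, Finset.sum_add_distrib, ← Finset.mul_sum, ih, sum_prod_eq_one hp1,
        sum_prod_mul_sum hp1 hg]
      ring
    simp only [this, Finset.sum_add_distrib, ← Finset.sum_mul, hp1]
    push_cast
    ring

/-- Chebyshev's inequality for sums of independent variables. -/
theorem le_sum_prod_of_chebyshev (hp : ∀ x, 0 < p x) (hp1 : ∑ x, p x = 1) (g : X → ℝ) (N : ℕ) {a : ℝ}
    (ha : 0 < a) :
    1 - N * (∑ x, p x * (g x - ∑ y, p y * g y) ^ 2) / a ^ 2 ≤
      ∑ x ∈ Finset.univ.filter (fun x : Fin N → X => |∑ j, g (x j) - N * ∑ y, p y * g y| ≤ a),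
        ∏ j, p (x j) := by
  set m := ∑ y, p y * g y with hm
  have hg : ∑ x, p x * (g x - m) = 0 := by
    simp only [mul_sub, Finset.sum_sub_distrib, ← Finset.sum_mul, hp1, ← hm, one_mul, sub_self]
  have h1 := sum_prod_mul_sum_sq hp1 hg N
  have h2 := sum_prod_eq_one hp1 N
  rw [← h1, ← h2, Finset.sum_div, ← Finset.sum_sub_distrib, Finset.sum_filter]
  refine Finset.sum_le_sum fun x _ => ?_
  have hpx : 0 ≤ ∏ j, p (x j) := Finset.prod_nonneg fun j _ => (hp _).le
  have h3 : ∑ j, (g (x j) - m) = ∑ j, g (x j) - N * m := by simp [Finset.sum_sub_distrib]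
  rw [h3]
  split_ifs with h
  · have : 0 ≤ (∏ j, p (x j)) * (∑ j, g (x j) - N * m) ^ 2 / a ^ 2 := by positivity
    linarith
  · rw [sub_nonpos, le_div_iff₀ (by positivity)]
    refine mul_le_mul_of_nonneg_left ?_ hpx
    rw [← sq_abs (∑ j, g (x j) - N * m)]
    exact pow_le_pow_left₀ ha.le (not_le.1 h).le 2

/-- Asymptotic equipartition: existence of typical sets. -/
theorem eventually_exists_typical (hp : ∀ x, 0 < p x) (hp1 : ∑ x, p x = 1) {η ε : ℝ} (hη : 0 < η)
    (hε : 0 < ε) : ∀ᶠ N : ℕ in atTop, ∃ T : Finset (Fin N → X),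
      1 - ε ≤ ∑ x ∈ T, ∏ j, p (x j) ∧
      (T.card : ℝ) ≤ Real.exp (N * (∑ x, Real.negMulLog (p x) + η)) ∧
      ∀ x ∈ T, ∏ j, p (x j) ≤ Real.exp (-(N * (∑ x, Real.negMulLog (p x) - η))) := by
  set H := ∑ x, Real.negMulLog (p x) with hH
  have hH' : ∑ x, p x * -Real.log (p x) = H := by
    rw [hH]
    refine Finset.sum_congr rfl fun x _ => ?_
    rw [Real.negMulLog]
    ring
  set V := ∑ x, p x * (-Real.log (p x) - H) ^ 2 with hV
  have hlim : Tendsto (fun N : ℕ => V / η ^ 2 / (N : ℝ)) atTop (𝓝 0) :=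
    tendsto_const_div_atTop_nhds_zero_nat _
  filter_upwards [hlim.eventually (eventually_le_nhds hε), eventually_gt_atTop 0] with N hN hN0
  have hN' : (0 : ℝ) < N := by exact_mod_cast hN0
  -- The logarithm of a product weight is a sum of independent terms, so Chebyshev's inequality
  -- applies to `-log p`, with mean `H`.
  have hexp : ∀ x : Fin N → X, ∏ j, p (x j) = Real.exp (-∑ j, -Real.log (p (x j))) := by
    intro x
    rw [← Finset.sum_neg_distrib, Real.exp_sum]
    exact Finset.prod_congr rfl fun j _ => by rw [neg_neg, Real.exp_log (hp _)]
  have hcheb := le_sum_prod_of_chebyshev hp hp1 (fun x => -Real.log (p x)) N (a := N * η)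
    (by positivity)
  rw [hH'] at hcheb
  refine ⟨_, le_trans ?_ hcheb, ?_, ?_⟩
  · have : (N : ℝ) * V / (N * η) ^ 2 = V / η ^ 2 / N := by
      field_simp
    rw [this]
    linarith
  · set T := Finset.univ.filter
      (fun x : Fin N → X => |∑ j, -Real.log (p (x j)) - N * H| ≤ N * η) with hT
    have h1 : (T.card : ℝ) * Real.exp (-(N * (H + η))) ≤ 1 := by
      rw [← nsmul_eq_mul, ← Finset.sum_const, ← sum_prod_eq_one hp1 N]
      refine (Finset.sum_le_sum fun x hx => ?_).trans (Finset.sum_le_sum_of_subset_of_nonneg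
        (Finset.subset_univ T) fun x _ _ => Finset.prod_nonneg fun j _ => (hp _).le)
      rw [hexp, Real.exp_le_exp]
      have := (abs_le.1 (Finset.mem_filter.1 hx).2).2
      linarith
    rw [Real.exp_neg, ← div_eq_mul_inv, div_le_one (Real.exp_pos _)] at h1
    exact h1
  · intro x hx
    rw [hexp, Real.exp_le_exp]
    have := (abs_le.1 (Finset.mem_filter.1 hx).2).1
    linarith

/-- With high probability, the weights in a product distribution are exponentially small compared
to the weight of their sector. -/
theorem eventually_exists_flat (hp : ∀ x, 0 < p x) (hp1 : ∑ x, p x = 1) {n : X → ℕ} {K : ℕ}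
    (hn : ∀ x, n x ≤ K) {η ε : ℝ} (hη : 0 < η) (hε : 0 < ε) :
    ∀ᶠ N : ℕ in atTop, ∃ G : Finset (Fin N → X),
      1 - ε ≤ ∑ x ∈ G, ∏ j, p (x j) ∧
      ∀ x ∈ G, (∏ j, p (x j)) * Real.exp (N * (∑ x, Real.negMulLog (p x) - η)) ≤
        sumDist p (fun x => (n x : ℤ)) N (∑ j, (n (x j) : ℤ)) := by
  classical
  have h2 : Tendsto (fun N : ℕ => ((N : ℝ) * K + 1) * Real.exp (-(N * (η / 2)))) atTop (𝓝 0) := by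
    have e1 : Tendsto (fun x : ℝ => x ^ 1 * Real.exp (-(η / 2) * x)) atTop (𝓝 0) := by
      have := tendsto_rpow_mul_exp_neg_mul_atTop_nhds_zero 1 (η / 2) (by positivity)
      simpa using this
    have e2 : Tendsto (fun x : ℝ => Real.exp (-(η / 2) * x)) atTop (𝓝 0) := by
      have := tendsto_rpow_mul_exp_neg_mul_atTop_nhds_zero 0 (η / 2) (by positivity)
      simpa using this
    have e3 := ((e1.const_mul (K : ℝ)).add e2).comp tendsto_natCast_atTop_atTop (α := ℕ)
    simp only [mul_zero, add_zero] at e3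
    refine e3.congr fun N => ?_
    have : -((N : ℝ) * (η / 2)) = -(η / 2) * N := by ring
    simp only [Function.comp_apply, pow_one, this]
    ring
  filter_upwards [eventually_exists_typical hp hp1 (half_pos hη) (half_pos hε),
    h2.eventually (eventually_le_nhds (half_pos hε))] with N hN hN2
  obtain ⟨T, hT1, -, hT3⟩ := hN
  set H := ∑ x, Real.negMulLog (p x) with hH
  set P := sumDist p (fun x => (n x : ℤ)) N with hP
  have hK0 : (0 : ℝ) < (N : ℝ) * K + 1 := by positivity
  -- The particle number takes at most `N * K + 1` values, so discarding all sectors lighter than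
  -- `δ` costs at most `ε / 2`. Since `δ` is only polynomially small, `exp (-(N * (η / 2)))` is
  -- eventually below it.
  set δ := ε / 2 / ((N : ℝ) * K + 1) with hδ
  let m : (Fin N → X) → ℤ := fun x => ∑ j, (n (x j) : ℤ)
  have hw0 : ∀ x : Fin N → X, 0 ≤ ∏ j, p (x j) := fun x => Finset.prod_nonneg fun j _ => (hp _).le
  refine ⟨T.filter fun x => δ ≤ P (m x), ?_, ?_⟩
  · have h3 : ∑ x ∈ T, ∏ j, p (x j) ≤ ∑ x ∈ T.filter (fun x => δ ≤ P (m x)), ∏ j, p (x j)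
        + ∑ x ∈ Finset.univ.filter (fun x : Fin N → X => ¬ δ ≤ P (m x)), ∏ j, p (x j) := by
      rw [← Finset.sum_filter_add_sum_filter_not T fun x => δ ≤ P (m x)]
      refine add_le_add le_rfl (Finset.sum_le_sum_of_subset_of_nonneg ?_ fun x _ _ => hw0 x)
      exact Finset.filter_subset_filter _ (Finset.subset_univ _)
    have h4 : ∑ x ∈ Finset.univ.filter (fun x : Fin N → X => ¬ δ ≤ P (m x)), ∏ j, p (x j)
        ≤ ε / 2 := by
      have hmaps : ∀ x ∈ Finset.univ.filter (fun x : Fin N → X => ¬ δ ≤ P (m x)),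
          m x ∈ (Finset.Icc (0 : ℤ) (N * K)).filter (fun k => ¬ δ ≤ P k) := by
        intro x hx
        rw [Finset.mem_filter, Finset.mem_Icc]
        refine ⟨⟨Finset.sum_nonneg fun j _ => by positivity, ?_⟩, (Finset.mem_filter.1 hx).2⟩
        refine (Finset.sum_le_sum fun j _ => (Nat.cast_le (α := ℤ)).2 (hn (x j))).trans ?_
        simp
      rw [← Finset.sum_fiberwise_of_maps_to hmaps]
      calc _ ≤ ∑ k ∈ (Finset.Icc (0 : ℤ) (N * K)).filter (fun k => ¬ δ ≤ P k), δ := by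
            refine Finset.sum_le_sum fun k hk => ?_
            refine le_trans ?_ (not_le.1 (Finset.mem_filter.1 hk).2).le
            rw [hP, sumDist, marginal, ← Finset.sum_filter]
            refine Finset.sum_le_sum_of_subset_of_nonneg ?_ fun x _ _ => hw0 x
            intro x hx
            exact Finset.mem_filter.2 ⟨Finset.mem_univ _, (Finset.mem_filter.1 hx).2⟩
        _ ≤ ∑ k ∈ Finset.Icc (0 : ℤ) (N * K), δ :=
            Finset.sum_le_sum_of_subset_of_nonneg (Finset.filter_subset _ _) fun _ _ _ => by
              positivity
        _ = ε / 2 := by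
            rw [Finset.sum_const, nsmul_eq_mul, Int.card_Icc]
            have : (((N : ℤ) * K + 1 - 0).toNat : ℝ) = (N : ℝ) * K + 1 := by
              have h5 : (N : ℤ) * K + 1 - 0 = ((N * K + 1 : ℕ) : ℤ) := by push_cast; ring
              rw [h5, Int.toNat_natCast]
              push_cast
              ring
            rw [this, hδ]
            field_simp
    linarith
  · intro x hx
    obtain ⟨hxT, hx2⟩ := Finset.mem_filter.1 hx
    refine le_trans ?_ hx2
    calc (∏ j, p (x j)) * Real.exp (N * (H - η))
        ≤ Real.exp (-(N * (H - η / 2))) * Real.exp (N * (H - η)) :=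
          mul_le_mul_of_nonneg_right (hT3 x hxT) (Real.exp_pos _).le
      _ = Real.exp (-(N * (η / 2))) := by
          rw [← Real.exp_add]
          congr 1
          ring
      _ ≤ δ := by
          rw [hδ, le_div_iff₀ hK0, mul_comm]
          exact hN2

theorem sumDist_nonneg (hp : ∀ x, 0 < p x) (f : X → ℤ) (N : ℕ) (n : ℤ) : 0 ≤ sumDist p f N n :=
  marginal_nonneg (fun _ => Finset.prod_nonneg fun _ _ => (hp _).le) _ _

/-- A distribution that is pointwise close to the distribution of a sum of independent variables, on
the scale given by the standard deviation, is close to it in total variation. -/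
theorem exists_overlap (hp : ∀ x, 0 < p x) (hp1 : ∑ x, p x = 1) (f : X → ℤ) {ε : ℝ} (hε : 0 < ε) :
    ∃ η : ℝ, 0 < η ∧ ∀ N : ℕ, 0 < N → ∀ Q : ℤ → ℝ, (∀ n, 0 ≤ Q n) →
      (∀ n, sumDist p f N n ≤ Q n + η / √N) →
      ∃ Z : Finset ℤ, 1 - ε ≤ ∑ n ∈ Z, min (sumDist p f N n) (Q n) := by
  have hv : 0 ≤ variance p f := Finset.sum_nonneg fun x _ => mul_nonneg (hp x).le (sq_nonneg _)
  -- By Chebyshev the window of radius `a * √N` around the mean misses at most `ε / 2`; the summand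
  -- `1` keeps `a` positive when the variance is zero.
  set a := √(2 * (variance p f + 1) / ε) with ha
  have ha2 : a ^ 2 = 2 * (variance p f + 1) / ε := Real.sq_sqrt (by positivity)
  have ha0 : 0 < a := Real.sqrt_pos.2 (by positivity)
  -- The window contains at most `(2 * a + 1) * √N` integers, each of which loses at most `η / √N`:
  -- again `ε / 2` in total. A one-sided bound suffices because only the minimum matters.
  refine ⟨ε / 2 / (2 * a + 1), by positivity, fun N hN Q hQ h => ?_⟩
  have hN' : (1 : ℝ) ≤ N := by exact_mod_cast hN
  have hs : 1 ≤ √(N : ℝ) := Real.one_le_sqrt.2 hN'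
  have hs0 : 0 < √(N : ℝ) := by linarith
  set Z := Finset.Icc ⌈N * mean p f - a * √N⌉ ⌊N * mean p f + a * √N⌋ with hZ
  have hcheb := le_sum_prod_of_chebyshev hp hp1 (fun x => (f x : ℝ)) N (a := a * √N) (by positivity)
  have h1 : 1 - ε / 2 ≤ ∑ n ∈ Z, sumDist p f N n := by
    refine le_trans ?_ (hcheb.trans ?_)
    · have e1 : (N : ℝ) * (∑ x, p x * (f x - ∑ y, p y * f y) ^ 2) / (a * √N) ^ 2
          = variance p f / a ^ 2 := by
        change (N : ℝ) * variance p f / (a * √N) ^ 2 = _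
        rw [mul_pow, Real.sq_sqrt (show (0 : ℝ) ≤ N by linarith)]
        field_simp
      rw [e1, ha2]
      have : variance p f / (2 * (variance p f + 1) / ε) ≤ ε / 2 := by
        rw [div_le_iff₀ (by positivity)]
        have : ε / 2 * (2 * (variance p f + 1) / ε) = variance p f + 1 := by field_simp
        linarith
      linarith
    · simp only [sumDist, marginal]
      rw [Finset.sum_comm, Finset.sum_filter]
      refine Finset.sum_le_sum fun x _ => ?_
      rw [Finset.sum_ite_eq]
      have hw0 : 0 ≤ ∏ j, p (x j) := Finset.prod_nonneg fun j _ => (hp _).le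
      split_ifs with h2 h3 h3
      · exact le_rfl
      · exfalso
        apply h3
        have h4 := abs_le.1 h2
        rw [hZ, Finset.mem_Icc, Int.ceil_le, Int.le_floor]
        push_cast
        change -(a * √N) ≤ ∑ j, (f (x j) : ℝ) - N * mean p f ∧
          ∑ j, (f (x j) : ℝ) - N * mean p f ≤ a * √N at h4
        exact ⟨by linarith, by linarith⟩
      · exact hw0
      · exact le_rfl
  have hcard : (Z.card : ℝ) ≤ (2 * a + 1) * √N := by
    rw [hZ, Int.card_Icc]
    have h5 : (((⌊N * mean p f + a * √N⌋ + 1 - ⌈N * mean p f - a * √N⌉).toNat : ℤ) : ℝ)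
        ≤ 2 * (a * √N) + 1 := by
      rw [Int.toNat_eq_max]
      push_cast
      refine max_le ?_ (by positivity)
      have := Int.floor_le (N * mean p f + a * √N)
      have := Int.le_ceil (N * mean p f - a * √N)
      linarith
    rw [Int.cast_natCast] at h5
    nlinarith
  refine ⟨Z, ?_⟩
  have h6 : ∑ n ∈ Z, sumDist p f N n - Z.card * (ε / 2 / (2 * a + 1) / √N)
      ≤ ∑ n ∈ Z, min (sumDist p f N n) (Q n) := by
    rw [← nsmul_eq_mul, ← Finset.sum_const, ← Finset.sum_sub_distrib]
    refine Finset.sum_le_sum fun n _ => le_min ?_ ?_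
    · have : 0 ≤ ε / 2 / (2 * a + 1) / √N := by positivity
      linarith
    · linarith [h n]
  have h7 : Z.card * (ε / 2 / (2 * a + 1) / √N) ≤ ε / 2 := by
    calc Z.card * (ε / 2 / (2 * a + 1) / √N) ≤ (2 * a + 1) * √N * (ε / 2 / (2 * a + 1) / √N) :=
          mul_le_mul_of_nonneg_right hcard (by positivity)
      _ = ε / 2 := by field_simp
  linarith

end

/-! ### Comparison with discrete Gaussians -/

open MeasureTheory in
theorem sum_exp_neg_mul_sq_nat_le {c : ℝ} (hc : 0 < c) (T : Finset ℕ) :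
    ∑ i ∈ T, Real.exp (-c * (i : ℝ) ^ 2) ≤ 1 + √(Real.pi / c) / 2 := by
  obtain ⟨k, hk⟩ := Finset.exists_nat_subset_range T
  have hanti : AntitoneOn (fun x : ℝ => Real.exp (-c * x ^ 2)) (Set.Icc 0 (0 + (k : ℝ))) := by
    intro x hx y _ hxy
    have := pow_le_pow_left₀ hx.1 hxy 2
    exact Real.exp_le_exp.2 (by nlinarith)
  have h1 := hanti.sum_le_integral
  rw [zero_add, intervalIntegral.integral_of_le (Nat.cast_nonneg k)] at h1
  have hint : Integrable fun x : ℝ => Real.exp (-c * x ^ 2) := integrable_exp_neg_mul_sq hc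
  have h2 : ∫ x in Set.Ioc (0 : ℝ) k, Real.exp (-c * x ^ 2) ≤ √(Real.pi / c) / 2 := by
    rw [← integral_gaussian_Ioi]
    exact setIntegral_mono_set hint.integrableOn (Eventually.of_forall fun x => (Real.exp_pos _).le)
      (Eventually.of_forall Set.Ioc_subset_Ioi_self)
  calc ∑ i ∈ T, Real.exp (-c * (i : ℝ) ^ 2)
      ≤ ∑ i ∈ Finset.range (k + 1), Real.exp (-c * (i : ℝ) ^ 2) :=
        Finset.sum_le_sum_of_subset_of_nonneg (hk.trans (Finset.range_mono (Nat.le_succ k)))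
          fun i _ _ => (Real.exp_pos _).le
    _ = 1 + ∑ i ∈ Finset.range k, Real.exp (-c * ((i + 1 : ℕ) : ℝ) ^ 2) := by
        rw [Finset.sum_range_succ']
        simp [add_comm]
    _ ≤ 1 + √(Real.pi / c) / 2 := by
        simp only [zero_add] at h1
        linarith

/-- On either side of `b` the distances to `b` dominate distinct natural numbers, which reduces the
sum to two sums over naturals. -/
theorem sum_exp_neg_mul_sq_int_le {c : ℝ} (hc : 0 < c) (b : ℝ) (S : Finset ℤ) :
    ∑ j ∈ S, Real.exp (-c * ((j : ℝ) - b) ^ 2) ≤ 2 + √(Real.pi / c) := by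
  have key : ∀ (S : Finset ℤ) (i : ℤ → ℕ), Set.InjOn i S → (∀ j ∈ S, (i j : ℝ) ≤ |(j : ℝ) - b|) →
      ∑ j ∈ S, Real.exp (-c * ((j : ℝ) - b) ^ 2) ≤ 1 + √(Real.pi / c) / 2 := by
    intro S i hi hle
    refine le_trans ?_ (sum_exp_neg_mul_sq_nat_le hc (S.image i))
    rw [Finset.sum_image hi]
    refine Finset.sum_le_sum fun j hj => Real.exp_le_exp.2 ?_
    have := pow_le_pow_left₀ (Nat.cast_nonneg _) (hle j hj) 2
    rw [sq_abs] at this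
    nlinarith
  rw [← Finset.sum_filter_add_sum_filter_not S fun j => ⌈b⌉ ≤ j]
  have h1 := key (S.filter fun j => ⌈b⌉ ≤ j) (fun j => (j - ⌈b⌉).toNat)
    (fun j hj j' hj' h => by
      simp only [Finset.coe_filter, Set.mem_ofPred_eq] at hj hj' h
      omega)
    (fun j hj => by
      have hj' := (Finset.mem_filter.1 hj).2
      have h2 : (((j - ⌈b⌉).toNat : ℤ) : ℝ) = j - ⌈b⌉ := by
        rw [Int.toNat_of_nonneg (by omega)]
        push_cast
        ring
      rw [Int.cast_natCast] at h2
      rw [h2]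
      have := Int.le_ceil b
      exact le_trans (by linarith) (le_abs_self _))
  have h2 := key (S.filter fun j => ¬ ⌈b⌉ ≤ j) (fun j => (⌈b⌉ - 1 - j).toNat)
    (fun j hj j' hj' h => by
      simp only [Finset.coe_filter, Set.mem_ofPred_eq] at hj hj' h
      omega)
    (fun j hj => by
      have hj' := (Finset.mem_filter.1 hj).2
      have h2 : (((⌈b⌉ - 1 - j).toNat : ℤ) : ℝ) = ⌈b⌉ - 1 - j := by
        rw [Int.toNat_of_nonneg (by omega)]
        push_cast
        ring
      rw [Int.cast_natCast] at h2
      rw [h2]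
      have := Int.ceil_lt_add_one b
      exact le_trans (by linarith) (neg_le_abs _))
  linarith

/-- Upper bound for the sum of Gaussian weights over points of a coset of `dℤ`. -/
theorem sum_gaussian_le {d : ℕ} (hd : 0 < d) {s : ℝ} (hs : 0 < s) (b : ℝ) (n₀ : ℤ) (S : Finset ℤ)
    (hS : ∀ n ∈ S, (d : ℤ) ∣ n - n₀) :
    ∑ n ∈ S, Real.exp (-((n : ℝ) - b) ^ 2 / (2 * s)) ≤ 2 + √(2 * Real.pi * s) / d := by
  have hd' : (0 : ℝ) < d := by exact_mod_cast hd
  have hpi := Real.pi_pos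
  have hinj : Set.InjOn (fun n : ℤ => (n - n₀) / d) S := by
    intro n hn n' hn' h
    have h1 := Int.ediv_mul_cancel (hS n hn)
    have h2 := Int.ediv_mul_cancel (hS n' hn')
    simp only at h
    rw [h] at h1
    omega
  have h := sum_exp_neg_mul_sq_int_le (c := d ^ 2 / (2 * s)) (by positivity) ((b - n₀) / d)
    (S.image fun n => (n - n₀) / d)
  rw [Finset.sum_image hinj] at h
  have h3 : √(Real.pi / (d ^ 2 / (2 * s))) = √(2 * Real.pi * s) / d := by
    have : Real.pi / (d ^ 2 / (2 * s)) = 2 * Real.pi * s / d ^ 2 := by field_simp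
    rw [this, Real.sqrt_div (by positivity), Real.sqrt_sq hd'.le]
  rw [h3] at h
  refine le_trans (le_of_eq (Finset.sum_congr rfl fun n hn => ?_)) h
  congr 1
  obtain ⟨k, hk⟩ := hS n hn
  have h4 : (n - n₀) / d = k := by rw [hk, Int.mul_ediv_cancel_left _ (by omega)]
  have h5 : (n : ℝ) = n₀ + d * k := by
    have : n = n₀ + d * k := by omega
    exact_mod_cast this
  rw [h4, h5]
  field_simp
  ring

/-- The derivative is bounded by `1`, as `|z| ≤ 1 + z ^ 2 / 2 ≤ exp (z ^ 2 / 2)`. Rounding a shift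
to the lattice thus changes a Gaussian of width of order `√N` by only `O(1 / √N)` relative to its
peak. -/
theorem abs_exp_neg_sq_sub_le (x y : ℝ) :
    |Real.exp (-x ^ 2 / 2) - Real.exp (-y ^ 2 / 2)| ≤ |x - y| := by
  have hder : ∀ z : ℝ, HasDerivAt (fun z : ℝ => Real.exp (-z ^ 2 / 2))
      (Real.exp (-z ^ 2 / 2) * (-z)) z := by
    intro z
    have h1 : HasDerivAt (fun z : ℝ => -z ^ 2 / 2) (-z) z := by
      have := ((hasDerivAt_pow 2 z).neg).div_const 2
      refine this.congr_deriv ?_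
      norm_num
      ring
    exact h1.exp
  have h := Convex.norm_image_sub_le_of_norm_hasDerivWithin_le (C := 1) (s := Set.univ)
    (f := fun z : ℝ => Real.exp (-z ^ 2 / 2)) (fun z _ => (hder z).hasDerivWithinAt)
    (fun z _ => by
      rw [norm_mul, norm_neg, Real.norm_eq_abs, Real.norm_eq_abs, abs_of_pos (Real.exp_pos _),
        neg_div, Real.exp_neg, inv_mul_le_one₀ (Real.exp_pos _)]
      have h1 := Real.add_one_le_exp (z ^ 2 / 2)
      have h2 : z ^ 2 = |z| ^ 2 := (sq_abs z).symm
      nlinarith [sq_nonneg (|z| - 1)])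
    convex_univ (Set.mem_univ y) (Set.mem_univ x)
  simpa [Real.norm_eq_abs] using h

theorem dvd_sum_sub {X : Type} {f : X → ℤ} {d : ℕ} (hf : ∀ x y, (d : ℤ) ∣ f x - f y) {N : ℕ} (x : Fin N → X) (y : X) :
    (d : ℤ) ∣ ∑ j, f (x j) - N * f y := by
  have : ∑ j, f (x j) - N * f y = ∑ j, (f (x j) - f y) := by simp [Finset.sum_sub_distrib]
  rw [this]
  exact Finset.dvd_sum fun j _ => hf _ _

section

variable {X : Type} [Fintype X] {p : X → ℝ} {f : X → ℤ}

theorem exists_of_sumDist_ne_zero {N : ℕ} {n : ℤ} (h : sumDist p f N n ≠ 0) :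
    ∃ x : Fin N → X, ∑ j, f (x j) = n := by
  obtain ⟨x, -, hx⟩ := Finset.exists_ne_zero_of_sum_ne_zero h
  exact ⟨x, by_contra fun hc => hx (if_neg hc)⟩

/-- The distribution of a sum of independent lattice variables is close to a discrete Gaussian. -/
theorem eventually_sumDist_le_gaussian (hp : ∀ x, 0 < p x) (hp1 : ∑ x, p x = 1) {d : ℕ} (hd : 0 < d)
    (hf : ∀ x y, (d : ℤ) ∣ f x - f y)
    (hz : (d : ℤ) ∈ AddSubgroup.closure {z | ∃ x y, z = f x - f y}) (hv : 0 < variance p f)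
    {η : ℝ} (hη : 0 < η) :
    ∀ᶠ N : ℕ in atTop, ∀ S : Finset ℤ, (∀ n ∈ S, ∀ x, (d : ℤ) ∣ n - N * f x) → ∀ n ∈ S,
      sumDist p f N n ≤ Real.exp (-(n - N * mean p f) ^ 2 / (2 * (N * variance p f))) /
        (∑ m ∈ S, Real.exp (-(m - N * mean p f) ^ 2 / (2 * (N * variance p f)))) + η / √N := by
  have hpi := Real.pi_pos
  have hd' : (0 : ℝ) < d := by exact_mod_cast hd
  set v := variance p f with hvdef
  set C := d / √(2 * Real.pi * v) with hC
  have hC0 : 0 < C := by positivity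
  have hs : Tendsto (fun N : ℕ => √(N : ℝ)) atTop atTop :=
    Real.tendsto_sqrt_atTop.comp tendsto_natCast_atTop_atTop
  filter_upwards [local_limit hp hp1 hd hf hz hv (half_pos hη),
    hs.eventually_ge_atTop (2 * C ^ 2 / (η / 2)), eventually_gt_atTop 0] with N hN hN2 hN0 S hS n hn
  have hN' : (0 : ℝ) < N := by exact_mod_cast hN0
  have hs0 : 0 < √(N : ℝ) := Real.sqrt_pos.2 hN'
  obtain ⟨x₀⟩ : Nonempty X := by
    by_contra h
    rw [not_nonempty_iff] at h
    simp at hp1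
  set w : ℤ → ℝ := fun m => Real.exp (-(m - N * mean p f) ^ 2 / (2 * (N * v))) with hw
  -- Only an upper bound on the normalization is needed for a lower bound on the Gaussian
  -- probability, so truncating the support to `S` does no harm.
  have hW : ∑ m ∈ S, w m ≤ 2 + √N / C := by
    refine (sum_gaussian_le hd (mul_pos hN' hv) (N * mean p f) (N * f x₀) S
      fun m hm => hS m hm x₀).trans (le_of_eq ?_)
    have : 2 * Real.pi * (N * v) = N * (2 * Real.pi * v) := by ring
    rw [this, Real.sqrt_mul hN'.le, hC, div_div_eq_mul_div]
  have hW0 : 0 < ∑ m ∈ S, w m :=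
    Finset.sum_pos (fun m _ => Real.exp_pos _) ⟨n, hn⟩
  have hw1 : w n ≤ 1 := Real.exp_le_one_iff.2 (by
    rw [neg_div]
    exact neg_nonpos.2 (by positivity))
  have hw0 : 0 < w n := Real.exp_pos _
  have h1 := (abs_le.1 (hN n (hS n hn))).2
  change √N * sumDist p f N n - C * w n ≤ η / 2 at h1
  have h2 : sumDist p f N n ≤ C * w n / √N + η / 2 / √N := by
    rw [← add_div, le_div_iff₀ hs0]
    linarith
  have h3 : C * w n / √N ≤ w n / (∑ m ∈ S, w m) + η / 2 / √N := by
    have h4 : w n / (2 + √N / C) ≤ w n / (∑ m ∈ S, w m) :=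
      div_le_div_of_nonneg_left hw0.le hW0 hW
    have h5 : C * w n / √N - w n / (2 + √N / C) ≤ η / 2 / √N := by
      have e1 : C * w n / √N - w n / (2 + √N / C) = w n * (2 * C ^ 2 / (2 * C + √N)) / √N := by
        field_simp
        ring
      rw [e1]
      refine div_le_div_of_nonneg_right ?_ hs0.le
      have h6 : 2 * C ^ 2 / (2 * C + √N) ≤ η / 2 := by
        rw [div_le_iff₀ (by positivity)]
        rw [div_le_iff₀ (by positivity)] at hN2
        nlinarith
      have h7 : 0 ≤ 2 * C ^ 2 / (2 * C + √N) := by positivity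
      nlinarith
    linarith
  have h8 : η / √N = η / 2 / √N + η / 2 / √N := by ring
  rw [h8]
  linarith

/-- Sums of independent lattice variables with the same lattice and variance have, up to a shift,
almost the same distribution. -/
theorem eventually_exists_shift_overlap (hp : ∀ x, 0 < p x) (hp1 : ∑ x, p x = 1) {Y : Type}
    [Fintype Y] {q : Y → ℝ} {g : Y → ℤ} (hq : ∀ y, 0 < q y) (hq1 : ∑ y, q y = 1) {d : ℕ} (hd : 0 < d)
    (hf : ∀ x y, (d : ℤ) ∣ f x - f y)
    (hz : (d : ℤ) ∈ AddSubgroup.closure {z | ∃ x y, z = f x - f y})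
    (hg : ∀ x y, (d : ℤ) ∣ g x - g y)
    (hz' : (d : ℤ) ∈ AddSubgroup.closure {z | ∃ x y, z = g x - g y})
    (hv : 0 < variance p f) (hvv : variance q g = variance p f) {ε : ℝ} (hε : 0 < ε) :
    ∀ᶠ N : ℕ in atTop, ∃ (s : ℤ) (Z : Finset ℤ),
      1 - ε ≤ ∑ n ∈ Z, min (sumDist p f N n) (sumDist q g N (n - s)) := by
  obtain ⟨η, hη, hov⟩ := exists_overlap hp hp1 f hε
  have hpi := Real.pi_pos
  have hd' : (0 : ℝ) < d := by exact_mod_cast hd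
  have hl1 := local_limit hp hp1 hd hf hz hv (show 0 < η / 3 by linarith)
  have hl2 := local_limit hq hq1 hd hg hz' (hvv.symm ▸ hv) (show 0 < η / 3 by linarith)
  rw [hvv] at hl2
  set v := variance p f with hvdef
  set C := d / √(2 * Real.pi * v) with hC
  have hC0 : 0 < C := by positivity
  have hs : Tendsto (fun N : ℕ => √(N : ℝ)) atTop atTop :=
    Real.tendsto_sqrt_atTop.comp tendsto_natCast_atTop_atTop
  obtain ⟨x₀⟩ : Nonempty X := by
    by_contra h
    rw [not_nonempty_iff] at h
    simp at hp1
  obtain ⟨y₀⟩ : Nonempty Y := by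
    by_contra h
    rw [not_nonempty_iff] at h
    simp at hq1
  filter_upwards [hl1, hl2, hs.eventually_ge_atTop (C * d / √v / (η / 3)), eventually_gt_atTop 0]
    with N hN hN2 hN3 hN0
  have hN' : (0 : ℝ) < N := by exact_mod_cast hN0
  have hs0 : 0 < √(N : ℝ) := Real.sqrt_pos.2 hN'
  have hv0 : 0 < √v := Real.sqrt_pos.2 hv
  set t : ℝ := (N * (mean p f - mean q g) - N * (f x₀ - g y₀)) / d with ht
  -- The first term aligns the two cosets of `dℤ`; the multiple of `d` then brings the means
  -- together up to an error of `d`.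
  set s : ℤ := N * (f x₀ - g y₀) + d * ⌊t⌋ with hs
  have hst : |(s : ℝ) - N * (mean p f - mean q g)| ≤ d := by
    have e1 : (s : ℝ) - N * (mean p f - mean q g) = d * (⌊t⌋ - t) := by
      rw [hs, ht]
      push_cast
      field_simp
      ring
    rw [e1, abs_mul, abs_of_pos hd']
    refine mul_le_of_le_one_right hd'.le (abs_le.2 ⟨?_, ?_⟩)
    · linarith [Int.lt_floor_add_one t]
    · linarith [Int.floor_le t]
  refine ⟨s, hov N hN0 (fun n => sumDist q g N (n - s)) (fun n => sumDist_nonneg hq g N _) fun n => ?_⟩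
  by_cases hn : sumDist p f N n = 0
  · rw [hn]
    exact add_nonneg (sumDist_nonneg hq g N _) (by positivity)
  obtain ⟨x, rfl⟩ := exists_of_sumDist_ne_zero hn
  set n := ∑ j, f (x j) with hndef
  have hnf : ∀ x, (d : ℤ) ∣ n - N * f x := fun y => dvd_sum_sub hf x y
  have hng : ∀ y, (d : ℤ) ∣ n - s - N * g y := by
    intro y
    have e1 : n - s - N * g y = (n - N * f x₀) - d * ⌊t⌋ - N * (g y - g y₀) := by
      rw [hs]
      ring
    rw [e1]
    exact dvd_sub (dvd_sub (hnf x₀) (dvd_mul_right _ _)) (Dvd.dvd.mul_left (hg _ _) _)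
  have h1 := (abs_le.1 (hN n hnf)).2
  have h2 := (abs_le.1 (hN2 (n - s) hng)).1
  have h3 := abs_exp_neg_sq_sub_le ((n - N * mean p f) / √(N * v))
    (((n - s : ℤ) - N * mean q g) / √(N * v))
  have hNv : 0 < √(N * v) := Real.sqrt_pos.2 (mul_pos hN' hv)
  have e2 : ∀ z : ℝ, -(z / √(N * v)) ^ 2 / 2 = -z ^ 2 / (2 * (N * v)) := by
    intro z
    rw [div_pow, Real.sq_sqrt (mul_pos hN' hv).le]
    field_simp
  rw [e2, e2, ← sub_div, abs_div, abs_of_pos hNv] at h3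
  have h4 : |(n : ℝ) - N * mean p f - ((n - s : ℤ) - N * mean q g)| ≤ d := by
    refine le_trans (le_of_eq ?_) hst
    push_cast
    congr 1
    ring
  have h5 : |(n : ℝ) - N * mean p f - ((n - s : ℤ) - N * mean q g)| / √(N * v) ≤ d / √(N * v) :=
    div_le_div_of_nonneg_right h4 hNv.le
  have h6 : C * (d / √(N * v)) ≤ η / 3 := by
    rw [Real.sqrt_mul hN'.le]
    rw [div_le_iff₀ (by positivity)] at hN3
    have : C * (d / (√N * √v)) = C * d / √v / √N := by field_simp
    rw [this, div_le_iff₀ hs0]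
    linarith
  have h7 := (abs_le.1 (h3.trans h5)).2
  have h8 := mul_le_mul_of_nonneg_left h7 hC0.le
  have h9 : √N * sumDist p f N n ≤ √N * sumDist q g N (n - s) + η := by linarith
  have h10 : sumDist p f N n ≤ (√N * sumDist q g N (n - s) + η) / √N := by
    rw [le_div_iff₀ hs0]
    linarith
  refine h10.trans (le_of_eq ?_)
  field_simp

end

/-! ### Schmidt data of a state and its number distribution -/

theorem PureState.exists_amp_ne_zero {A B : LocalSystem} (φ : PureState A B) :
    ∃ a b, φ.amp a b ≠ 0 := by
  by_contra h
  push Not at h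
  simpa [h] using φ.norm_one

/-- `(p, n)` are the Schmidt weights and Alice's particle numbers in a Schmidt decomposition of
`φ`. -/
structure PureState.SchmidtData {A B : LocalSystem} (φ : PureState A B) {X : Type} [Fintype X]
    [DecidableEq X] (p : X → ℝ) (n : X → ℕ) : Prop where
  schmidt : HasSchmidt φ.amp p (fun x => (n x : ℤ))
  pos : ∀ x, 0 < p x
  sum_eq_one : ∑ x, p x = 1
  le_total : ∀ x, n x ≤ φ.total
  mean_eq : mean p (fun x => (n x : ℤ)) = φ.meanNum
  variance_eq : variance p (fun x => (n x : ℤ)) = φ.siv / 4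
  entropy_eq : ∑ x, Real.negMulLog (p x) = φ.entropy * Real.log 2
  mem_occurring : ∀ k, k ∈ φ.occurring ↔ ∃ x, n x = k
  numLattice_eq : φ.numLattice = AddSubgroup.closure {z | ∃ x y, z = (n x : ℤ) - n y}

theorem PureState.exists_schmidtData {A B : LocalSystem} (φ : PureState A B) :
    ∃ (X : Type) (_ : Fintype X) (_ : DecidableEq X) (p : X → ℝ) (n : X → ℕ),
      φ.SchmidtData p n := by
  obtain ⟨X, _, _, p, n, h1, h2, h3, h4, h5⟩ := φ.exists_schmidt
  have hs : ∑ x, p x = 1 := by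
    have := h4 fun _ => 1
    simp only [one_mul, mul_one, φ.norm_one] at this
    exact this.symm
  have hm : mean p (fun x => (n x : ℤ)) = φ.meanNum := by
    have := h4 fun k => (k : ℝ)
    rw [PureState.meanNum, this, mean]
    simp
  have hocc : ∀ k, k ∈ φ.occurring ↔ ∃ x, n x = k := by
    intro k
    -- With the indicator of `k` as test function, `k` occurs in `φ` exactly when it has positive
    -- weight on either side.
    have h6 := h4 fun j => if j = k then 1 else 0
    constructor
    · rintro ⟨a, b, hab, rfl⟩
      by_contra hc
      push Not at hc
      rw [Finset.sum_eq_zero (s := Finset.univ (α := X)) fun x _ => by simp [hc x]] at h6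
      have h7 : 0 < ∑ a', ∑ b', (if A.num a' = A.num a then (1 : ℝ) else 0) * ‖φ.amp a' b'‖ ^ 2 := by
        refine Finset.sum_pos' (fun a' _ => Finset.sum_nonneg fun b' _ => by positivity)
          ⟨a, Finset.mem_univ _, Finset.sum_pos' (fun b' _ => by positivity)
            ⟨b, Finset.mem_univ _, ?_⟩⟩
        have := norm_pos_iff.2 hab
        simp only [if_true, one_mul]
        positivity
      linarith
    · rintro ⟨x, rfl⟩
      by_contra hc
      have h7 : ∀ a b, A.num a = n x → φ.amp a b = 0 := by
        intro a b ha
        by_contra h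
        exact hc ⟨a, b, h, ha⟩
      rw [Finset.sum_eq_zero (s := Finset.univ (α := A)) fun a _ => Finset.sum_eq_zero fun b _ => by
        by_cases ha : A.num a = n x
        · rw [h7 a b ha]; simp
        · simp [ha]] at h6
      have h8 : 0 < ∑ y, p y * (if n y = n x then (1 : ℝ) else 0) := by
        refine Finset.sum_pos' (fun y _ => mul_nonneg (h2 y).le (by positivity))
          ⟨x, Finset.mem_univ _, ?_⟩
        simp [h2 x]
      linarith
  refine ⟨X, _, _, p, n, h1, h2, hs, h3, hm, ?_, ?_, hocc, ?_⟩
  · have h6 : φ.meanNumSq = ∑ x, p x * (n x : ℝ) ^ 2 := h4 fun k => (k : ℝ) ^ 2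
    have h7 : ∑ x, p x * (n x : ℝ) = φ.meanNum := by rw [← hm, mean]; simp
    rw [variance, hm, PureState.siv, h6]
    have h8 : ∀ x, p x * (((n x : ℤ) : ℝ) - φ.meanNum) ^ 2
        = p x * (n x : ℝ) ^ 2 - 2 * φ.meanNum * (p x * n x) + φ.meanNum ^ 2 * p x := fun x => by
      push_cast
      ring
    simp only [h8, Finset.sum_add_distrib, Finset.sum_sub_distrib, ← Finset.mul_sum, h7, hs]
    ring
  · rw [h5, div_mul_cancel₀ _ (Real.log_pos one_lt_two).ne']
  · rw [PureState.numLattice]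
    congr 1
    ext z
    simp only [hocc]
    constructor
    · rintro ⟨_, ⟨x, rfl⟩, _, ⟨y, rfl⟩, rfl⟩
      exact ⟨x, y, rfl⟩
    · rintro ⟨x, y, rfl⟩
      exact ⟨_, ⟨x, rfl⟩, _, ⟨y, rfl⟩, rfl⟩

theorem exists_generator (H : AddSubgroup ℤ) : ∃ d : ℕ, ∀ z, z ∈ H ↔ (d : ℤ) ∣ z := by
  obtain ⟨a, ha⟩ := Int.subgroup_cyclic H
  refine ⟨a.natAbs, fun z => ?_⟩
  rw [ha, ← AddSubgroup.zmultiples_eq_closure, Int.mem_zmultiples_iff, Int.natAbs_dvd]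

/-- Vanishing variance would make the particle number constant and the lattice trivial. -/
theorem PureState.SchmidtData.variance_pos {A B : LocalSystem} {φ : PureState A B} {X : Type}
    [Fintype X] [DecidableEq X] {p : X → ℝ} {n : X → ℕ} (h : φ.SchmidtData p n) {d : ℕ} (hd : 0 < d)
    (hL : (d : ℤ) ∈ φ.numLattice) : 0 < variance p (fun x => (n x : ℤ)) := by
  have h0 : ∀ x ∈ Finset.univ, 0 ≤ p x * (((n x : ℤ) : ℝ) - mean p (fun x => (n x : ℤ))) ^ 2 :=
    fun x _ => mul_nonneg (h.pos x).le (sq_nonneg _)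
  refine lt_of_le_of_ne (Finset.sum_nonneg h0) fun hv => ?_
  have h1 := (Finset.sum_eq_zero_iff_of_nonneg h0).1 hv.symm
  have h2 : ∀ x, (n x : ℝ) = mean p (fun x => (n x : ℤ)) := by
    intro x
    have := (mul_eq_zero.1 (h1 x (Finset.mem_univ x))).resolve_left (h.pos x).ne'
    rw [sq_eq_zero_iff, sub_eq_zero, Int.cast_natCast] at this
    exact this
  have h3 : φ.numLattice ≤ ⊥ := by
    rw [h.numLattice_eq, AddSubgroup.closure_le]
    rintro z ⟨x, y, rfl⟩
    have : n x = n y := by exact_mod_cast (h2 x).trans (h2 y).symm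
    simp [this]
  have h4 := AddSubgroup.mem_bot.1 (h3 hL)
  omega

theorem sumDist_of_const {X : Type} [Fintype X] {p : X → ℝ} {f : X → ℤ} (hp1 : ∑ x, p x = 1) {a : ℤ}
    (hf : ∀ x, f x = a) (N : ℕ) (k : ℤ) : sumDist p f N k = if k = N * a then 1 else 0 := by
  unfold sumDist marginal
  simp only [hf, Finset.sum_const, Finset.card_univ, Fintype.card_fin, nsmul_eq_mul, eq_comm (a := k)]
  split_ifs
  · exact sum_prod_eq_one hp1 N
  · simp

/-- Distribution of the particle number of Alice in the Gaussian state. -/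
def gaussianDist {A B : LocalSystem} (φ : PureState A B) (N : ℕ) : ℤ → ℝ :=
  marginal (fun m : Fin (N * φ.total + 1) => φ.gaussianWeight N m /
    ∑ m : Fin (N * φ.total + 1), φ.gaussianWeight N m) (fun m => ((m : ℕ) : ℤ))

theorem gaussianDist_apply {A B : LocalSystem} (φ : PureState A B) (N : ℕ)
    (m : Fin (N * φ.total + 1)) : gaussianDist φ N (m : ℕ) = φ.gaussianWeight N m /
      ∑ m : Fin (N * φ.total + 1), φ.gaussianWeight N m := by
  rw [gaussianDist, marginal, Finset.sum_eq_single m]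
  · simp
  · intro m' _ hm
    rw [if_neg]
    intro h
    exact hm (Fin.ext (by exact_mod_cast h))
  · simp

theorem gaussianDist_nonneg {A B : LocalSystem} (φ : PureState A B) (N : ℕ) (k : ℤ) :
    0 ≤ gaussianDist φ N k :=
  marginal_nonneg (fun _ => div_nonneg (φ.gaussianWeight_nonneg _ _)
    (φ.gaussianWeight_sum_pos N).le) _ _

theorem hasSchmidt_gaussian {A B : LocalSystem} (φ : PureState A B) (N : ℕ) :
    HasSchmidt (φ.gaussian N).amp (fun m : Fin (N * φ.total + 1) => φ.gaussianWeight N m /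
      ∑ m : Fin (N * φ.total + 1), φ.gaussianWeight N m) (fun m => ((m : ℕ) : ℤ)) :=
  hasSchmidt_fockSum _ _ (fun _ => div_nonneg (φ.gaussianWeight_nonneg _ _)
    (φ.gaussianWeight_sum_pos N).le) (φ.gaussianCoeff_norm N)

/-- The particle number distribution of `N` copies of a state is close to the one of the Gaussian
state. -/
theorem PureState.SchmidtData.eventually_gaussian_overlap {A B : LocalSystem} {φ : PureState A B}
    {X : Type} [Fintype X] [DecidableEq X] {p : X → ℝ} {n : X → ℕ} (h : φ.SchmidtData p n) {ε : ℝ}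
    (hε : 0 < ε) : ∀ᶠ N : ℕ in atTop, ∃ Z : Finset ℤ,
      1 - ε ≤ ∑ k ∈ Z, min (sumDist p (fun x => (n x : ℤ)) N k) (gaussianDist φ N k) := by
  classical
  obtain ⟨d, hdL⟩ := exists_generator φ.numLattice
  have hf : ∀ x y, (d : ℤ) ∣ (n x : ℤ) - n y := fun x y => by
    rw [← hdL, h.numLattice_eq]
    exact AddSubgroup.subset_closure ⟨x, y, rfl⟩
  obtain ⟨x₀⟩ : Nonempty X := by
    by_contra hX
    rw [not_nonempty_iff] at hX
    simpa using h.sum_eq_one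
  have hcond : ∀ N m : ℕ, (∀ k ∈ φ.occurring, (m : ℤ) - N * k ∈ φ.numLattice) ↔
      ∀ x, (d : ℤ) ∣ m - N * n x := by
    intro N m
    simp only [h.mem_occurring, hdL]
    constructor
    · exact fun H x => H _ ⟨x, rfl⟩
    · rintro H _ ⟨x, rfl⟩
      exact H x
  rcases Nat.eq_zero_or_pos d with rfl | hd
  -- For `d = 0` the particle number is constant. A single Gaussian weight survives the lattice
  -- condition, and both distributions are the point mass at `N * n x₀`.
  · refine Eventually.of_forall fun N => ⟨{(N : ℤ) * n x₀}, ?_⟩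
    have hconst : ∀ x, (n x : ℤ) = n x₀ := fun x => by
      have := hf x x₀
      rw [Nat.cast_zero, zero_dvd_iff] at this
      omega
    rw [Finset.sum_singleton, sumDist_of_const h.sum_eq_one hconst, if_pos rfl]
    have hlt : N * n x₀ < N * φ.total + 1 :=
      Nat.lt_succ_of_le (Nat.mul_le_mul_left N (h.le_total x₀))
    have h1 := gaussianDist_apply φ N ⟨N * n x₀, hlt⟩
    have h2 : ∑ m : Fin (N * φ.total + 1), φ.gaussianWeight N m = φ.gaussianWeight N (N * n x₀) := by
      rw [Finset.sum_eq_single ⟨N * n x₀, hlt⟩]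
      · intro m _ hm
        rw [PureState.gaussianWeight, if_neg]
        rw [hcond]
        intro H
        have := H x₀
        rw [Nat.cast_zero, zero_dvd_iff] at this
        refine hm (Fin.ext ?_)
        have h3 : ((m : ℕ) : ℤ) = ((N * n x₀ : ℕ) : ℤ) := by
          push_cast
          linarith
        exact_mod_cast h3
      · simp
    have h3 := φ.gaussianWeight_sum_pos N
    rw [h2] at h1 h3
    simp only at h1
    rw [div_self h3.ne'] at h1
    push_cast at h1
    rw [h1]
    simp [hε.le]
  · obtain ⟨η, hη, hov⟩ := exists_overlap h.pos h.sum_eq_one (fun x => (n x : ℤ)) hε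
    have hz : (d : ℤ) ∈ AddSubgroup.closure {z | ∃ x y, z = (n x : ℤ) - n y} := by
      rw [← h.numLattice_eq, hdL]
    filter_upwards [eventually_sumDist_le_gaussian h.pos h.sum_eq_one hd hf hz
      (h.variance_pos hd ((hdL _).2 dvd_rfl)) hη, eventually_gt_atTop 0] with N hN hN0
    refine hov N hN0 _ (gaussianDist_nonneg φ N) fun k => ?_
    by_cases hk : sumDist p (fun x => (n x : ℤ)) N k = 0
    · rw [hk]
      exact add_nonneg (gaussianDist_nonneg φ N _) (by positivity)
    obtain ⟨x, rfl⟩ := exists_of_sumDist_ne_zero hk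
    -- This is the support of the Gaussian state. Normalizing the local limit comparison over it
    -- gives `gaussianDist` exactly.
    set S : Finset ℤ := ((Finset.range (N * φ.total + 1)).filter
      fun m : ℕ => ∀ x, (d : ℤ) ∣ m - N * n x).map Nat.castEmbedding with hS
    have hw : ∀ m : ℕ, φ.gaussianWeight N m = if ∀ x, (d : ℤ) ∣ m - N * n x then
        Real.exp (-(((m : ℤ) : ℝ) - N * mean p (fun x => (n x : ℤ))) ^ 2 /
          (2 * (N * variance p (fun x => (n x : ℤ))))) else 0 := by
      intro m
      rw [PureState.gaussianWeight, h.mean_eq, h.variance_eq, Int.cast_natCast, mul_div_assoc]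
      by_cases hc : ∀ x, (d : ℤ) ∣ m - N * n x
      · rw [if_pos hc, if_pos ((hcond N m).2 hc)]
      · rw [if_neg hc, if_neg fun H => hc ((hcond N m).1 H)]
    have hW : ∑ m : Fin (N * φ.total + 1), φ.gaussianWeight N m = ∑ k ∈ S,
        Real.exp (-((k : ℝ) - N * mean p (fun x => (n x : ℤ))) ^ 2 /
          (2 * (N * variance p (fun x => (n x : ℤ))))) := by
      rw [Fin.sum_univ_eq_sum_range (fun m => φ.gaussianWeight N m), hS, Finset.sum_map,
        Finset.sum_filter]
      exact Finset.sum_congr rfl fun m _ => hw m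
    have hdvd : ∀ y, (d : ℤ) ∣ ((∑ j, n (x j) : ℕ) : ℤ) - N * n y := fun y => by
      push_cast
      exact dvd_sum_sub (f := fun x => (n x : ℤ)) hf x y
    have hlt : ∑ j, n (x j) < N * φ.total + 1 := by
      refine Nat.lt_succ_of_le ((Finset.sum_le_sum fun j _ => h.le_total (x j)).trans ?_)
      simp
    have hxS : ((∑ j, n (x j) : ℕ) : ℤ) ∈ S :=
      Finset.mem_map.2 ⟨_, Finset.mem_filter.2 ⟨Finset.mem_range.2 hlt, hdvd⟩, rfl⟩
    have h1 := hN S (fun k hk y => by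
      obtain ⟨m, hm, rfl⟩ := Finset.mem_map.1 hk
      exact (Finset.mem_filter.1 hm).2 y) _ hxS
    have h2 := gaussianDist_apply φ N ⟨_, hlt⟩
    simp only at h2
    rw [hW, hw, if_pos hdvd] at h2
    rw [← h2] at h1
    push_cast at h1 ⊢
    exact h1

/-- States with the same superselection induced variance and number lattice have, up to a shift,
almost the same particle number distribution in `N` copies. -/
theorem PureState.SchmidtData.eventually_shift_overlap {A B A' B' : LocalSystem}
    {φ : PureState A B} {φ' : PureState A' B'} {X : Type} [Fintype X] [DecidableEq X] {p : X → ℝ}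
    {n : X → ℕ} (h : φ.SchmidtData p n) {Y : Type} [Fintype Y] [DecidableEq Y] {q : Y → ℝ}
    {m : Y → ℕ} (h' : φ'.SchmidtData q m) (hsiv : φ.siv = φ'.siv)
    (hlat : φ.numLattice = φ'.numLattice) {ε : ℝ} (hε : 0 < ε) :
    ∀ᶠ N : ℕ in atTop, ∃ (s : ℤ) (Z : Finset ℤ), 1 - ε ≤ ∑ k ∈ Z,
      min (sumDist p (fun x => (n x : ℤ)) N k) (sumDist q (fun y => (m y : ℤ)) N (k - s)) := by
  obtain ⟨d, hdL⟩ := exists_generator φ.numLattice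
  have hf : ∀ x y, (d : ℤ) ∣ (n x : ℤ) - n y := fun x y => by
    rw [← hdL, h.numLattice_eq]
    exact AddSubgroup.subset_closure ⟨x, y, rfl⟩
  have hg : ∀ x y, (d : ℤ) ∣ (m x : ℤ) - m y := fun x y => by
    rw [← hdL, hlat, h'.numLattice_eq]
    exact AddSubgroup.subset_closure ⟨x, y, rfl⟩
  rcases Nat.eq_zero_or_pos d with rfl | hd
  · obtain ⟨x₀⟩ : Nonempty X := by
      by_contra hX
      rw [not_nonempty_iff] at hX
      simpa using h.sum_eq_one
    obtain ⟨y₀⟩ : Nonempty Y := by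
      by_contra hX
      rw [not_nonempty_iff] at hX
      simpa using h'.sum_eq_one
    refine Eventually.of_forall fun N => ⟨N * n x₀ - N * m y₀, {(N : ℤ) * n x₀}, ?_⟩
    have h1 : ∀ x, (n x : ℤ) = n x₀ := fun x => by
      have := hf x x₀
      rw [Nat.cast_zero, zero_dvd_iff] at this
      omega
    have h2 : ∀ x, (m x : ℤ) = m y₀ := fun x => by
      have := hg x y₀
      rw [Nat.cast_zero, zero_dvd_iff] at this
      omega
    rw [Finset.sum_singleton, sumDist_of_const h.sum_eq_one h1, if_pos rfl,
      sumDist_of_const h'.sum_eq_one h2, if_pos (by ring)]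
    simp [hε.le]
  · refine eventually_exists_shift_overlap h.pos h.sum_eq_one h'.pos h'.sum_eq_one hd hf ?_ hg ?_
      (h.variance_pos hd ((hdL _).2 dvd_rfl)) ?_ hε
    · rw [← h.numLattice_eq, hdL]
    · rw [← h'.numLattice_eq, ← hlat, hdL]
    · rw [h.variance_eq, h'.variance_eq, hsiv]

theorem PureState.nonempty_left {A B : LocalSystem} (φ : PureState A B) : Nonempty A :=
  let ⟨a, _, _⟩ := φ.exists_amp_ne_zero
  ⟨a⟩

theorem PureState.nonempty_right {A B : LocalSystem} (φ : PureState A B) : Nonempty B :=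
  let ⟨_, b, _⟩ := φ.exists_amp_ne_zero
  ⟨b⟩

/-! ### The asymptotic conversions -/

theorem le_marginal {X : Type} [Fintype X] {p : X → ℝ} (hp : ∀ x, 0 ≤ p x) (n : X → ℤ) (x : X) :
    p x ≤ marginal p n (n x) := by
  have := Finset.single_le_sum (f := fun y => if n y = n x then p y else 0)
    (fun y _ => by split_ifs <;> simp [hp]) (Finset.mem_univ x)
  simpa [marginal] using this

/-- Schmidt weights of `M` ebits together with another state. -/
def ebitWeight {Z : Type} (M : ℕ) (γ : Z → ℝ) (y : (Fin M → Fin 2) × Z) : ℝ :=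
  (∏ _j : Fin M, (1 / 2 : ℝ)) * γ y.2

/-- Alice's particle numbers in `M` ebits together with another state. -/
def ebitNum {Z : Type} (M : ℕ) (i : Z → ℤ) (y : (Fin M → Fin 2) × Z) : ℤ :=
  (∑ _j : Fin M, (1 : ℤ)) + i y.2

theorem marginal_ebit {Z : Type} [Fintype Z] (M : ℕ) (γ : Z → ℝ) (i : Z → ℤ) (k : ℤ) :
    marginal (ebitWeight M γ) (ebitNum M i) k = marginal γ i (k - M) := by
  have h : ∀ z, ((∑ _j : Fin M, (1 : ℤ)) + i z = k) ↔ i z = k - M := fun z => by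
    simp only [Finset.sum_const, Finset.card_univ, Fintype.card_fin, nsmul_eq_mul, mul_one]
    omega
  simp only [marginal, ebitWeight, ebitNum, Fintype.sum_prod_type, h]
  rw [Finset.sum_const, Finset.card_univ, nsmul_eq_mul, Finset.mul_sum]
  refine Finset.sum_congr rfl fun z _ => ?_
  split_ifs
  · simp
  · simp

theorem sum_ebitWeight {Z : Type} [Fintype Z] (M : ℕ) {γ : Z → ℝ} (hγ : ∑ z, γ z = 1) :
    ∑ y, ebitWeight M γ y = 1 := by
  simp [ebitWeight, Fintype.sum_prod_type, ← Finset.mul_sum, hγ]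

theorem sum_gaussianWeight_div {A B : LocalSystem} (φ : PureState A B) (N : ℕ) :
    ∑ m : Fin (N * φ.total + 1), φ.gaussianWeight N m /
      ∑ m : Fin (N * φ.total + 1), φ.gaussianWeight N m = 1 := by
  rw [← Finset.sum_div, div_self (φ.gaussianWeight_sum_pos N).ne']

theorem hasSchmidt_ebit_gaussian {A B : LocalSystem} (φ : PureState A B) (M N : ℕ) :
    HasSchmidt ((ebit.pow M).tensor (φ.gaussian N)).amp
      (ebitWeight M fun m : Fin (N * φ.total + 1) => φ.gaussianWeight N m /
        ∑ m : Fin (N * φ.total + 1), φ.gaussianWeight N m) (ebitNum M fun m => ((m : ℕ) : ℤ)) :=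
  (hasSchmidt_ebit.pow M).tensor (hasSchmidt_gaussian φ N)

theorem marginal_ebit_gaussian {A B : LocalSystem} (φ : PureState A B) (M N : ℕ) (k : ℤ) :
    marginal (ebitWeight M fun m : Fin (N * φ.total + 1) => φ.gaussianWeight N m /
      ∑ m : Fin (N * φ.total + 1), φ.gaussianWeight N m) (ebitNum M fun m => ((m : ℕ) : ℤ)) k
      = gaussianDist φ N (k - M) :=
  marginal_ebit M _ _ k

theorem two_pow_eq_exp (M : ℕ) : (2 : ℝ) ^ M = Real.exp (M * Real.log 2) := by
  rw [Real.exp_nat_mul, Real.exp_log two_pos]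

/-- Here `L = 2 ^ M`: the copies of `φ` are flat enough because `M ≤ N * (E - δ)`, while the target
has at most `2 ^ M` weights per sector. The shift `-M` accounts for Alice's particles in the ebits.
-/
theorem asymptoticallyConvertible_concentration {A B : LocalSystem} (φ : PureState A B) {δ : ℝ}
    (hδ : 0 < δ) : AsymptoticallyConvertible (fun N : ℕ => φ.pow N)
      (fun N : ℕ => (ebit.pow ⌊(N : ℝ) * (φ.entropy - δ)⌋₊).tensor (φ.gaussian N)) := by
  obtain ⟨X, _, _, p, n, h⟩ := φ.exists_schmidtData
  intro ε hε
  have hlog : 0 < Real.log 2 := Real.log_pos one_lt_two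
  have hε' : 0 < ε / 6 := by positivity
  filter_upwards [h.eventually_gaussian_overlap hε', eventually_exists_flat h.pos h.sum_eq_one
    h.le_total (show 0 < δ * Real.log 2 by positivity) hε'] with N hZ hG
  obtain ⟨Z, hZ⟩ := hZ
  set M := ⌊(N : ℝ) * (φ.entropy - δ)⌋₊ with hM
  have hpN : ∀ x : Fin N → X, 0 ≤ ∏ j, p (x j) := fun x => Finset.prod_nonneg fun _ _ => (h.pos _).le
  obtain ⟨G, hG1, hG2⟩ : ∃ G : Finset (Fin N → X), 1 - ε / 6 ≤ ∑ x ∈ G, ∏ j, p (x j) ∧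
      ∀ x ∈ G, (∏ j, p (x j)) * 2 ^ M ≤
        sumDist p (fun x => (n x : ℤ)) N (∑ j, (n (x j) : ℤ)) := by
    -- If `E < δ`, then `M = 0` and `L = 1`, and flatness only says that a weight is at most that of
    -- its sector.
    by_cases hE : φ.entropy - δ < 0
    · refine ⟨Finset.univ, by rw [sum_prod_eq_one h.sum_eq_one]; linarith, fun x _ => ?_⟩
      have : M = 0 := Nat.floor_of_nonpos
        (mul_nonpos_of_nonneg_of_nonpos (Nat.cast_nonneg N) hE.le)
      rw [this, pow_zero, mul_one]
      exact le_marginal hpN _ x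
    · obtain ⟨G, hG1, hG2⟩ := hG
      refine ⟨G, hG1, fun x hx => le_trans (mul_le_mul_of_nonneg_left ?_ (hpN x)) (hG2 x hx)⟩
      rw [two_pow_eq_exp, h.entropy_eq, Real.exp_le_exp]
      have h1 : (M : ℝ) ≤ N * (φ.entropy - δ) :=
        Nat.floor_le (mul_nonneg (Nat.cast_nonneg N) (not_lt.1 hE))
      have h2 := mul_le_mul_of_nonneg_right h1 hlog.le
      linarith
  have := ((ebit.pow M).tensor (φ.gaussian N)).nonempty_left
  have := ((ebit.pow M).tensor (φ.gaussian N)).nonempty_right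
  refine Exists.imp (fun P hP => le_trans (by linarith) hP)
    <| (h.schmidt.pow N).exists_locc_of_flat (hasSchmidt_ebit_gaussian φ M N)
    (sum_prod_eq_one h.sum_eq_one N) (sum_ebitWeight M (sum_gaussianWeight_div φ N))
    (fun _ : Unit => 1) (fun _ => zero_le_one) (by simp) (fun _ => -(M : ℤ)) (L := 2 ^ M) G
    Finset.univ (ε := ε / 6) hG2 (fun k => ?_) hG1
    (by rw [sum_ebitWeight M (sum_gaussianWeight_div φ N)]; linarith) Z ?_
  -- The sector determines the index of the Gaussian term, which leaves only the `2 ^ M` choices of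
  -- the ebits.
  · have : (Finset.univ.filter fun y : (Fin M → Fin 2) × Fin (N * φ.total + 1) =>
        ebitNum M (fun m : Fin (N * φ.total + 1) => ((m : ℕ) : ℤ)) y = k).card ≤ (Finset.univ (α := Fin M → Fin 2)).card := by
      refine Finset.card_le_card_of_injOn Prod.fst (fun _ _ => Finset.mem_coe.2 (Finset.mem_univ _)) ?_
      intro y hy y' hy' hyy
      have h1 := (Finset.mem_filter.1 (Finset.mem_coe.1 hy)).2
      have h2 := (Finset.mem_filter.1 (Finset.mem_coe.1 hy')).2
      simp only [ebitNum] at h1 h2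
      exact Prod.ext hyy (Fin.ext (by omega))
    rw [Finset.card_univ, Fintype.card_fun, Fintype.card_fin, Fintype.card_fin] at this
    exact_mod_cast this
  · refine hZ.trans (le_of_eq (Finset.sum_congr rfl fun k _ => ?_))
    rw [Fintype.sum_unique, one_mul, marginal_ebit_gaussian, sub_neg_eq_add, add_sub_cancel_right]
    rfl

/-- Now the source is exactly flat, each weight being `2 ^ (-M)` of its sector, and the whole
typical set of the target, hence its part in any sector, has at most `2 ^ M` elements. -/
theorem asymptoticallyConvertible_dilution {A B : LocalSystem} (φ : PureState A B) {δ : ℝ}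
    (hδ : 0 < δ) : AsymptoticallyConvertible
      (fun N : ℕ => (ebit.pow ⌈(N : ℝ) * (φ.entropy + δ)⌉₊).tensor (φ.gaussian N))
      (fun N : ℕ => φ.pow N) := by
  obtain ⟨X, _, _, p, n, h⟩ := φ.exists_schmidtData
  intro ε hε
  have hlog : 0 < Real.log 2 := Real.log_pos one_lt_two
  have hε' : 0 < ε / 6 := by positivity
  filter_upwards [h.eventually_gaussian_overlap hε', eventually_exists_typical h.pos h.sum_eq_one
    (show 0 < δ * Real.log 2 by positivity) hε'] with N hZ hT
  obtain ⟨Z, hZ⟩ := hZ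
  obtain ⟨T, hT1, hT2, -⟩ := hT
  set M := ⌈(N : ℝ) * (φ.entropy + δ)⌉₊ with hM
  have := (φ.pow N).nonempty_left
  have := (φ.pow N).nonempty_right
  have hL : Real.exp (N * (∑ x, Real.negMulLog (p x) + δ * Real.log 2)) ≤ 2 ^ M := by
    rw [two_pow_eq_exp, h.entropy_eq, Real.exp_le_exp]
    have h1 : N * (φ.entropy + δ) ≤ (M : ℝ) := Nat.le_ceil _
    have h2 := mul_le_mul_of_nonneg_right h1 hlog.le
    linarith
  refine Exists.imp (fun P hP => le_trans (by linarith) hP)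
    <| (hasSchmidt_ebit_gaussian φ M N).exists_locc_of_flat (h.schmidt.pow N)
    (sum_ebitWeight M (sum_gaussianWeight_div φ N)) (sum_prod_eq_one h.sum_eq_one N)
    (fun _ : Unit => 1) (fun _ => zero_le_one) (by simp) (fun _ => (M : ℤ)) (L := 2 ^ M)
    Finset.univ T (ε := ε / 6) (fun y _ => ?_) (fun k => ?_)
    (by rw [sum_ebitWeight M (sum_gaussianWeight_div φ N)]; linarith) hT1
    (Z.map (Equiv.addRight (M : ℤ)).toEmbedding) ?_
  · rw [marginal_ebit_gaussian]
    have h1 : ebitNum M (fun m : Fin (N * φ.total + 1) => ((m : ℕ) : ℤ)) y - M = (y.2 : ℕ) := by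
      simp [ebitNum]
    rw [h1, gaussianDist_apply, ebitWeight, mul_right_comm]
    simp
  · refine le_trans ?_ (hT2.trans hL)
    exact_mod_cast Finset.card_filter_le _ _
  · rw [Finset.sum_map]
    refine hZ.trans (le_of_eq (Finset.sum_congr rfl fun k _ => ?_))
    rw [marginal_ebit_gaussian, Fintype.sum_unique, one_mul]
    simp only [Equiv.coe_toEmbedding, Equiv.coe_addRight, add_sub_cancel_right]
    rw [min_comm]
    rfl

theorem sumDist_add {X : Type} [Fintype X] (p : X → ℝ) (f : X → ℤ) (a b : ℕ) (k : ℤ) :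
    sumDist p f (a + b) k
      = ∑ c : Fin a → X, (∏ j, p (c j)) * sumDist p f b (k - ∑ j, f (c j)) := by
  unfold sumDist marginal
  rw [← Equiv.sum_comp (Fin.appendEquiv a b), Fintype.sum_prod_type]
  refine Finset.sum_congr rfl fun c _ => ?_
  rw [Finset.mul_sum]
  refine Finset.sum_congr rfl fun x _ => ?_
  have h1 : (∑ j, f (x j) = k - ∑ j, f (c j)) ↔ (∑ j, f (c j) + ∑ j, f (x j) = k) := by
    constructor <;> intro h <;> linarith
  simp only [Fin.appendEquiv, Equiv.coe_fn_mk, Fin.sum_univ_add, Fin.prod_univ_add,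
    Fin.append_left, Fin.append_right, h1]
  split_ifs <;> simp

/-- A random shift does not decrease the overlap of two distributions. -/
theorem exists_overlap_mixture {C : Type} [Fintype C] (r : C → ℝ) (hr : ∀ c, 0 ≤ r c)
    (hr1 : ∑ c, r c = 1) (t : C → ℤ) (P Q : ℤ → ℝ) (hP : ∀ k, 0 ≤ P k) (hQ : ∀ k, 0 ≤ Q k)
    (Z : Finset ℤ) : ∃ Z' : Finset ℤ, ∑ k ∈ Z, min (P k) (Q k) ≤
      ∑ k ∈ Z', min (∑ c, r c * P (k - t c)) (∑ c, r c * Q (k - t c)) := by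
  classical
  -- The union of all translates of `Z` contains the overlap region of every shifted pair.
  let Z' := Finset.univ.biUnion fun c => Z.map (Equiv.addRight (t c)).toEmbedding
  refine ⟨Z', ?_⟩
  have h0 : ∀ k, 0 ≤ min (P k) (Q k) := fun k => le_min (hP k) (hQ k)
  calc ∑ k ∈ Z, min (P k) (Q k) = ∑ c, r c * ∑ k ∈ Z, min (P k) (Q k) := by
        rw [← Finset.sum_mul, hr1, one_mul]
    _ ≤ ∑ c, r c * ∑ k ∈ Z', min (P (k - t c)) (Q (k - t c)) := by
        refine Finset.sum_le_sum fun c _ => mul_le_mul_of_nonneg_left ?_ (hr c)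
        have h1 : ∑ k ∈ Z, min (P k) (Q k) = ∑ k ∈ Z.map (Equiv.addRight (t c)).toEmbedding,
            min (P (k - t c)) (Q (k - t c)) := by
          rw [Finset.sum_map]
          simp
        rw [h1]
        exact Finset.sum_le_sum_of_subset_of_nonneg
          (Finset.subset_biUnion_of_mem (fun c => Z.map (Equiv.addRight (t c)).toEmbedding)
            (Finset.mem_univ c)) fun k _ _ => h0 _
    _ ≤ _ := by
        simp only [Finset.mul_sum]
        rw [Finset.sum_comm]
        refine Finset.sum_le_sum fun k _ => le_min ?_ ?_
        · exact Finset.sum_le_sum fun c _ => mul_le_mul_of_nonneg_left (min_le_left _ _) (hr c)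
        · exact Finset.sum_le_sum fun c _ => mul_le_mul_of_nonneg_left (min_le_right _ _) (hr c)

/-- The number distribution of `N` copies is that of `N'` copies shifted by the number in the other
`N - N'` (`sumDist_add`). Shifting the target at random in the same way preserves the overlap
already known for `N'` copies. -/
theorem PureState.SchmidtData.exists_locc_pow {A B A' B' : LocalSystem}
    {φ : PureState A B} {φ' : PureState A' B'} {X : Type} [Fintype X] [DecidableEq X] {p : X → ℝ}
    {n : X → ℕ} (h : φ.SchmidtData p n) {Y : Type} [Fintype Y] [DecidableEq Y] {q : Y → ℝ}
    {m : Y → ℕ} (h' : φ'.SchmidtData q m) {N N' : ℕ} (hN : N' ≤ N) {L ε : ℝ}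
    (hG : ∃ G : Finset (Fin N → X), 1 - ε ≤ ∑ x ∈ G, ∏ j, p (x j) ∧
      ∀ x ∈ G, (∏ j, p (x j)) * L ≤ sumDist p (fun x => (n x : ℤ)) N (∑ j, (n (x j) : ℤ)))
    (hT : ∃ T : Finset (Fin N' → Y), 1 - ε ≤ ∑ y ∈ T, ∏ j, q (y j) ∧ (T.card : ℝ) ≤ L)
    (hZ : ∃ (s : ℤ) (Z : Finset ℤ), 1 - ε ≤ ∑ k ∈ Z,
      min (sumDist p (fun x => (n x : ℤ)) N' k) (sumDist q (fun y => (m y : ℤ)) N' (k - s))) :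
    ∃ P : LOCC (A'.pow N') (B'.pow N') (A.pow N) (B.pow N),
      1 - 6 * ε ≤ P.fidelity (φ'.pow N').amp (φ.pow N).amp := by
  obtain ⟨G, hG1, hG2⟩ := hG
  obtain ⟨T, hT1, hT2⟩ := hT
  obtain ⟨s, Z, hZ⟩ := hZ
  have := (φ'.pow N').nonempty_left
  have := (φ'.pow N').nonempty_right
  obtain ⟨Z', hZ'⟩ := exists_overlap_mixture (fun c : Fin (N - N') → X => ∏ j, p (c j))
    (fun c => Finset.prod_nonneg fun _ _ => (h.pos _).le) (sum_prod_eq_one h.sum_eq_one _)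
    (fun c => ∑ j, (n (c j) : ℤ)) _ _ (sumDist_nonneg h.pos (fun x => (n x : ℤ)) N')
    (fun k => sumDist_nonneg h'.pos (fun y => (m y : ℤ)) N' (k - s)) Z
  refine (h.schmidt.pow N).exists_locc_of_flat (h'.schmidt.pow N')
    (sum_prod_eq_one h.sum_eq_one N) (sum_prod_eq_one h'.sum_eq_one N')
    (fun c : Fin (N - N') → X => ∏ j, p (c j))
    (fun c => Finset.prod_nonneg fun _ _ => (h.pos _).le) (sum_prod_eq_one h.sum_eq_one _).le
    (fun c => ∑ j, (n (c j) : ℤ) + s) (L := L) G T hG2 (fun k => ?_) hG1 hT1 Z' ?_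
  · refine le_trans ?_ hT2
    exact_mod_cast Finset.card_filter_le _ _
  · refine (hZ.trans hZ').trans (le_of_eq (Finset.sum_congr rfl fun k _ => ?_))
    have h1 := sumDist_add p (fun x => (n x : ℤ)) (N - N') N' k
    rw [Nat.sub_add_cancel hN] at h1
    rw [← h1]
    simp only [sub_sub]
    rfl

/-- At zero entropy the surplus copies provide no slack for typicality, and none is needed: there is
only one Schmidt weight. -/
theorem subsingleton_of_entropy_eq_zero {X : Type} [Fintype X] {p : X → ℝ} (hp : ∀ x, 0 < p x)
    (hp1 : ∑ x, p x = 1) (h : ∑ x, Real.negMulLog (p x) = 0) : Subsingleton X := by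
  classical
  have hle : ∀ x, p x ≤ 1 := fun x => by
    rw [← hp1]
    exact Finset.single_le_sum (fun y _ => (hp y).le) (Finset.mem_univ x)
  have h1 := (Finset.sum_eq_zero_iff_of_nonneg fun x _ =>
    Real.negMulLog_nonneg (hp x).le (hle x)).1 h
  have h2 : ∀ x, p x = 1 := by
    intro x
    have := h1 x (Finset.mem_univ x)
    rw [Real.negMulLog, mul_eq_zero, neg_eq_zero] at this
    exact Real.eq_one_of_pos_of_log_eq_zero (hp x) (this.resolve_left (hp x).ne')
  refine ⟨fun x y => ?_⟩
  by_contra hxy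
  have h3 : p x + p y ≤ ∑ z, p z := by
    rw [← Finset.sum_pair hxy]
    exact Finset.sum_le_sum_of_subset_of_nonneg (Finset.subset_univ _) fun z _ _ => (hp z).le
  rw [h2, h2, hp1] at h3
  linarith

/-- Number distributions are compared for `N' = ⌊(1 - δ) * N⌋` copies on both sides, which needs `N'
→ ∞`. The cases `1 ≤ δ`, where no copy is demanded, and zero entropy are settled with `L = 1`. -/
theorem asymptoticallyConvertible_of_invariants_eq {A B A' B' : LocalSystem} (φ : PureState A B)
    (φ' : PureState A' B') (hent : φ.entropy = φ'.entropy) (hsiv : φ.siv = φ'.siv)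
    (hlat : φ.numLattice = φ'.numLattice) {δ : ℝ} (hδ : 0 < δ) :
    AsymptoticallyConvertible (fun N : ℕ => φ.pow N)
      (fun N : ℕ => φ'.pow ⌊(1 - δ) * (N : ℝ)⌋₊) := by
  obtain ⟨X, _, _, p, n, h⟩ := φ.exists_schmidtData
  obtain ⟨Y, _, _, q, m, h'⟩ := φ'.exists_schmidtData
  intro ε hε
  have hε' : 0 < ε / 6 := by positivity
  have hGtriv : ∀ N, ∃ G : Finset (Fin N → X), 1 - ε / 6 ≤ ∑ x ∈ G, ∏ j, p (x j) ∧
      ∀ x ∈ G, (∏ j, p (x j)) * 1 ≤ sumDist p (fun x => (n x : ℤ)) N (∑ j, (n (x j) : ℤ)) :=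
    fun N => ⟨Finset.univ, by rw [sum_prod_eq_one h.sum_eq_one]; linarith, fun x _ => by
      rw [mul_one]
      exact le_marginal (p := fun x : Fin N → X => ∏ j, p (x j))
        (fun x => Finset.prod_nonneg fun _ _ => (h.pos _).le) (fun x => ∑ j, (n (x j) : ℤ)) x⟩
  have hTtriv : ∀ N', Subsingleton (Fin N' → Y) → ∃ T : Finset (Fin N' → Y),
      1 - ε / 6 ≤ ∑ y ∈ T, ∏ j, q (y j) ∧ (T.card : ℝ) ≤ 1 :=
    fun N' _ => ⟨Finset.univ, by rw [sum_prod_eq_one h'.sum_eq_one]; linarith, by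
      exact_mod_cast Finset.card_le_one_of_subsingleton _⟩
  rcases le_or_gt 1 δ with hδ1 | hδ1
  · refine Eventually.of_forall fun N => ?_
    have h0 : ⌊(1 - δ) * (N : ℝ)⌋₊ = 0 := Nat.floor_of_nonpos
      (mul_nonpos_of_nonpos_of_nonneg (by linarith) (Nat.cast_nonneg N))
    have h1 : ∀ N', N' = 0 → ∃ P : LOCC (A'.pow N') (B'.pow N') (A.pow N) (B.pow N),
        1 - ε ≤ P.fidelity (φ'.pow N').amp (φ.pow N).amp := by
      rintro _ rfl
      exact Exists.imp (fun P hP => le_trans (by linarith) hP)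
        (h.exists_locc_pow h' (Nat.zero_le N) (hGtriv N) (hTtriv 0 inferInstance)
          ⟨0, {0}, by simpa [sumDist, marginal] using hε'.le⟩)
    exact h1 _ h0
  have hfloor : Tendsto (fun N : ℕ => ⌊(1 - δ) * (N : ℝ)⌋₊) atTop atTop :=
    tendsto_nat_floor_atTop.comp
      (tendsto_natCast_atTop_atTop.const_mul_atTop (sub_pos.2 hδ1))
  have hle : ∀ N : ℕ, (⌊(1 - δ) * (N : ℝ)⌋₊ : ℝ) ≤ (1 - δ) * N := fun N =>
    Nat.floor_le (mul_nonneg (sub_pos.2 hδ1).le (Nat.cast_nonneg N))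
  have hle' : ∀ N : ℕ, ⌊(1 - δ) * (N : ℝ)⌋₊ ≤ N := fun N => by
    have h1 := hle N
    have h2 : (0 : ℝ) ≤ δ * N := by positivity
    have h3 : (⌊(1 - δ) * (N : ℝ)⌋₊ : ℝ) ≤ N := by linarith
    exact_mod_cast h3
  have hov := hfloor.eventually (h.eventually_shift_overlap h' hsiv hlat hε')
  have hHH : ∑ y, Real.negMulLog (q y) = ∑ x, Real.negMulLog (p x) := by
    rw [h.entropy_eq, h'.entropy_eq, hent]
  have hH0 : 0 ≤ ∑ x, Real.negMulLog (p x) := Finset.sum_nonneg fun x _ =>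
    Real.negMulLog_nonneg (h.pos x).le (by
      rw [← h.sum_eq_one]
      exact Finset.single_le_sum (fun y _ => (h.pos y).le) (Finset.mem_univ x))
  rcases hH0.eq_or_lt with hH | hH
  · have := subsingleton_of_entropy_eq_zero h'.pos h'.sum_eq_one (hHH.trans hH.symm)
    filter_upwards [hov] with N hN
    exact Exists.imp (fun P hP => le_trans (by linarith) hP)
      (h.exists_locc_pow h' (hle' N) (hGtriv N) (hTtriv _ inferInstance) hN)
  · set H := ∑ x, Real.negMulLog (p x) with hHdef
    -- With `η = δ * H / 2` the typical target count fits the flatness of the source: `(1 - δ) * (H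
    -- + η) ≤ H - η`, with `δ ^ 2 * H / 2` to spare.
    have hη : 0 < δ * H / 2 := by positivity
    filter_upwards [hov, eventually_exists_flat h.pos h.sum_eq_one h.le_total hη hε',
      hfloor.eventually (eventually_exists_typical h'.pos h'.sum_eq_one hη hε')] with N hN hG hT
    obtain ⟨T, hT1, hT2, -⟩ := hT
    refine Exists.imp (fun P hP => le_trans (by linarith) hP)
      (h.exists_locc_pow h' (hle' N) hG ⟨T, hT1, hT2.trans ?_⟩ hN)
    · rw [Real.exp_le_exp, hHH]
      have h1 := mul_le_mul_of_nonneg_right (hle N) (show 0 ≤ H + δ * H / 2 by positivity)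
      have h2 : (1 - δ) * N * (H + δ * H / 2) ≤ N * (H - δ * H / 2) := by
        have h3 : (0 : ℝ) ≤ N * H * δ ^ 2 / 2 := by positivity
        nlinarith
      exact h1.trans h2

end SSR

end

theorem mainTheorem1 :
    (∀ (A B : SSR.LocalSystem) (φ : SSR.PureState A B) (δ : ℝ), 0 < δ →
      SSR.AsymptoticallyConvertible
        (fun N : ℕ => φ.pow N)
        (fun N : ℕ => (SSR.ebit.pow ⌊(N : ℝ) * (φ.entropy - δ)⌋₊).tensor (φ.gaussian N)) ∧
      SSR.AsymptoticallyConvertible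
        (fun N : ℕ => (SSR.ebit.pow ⌈(N : ℝ) * (φ.entropy + δ)⌉₊).tensor (φ.gaussian N))
        (fun N : ℕ => φ.pow N)) ∧
    (∀ (A B A' B' : SSR.LocalSystem) (φ : SSR.PureState A B) (φ' : SSR.PureState A' B'),
      φ.entropy = φ'.entropy → φ.siv = φ'.siv → φ.numLattice = φ'.numLattice →
      ∀ δ : ℝ, 0 < δ →
        SSR.AsymptoticallyConvertible
          (fun N : ℕ => φ.pow N)
          (fun N : ℕ => φ'.pow ⌊(1 - δ) * (N : ℝ)⌋₊)) :=
  ⟨fun _ _ φ _ hδ => ⟨SSR.asymptoticallyConvertible_concentration φ hδ,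
    SSR.asymptoticallyConvertible_dilution φ hδ⟩,
    fun _ _ _ _ φ φ' hent hsiv hlat _ hδ =>
      SSR.asymptoticallyConvertible_of_invariants_eq φ φ' hent hsiv hlat hδ⟩
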